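/- Let $n\ge 1$ and let $\gamma=(\gamma_1,\dots,\gamma_r)$ be a composition of $n$. Put $\Vert\gamma\Vert=\{\gamma_1+\cdots+\gamma_i : 1\le i<r\}$. Write $[n]=\{1,\dots,n\}$; a subset of $[n]$ is read as the tuple of its elements in increasing order, $I|J$ is concatenation of tuples, and $\ell$ of a tuple of distinct integers is its number of inversions. For a power series $f(u)=\sum_{r\ge 0} f_r u^{-r}$ and $a\in\mathbb Z$, the series $f(u+a)$ is obtained by expanding $(u+a)^{-r}=\sum_{q\ge 0}\binom{-r}{q}a^q u^{-r-q}$. **The Yangian.** $Y_n$ is the associative unital $\mathbb C$-algebra generated by $t_{ij}^{(r)}$ ($1\le i,j\le n$, $r\ge 1$) with the relations $$[t_{ij}^{(r+1)},t_{kl}^{(s)}]-[t_{ij}^{(r)},t_{kl}^{(s+1)}]=t_{kj}^{(r)}t_{il}^{(s)}-t_{kj}^{(s)}t_{il}^{(r)}\qquad(r,s\ge 0),\qquad t_{ij}^{(0)}:=\delta_{ij}.$$ With $t_{ij}(u)=\sum_{r\ge 0}t_{ij}^{(r)}u^{-r}$ it is a bialgebra via $\Delta t_{ij}(u)=\sum_k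 t_{ik}(u)\otimes t_{kj}(u)$, $\varepsilon(t_{ij}(u))=\delta_{ij}$. For $I,J\in[n]^d$ its minors are $$t^I_J(u)=\sum_{\sigma\in\mathfrak S_d}(-1)^{\ell(\sigma)}\,t_{i_{\sigma(1)}j_1}(u)\,t_{i_{\sigma(2)}j_2}(u-1)\cdots t_{i_{\sigma(d)}j_d}(u-d+1).$$ **The flag algebra.** Fix $r_0\in\{0,1\}$. $\mathcal F\ell_{Y_n}(\gamma)$ is the associative unital $\mathbb C$-algebra with generators $f_I^{(r)}$ ($I\in[n]^d$, $d\in\Vert\gamma\Vert$, $r\ge r_0$), collected in the series $f_I(u)=\sum_{r\ge r_0}f_I^{(r)}u^{-r}$, subject to the relations obtained by comparing the coefficients in the following identities, for all $d,e\in\Vert\gamma\Vert$. * Alternating: $f_{\sigma J}(u)=(-1)^{\ell(\sigma)}f_J(u)$ for $J\in[n]^d$, $\sigma\in\mathfrak S_d$. * Commuting: for $d\le e$, $I\in[n]^d$, $J\in[n]^e$, $$[f_J(u),f_I(v)]=\sum_{p=1}^{d}\frac{(-1)^{p-1}p!}{(u-v-e+1)\cdots(u-v-e+p)}\Bigl(\tbinom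 dp f_J(u)f_I(v)-\sum_{K,L} f_{i_1\cdots j_{\ell_1}\cdots j_{\ell_p}\cdots i_d}(v)\,f_{j_1\cdots i_{k_1}\cdots i_{k_p}\cdots j_e}(u)\Bigr),$$ where $K=\{k_1<\cdots<k_p\}\subseteq[d]$ and $L=\{\ell_1<\cdots<\ell_p\}\subseteq[e]$ run over all sets of $p$ positions, and the subscripts are obtained from $I$ and $J$ by interchanging $i_{k_m}$ with $j_{\ell_m}$ for $m=1,\dots,p$. Coefficients are compared after multiplication by the common denominator (equivalently, after expanding it). * Young symmetry: for $1\le p\le d\le e$, $I\in[n]^{d-p}$ and $J\subseteq[n]$ with $|J|=e+p$, $$0=\sum_{\Lambda\subseteq J,\ |\Lambda|=p}(-1)^{\ell(\Lambda|J\setminus\Lambda)}f_{I|\Lambda}(u+d)\,f_{J\setminus\Lambda}(u+e+p).$$ * Monomial straightening: for $d\le e$ and $I,J\subseteq[n]$ with $|I|=d$, $|J|=e$, $$f_J(u+e)\,f_I(u+d)=\sum_{\Lambda\subseteq J,\ |\Lambda|=e-d}(-1)^{\ell(\Lambda|J\setminus\Lambda)}f_{J\setminus\Lambda}(u+d)\,f_{\Lambda|I}(u+e).$$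 **Theorem.** There is a unique algebra homomorphism $\rho:\mathcal F\ell_{Y_n}(\gamma)\to\mathcal F\ell_{Y_n}(\gamma)\otimes Y_n$ that makes $\mathcal F\ell_{Y_n}(\gamma)$ a right $Y_n$-comodule algebra, i.e. $(\rho\otimes 1)\circ\rho=(1\otimes\Delta)\circ\rho$ and $(1\otimes\varepsilon)\circ\rho=1$, and that satisfies $$\rho(f_I(u))=\sum_{J\subseteq[n],\ |J|=d}f_J(u)\otimes t^J_I(u)\qquad\text{for all } d\in\Vert\gamma\Vert,\ I\in[n]^d$$ (coefficientwise in $u^{-1}$). -/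

import Mathlib

open scoped TensorProduct

noncomputable section

namespace YangianFlag

/-! ### Power series in `u⁻¹` and in `u⁻¹, v⁻¹` -/

section Series

/-- The series `f(u + a)`, for `f(u) = ∑ f_p u^{-p}` a power series in `u⁻¹`, obtained from the
expansion `(u + a)^{-p} = ∑_q binom(-p, q) a^q u^{-p-q}`.  The variable `X` stands for `u⁻¹`. -/
def shift {A : Type*} [Ring A] (a : ℤ) (f : PowerSeries A) : PowerSeries A :=
  PowerSeries.mk fun r => ∑ x ∈ Finset.HasAntidiagonal.antidiagonal r,
    (Ring.choose (-(x.1 : ℤ)) x.2 * a ^ x.2 : ℤ) • PowerSeries.coeff x.1 f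

/-- The series `f(u) ⊗ g(u)` with coefficients `∑_{a + b = r} f_a ⊗ g_b`. -/
def tensorSeries {A B : Type*} [Ring A] [Algebra ℂ A] [Ring B] [Algebra ℂ B]
    (f : PowerSeries A) (g : PowerSeries B) : PowerSeries (A ⊗[ℂ] B) :=
  PowerSeries.mk fun r => ∑ x ∈ Finset.HasAntidiagonal.antidiagonal r,
    PowerSeries.coeff x.1 f ⊗ₜ[ℂ] PowerSeries.coeff x.2 g

/-- Series in two commuting variables `u⁻¹` (the inner variable) and `v⁻¹` (the outer variable),
both commuting with the coefficients in `A`. -/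
abbrev Series₂ (A : Type*) := PowerSeries (PowerSeries A)

/-- `f(u)` as a series in `u⁻¹, v⁻¹`. -/
def inU {A : Type*} [Ring A] (f : PowerSeries A) : Series₂ A := PowerSeries.C f

/-- `f(v)` as a series in `u⁻¹, v⁻¹`. -/
def inV {A : Type*} [Ring A] (f : PowerSeries A) : Series₂ A :=
  PowerSeries.map (PowerSeries.C : A →+* PowerSeries A) f

/-- The coefficient of `u^{-r} v^{-s}`. -/
def coeff₂ {A : Type*} [Ring A] (r s : ℕ) (F : Series₂ A) : A :=
  PowerSeries.coeff r (PowerSeries.coeff s F)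

/-- `u⁻¹ v⁻¹ (u - v + c) = v⁻¹ - u⁻¹ + c u⁻¹ v⁻¹`. -/
def linearFactor (c : ℤ) : Series₂ ℂ :=
  PowerSeries.X - PowerSeries.C PowerSeries.X
    + c • (PowerSeries.C PowerSeries.X * PowerSeries.X)

/-- Scalar series inside the series with coefficients in the algebra `A`. -/
def scalar₂ (A : Type*) [Ring A] [Algebra ℂ A] : Series₂ ℂ →+* Series₂ A :=
  PowerSeries.map (PowerSeries.map (algebraMap ℂ A))

end Series

/-! ### Tuples and subsets -/

section Tuples

/-- The subsets of `[n]` with `d` elements. -/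
abbrev Sub (n d : ℕ) := {J : Finset (Fin n) // J.card = d}

/-- The elements of a subset, in increasing order, as a `d`-tuple. -/
def Sub.tup {n d : ℕ} (J : Sub n d) : Fin d → Fin n := J.1.orderEmbOfFin J.2

/-- The length of a tuple of distinct integers: its number of inversions, i.e. the minimal number
of adjacent swaps that sort it. -/
def len {n m : ℕ} (w : Fin m → Fin n) : ℕ :=
  (Finset.univ.filter fun x : Fin m × Fin m => x.1 < x.2 ∧ w x.2 < w x.1).card

/-- The pairs `(Λ, J ∖ Λ)` with `Λ ⊆ J`, `|Λ| = p` and `|J ∖ Λ| = q`. -/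
def splittings {n m : ℕ} (J : Sub n m) (p q : ℕ) : Finset (Sub n p × Sub n q) :=
  Finset.univ.filter fun x => x.1.1 ∪ x.2.1 = J.1 ∧ Disjoint x.1.1 x.2.1

/-- `(-1)^{ℓ(Λ | M)}`. -/
def splitSign {n p q : ℕ} (x : Sub n p × Sub n q) : ℤ :=
  (-1) ^ len (Fin.append x.1.tup x.2.tup)

/-- The tuple `(i_1, …, j_{ℓ_1}, …, j_{ℓ_p}, …, i_d)`: the entries of `I` in the positions
`K = {k_1 < ⋯ < k_p}` are replaced, in this order, by the entries of `J` in the positions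
`L = {ℓ_1 < ⋯ < ℓ_p}`. -/
def exchange {n d e p : ℕ} (I : Fin d → Fin n) (J : Fin e → Fin n) (K : Sub d p) (L : Sub e p) :
    Fin d → Fin n :=
  fun m => if h : m ∈ K.1 then J (L.tup ((K.1.orderIsoOfFin K.2).symm ⟨m, h⟩)) else I m

end Tuples

/-! ### The Yangian of `gl_n` -/

section Yangian

/-- The triple `(i, j, r)` indexes the generator `t_{ij}^{(r+1)}`. -/
abbrev YGen (n : ℕ) := Fin n × Fin n × ℕ

/-- `t_{ij}^{(r)}` in the free algebra, with `t_{ij}^{(0)} = δ_{ij}`. -/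
def freeT {n : ℕ} (i j : Fin n) : ℕ → FreeAlgebra ℂ (YGen n)
  | 0 => if i = j then 1 else 0
  | r + 1 => FreeAlgebra.ι ℂ (i, j, r)

/-- The defining relations
`[t_{ij}^{(r+1)}, t_{kl}^{(s)}] - [t_{ij}^{(r)}, t_{kl}^{(s+1)}]
  = t_{kj}^{(r)} t_{il}^{(s)} - t_{kj}^{(s)} t_{il}^{(r)}`. -/
inductive YRel (n : ℕ) : FreeAlgebra ℂ (YGen n) → FreeAlgebra ℂ (YGen n) → Prop
  | rtt (i j k l : Fin n) (r s : ℕ) : YRel n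
      ((freeT i j (r + 1) * freeT k l s - freeT k l s * freeT i j (r + 1))
        - (freeT i j r * freeT k l (s + 1) - freeT k l (s + 1) * freeT i j r))
      (freeT k j r * freeT i l s - freeT k j s * freeT i l r)

/-- The Yangian `Y_n` of `gl_n`. -/
def Yangian (n : ℕ) : Type := RingQuot (YRel n)

instance (n : ℕ) : Ring (Yangian n) := inferInstanceAs (Ring (RingQuot (YRel n)))

instance (n : ℕ) : Algebra ℂ (Yangian n) := inferInstanceAs (Algebra ℂ (RingQuot (YRel n)))

/-- The quotient map from the free algebra onto the Yangian. -/
def Yangian.mk (n : ℕ) : FreeAlgebra ℂ (YGen n) →ₐ[ℂ] Yangian n := RingQuot.mkAlgHom ℂ (YRel n)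

/-- The element `t_{ij}^{(r)}` of `Y_n`. -/
def Yangian.t {n : ℕ} (i j : Fin n) (r : ℕ) : Yangian n := Yangian.mk n (freeT i j r)

/-- `t_{ij}(u) = δ_{ij} + ∑_{r ≥ 1} t_{ij}^{(r)} u^{-r}`. -/
def Yangian.tSeries {n : ℕ} (i j : Fin n) : PowerSeries (Yangian n) :=
  PowerSeries.mk fun r => Yangian.t i j r

/-- The Yangian determinant `t^I_J(u)` with row indices `I` and column indices `J`:
`∑_σ (-1)^{ℓ(σ)} t_{i_{σ(1)} j_1}(u) t_{i_{σ(2)} j_2}(u - 1) ⋯ t_{i_{σ(d)} j_d}(u - d + 1)`. -/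
def Yangian.minor {n d : ℕ} (I J : Fin d → Fin n) : PowerSeries (Yangian n) :=
  ∑ σ : Equiv.Perm (Fin d), (Equiv.Perm.sign σ : ℤ) •
    (List.ofFn fun k : Fin d => shift (-(k : ℤ)) (Yangian.tSeries (I (σ k)) (J k))).prod

end Yangian

/-! ### The bialgebra structure of the Yangian

`Δ t_{ij}(u) = ∑_k t_{ik}(u) ⊗ t_{kj}(u)` and `ε T(u) = 1`. -/

section RTT

variable {A : Type*} [Ring A]

lemma coeff₂_ext {F G : Series₂ A} (h : ∀ r s, coeff₂ r s F = coeff₂ r s G) : F = G := by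
  ext s r
  exact h r s

lemma coeff₂_sub (r s : ℕ) (F G : Series₂ A) :
    coeff₂ r s (F - G) = coeff₂ r s F - coeff₂ r s G := by
  simp [coeff₂]

lemma coeff₂_inU_mul_inV (r s : ℕ) (f g : PowerSeries A) :
    coeff₂ r s (inU f * inV g) = PowerSeries.coeff r f * PowerSeries.coeff s g := by
  simp only [coeff₂, inU, inV, PowerSeries.coeff_C_mul, PowerSeries.coeff_map,
    PowerSeries.coeff_mul_C]

lemma coeff₂_inV_mul_inU (r s : ℕ) (f g : PowerSeries A) :
    coeff₂ r s (inV g * inU f) = PowerSeries.coeff s g * PowerSeries.coeff r f := by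
  simp only [coeff₂, inU, inV, PowerSeries.coeff_C_mul, PowerSeries.coeff_map,
    PowerSeries.coeff_mul_C]

/-- `v⁻¹`. -/
abbrev yy (A : Type*) [Ring A] : Series₂ A := PowerSeries.X

/-- `u⁻¹`. -/
abbrev xx (A : Type*) [Ring A] : Series₂ A := PowerSeries.C PowerSeries.X

lemma coeff₂_yy_succ (r s : ℕ) (F : Series₂ A) : coeff₂ r (s + 1) (yy A * F) = coeff₂ r s F := by
  simp only [coeff₂, PowerSeries.coeff_succ_X_mul]

lemma coeff₂_yy_zero (r : ℕ) (F : Series₂ A) : coeff₂ r 0 (yy A * F) = 0 := by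
  simp only [coeff₂, PowerSeries.coeff_zero_X_mul, map_zero]

lemma coeff₂_xx_succ (r s : ℕ) (F : Series₂ A) : coeff₂ (r + 1) s (xx A * F) = coeff₂ r s F := by
  simp only [coeff₂, PowerSeries.coeff_C_mul, PowerSeries.coeff_succ_X_mul]

lemma coeff₂_xx_zero (s : ℕ) (F : Series₂ A) : coeff₂ 0 s (xx A * F) = 0 := by
  simp only [coeff₂, PowerSeries.coeff_C_mul, PowerSeries.coeff_zero_X_mul]

lemma commute_yy (F : Series₂ A) : Commute (yy A) F := (PowerSeries.commute_X F).symm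

lemma commute_xx (F : Series₂ A) : Commute (xx A) F := by
  refine PowerSeries.ext fun s => ?_
  rw [PowerSeries.coeff_C_mul, PowerSeries.coeff_mul_C]
  exact PowerSeries.X_mul

/-- The defining relations of the Yangian for a matrix of series, in generating-function form. -/
def IsRTT {n : ℕ} (P : Fin n → Fin n → PowerSeries A) : Prop :=
  ∀ i j k l, (yy A - xx A) * (inU (P i j) * inV (P k l) - inV (P k l) * inU (P i j))
    = (xx A * yy A) * (inU (P k j) * inV (P i l) - inV (P k j) * inU (P i l))

/-- The defining relations of the Yangian for a matrix of series, coefficientwise. -/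
def IsRTTCoeff {n : ℕ} (P : Fin n → Fin n → ℕ → A) : Prop :=
  ∀ i j k l r s,
    (P i j (r + 1) * P k l s - P k l s * P i j (r + 1))
      - (P i j r * P k l (s + 1) - P k l (s + 1) * P i j r)
    = P k j r * P i l s - P k j s * P i l r

lemma IsRTT.coeff {n : ℕ} {P : Fin n → Fin n → PowerSeries A} (h : IsRTT P) :
    IsRTTCoeff fun i j r => PowerSeries.coeff r (P i j) := by
  intro i j k l r s
  have h1 := congrArg (coeff₂ (r + 1) (s + 1)) (h i j k l)
  simp only [sub_mul, coeff₂_sub, coeff₂_yy_succ, coeff₂_xx_succ, mul_assoc,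
    coeff₂_inU_mul_inV, coeff₂_inV_mul_inU, mul_sub] at h1
  rw [sub_sub_sub_comm, h1]

lemma isRTT_of_coeff {n : ℕ} {P : Fin n → Fin n → ℕ → A}
    (h0 : ∀ i j a, Commute (P i j 0) a) (h : IsRTTCoeff P) :
    IsRTT fun i j => PowerSeries.mk (P i j) := by
  intro i j k l
  refine coeff₂_ext fun r s => ?_
  rcases r with _ | r <;> rcases s with _ | s
  · simp only [sub_mul, coeff₂_sub, mul_assoc, mul_sub, coeff₂_yy_zero, coeff₂_xx_zero,
      sub_self]
  · simp only [sub_mul, coeff₂_sub, mul_assoc, mul_sub, coeff₂_yy_succ, coeff₂_xx_zero,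
      coeff₂_inU_mul_inV, coeff₂_inV_mul_inU, PowerSeries.coeff_mk, (h0 i j _).eq, sub_self]
  · simp only [sub_mul, coeff₂_sub, mul_assoc, mul_sub, coeff₂_yy_zero, coeff₂_xx_succ,
      coeff₂_inU_mul_inV, coeff₂_inV_mul_inU, PowerSeries.coeff_mk, (h0 k l _).eq, sub_self]
  · simp only [sub_mul, coeff₂_sub, mul_assoc, mul_sub, coeff₂_yy_succ, coeff₂_xx_succ,
      coeff₂_inU_mul_inV, coeff₂_inV_mul_inU, PowerSeries.coeff_mk]
    rw [sub_sub_sub_comm, h i j k l r s]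

lemma commute_inU_inV {f g : PowerSeries A}
    (h : ∀ r s, Commute (PowerSeries.coeff r f) (PowerSeries.coeff s g)) :
    inU f * inV g = inV g * inU f := by
  refine coeff₂_ext fun r s => ?_
  rw [coeff₂_inU_mul_inV, coeff₂_inV_mul_inU, (h r s).eq]

lemma inU_sum_mul {n : ℕ} (f g : Fin n → PowerSeries A) :
    inU (∑ a, f a * g a) = ∑ a, inU (f a) * inU (g a) := by
  simp only [inU, map_sum, map_mul]

lemma inV_sum_mul {n : ℕ} (f g : Fin n → PowerSeries A) :
    inV (∑ a, f a * g a) = ∑ a, inV (f a) * inV (g a) := by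
  simp only [inV, map_sum, map_mul]

/-- The product of two matrices satisfying the defining relations of the Yangian, with mutually
commuting entries, satisfies them as well. -/
lemma IsRTT.mul {n : ℕ} {P Q : Fin n → Fin n → PowerSeries A} (hP : IsRTT P) (hQ : IsRTT Q)
    (hPQ : ∀ i j k l r s,
      Commute (PowerSeries.coeff r (P i j)) (PowerSeries.coeff s (Q k l))) :
    IsRTT fun i j => ∑ a, P i a * Q a j := by
  have c1 : ∀ i j k l, inU (Q i j) * inV (P k l) = inV (P k l) * inU (Q i j) := fun i j k l =>
    commute_inU_inV fun r s => (hPQ k l i j s r).symm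
  have c2 : ∀ i j k l, inV (Q i j) * inU (P k l) = inU (P k l) * inV (Q i j) := fun i j k l =>
    (commute_inU_inV fun r s => hPQ k l i j r s).symm
  have sw : ∀ a b c d : Series₂ A, b * c = c * b → a * b * (c * d) = a * c * (b * d) := by
    intro a b c d hbc
    rw [mul_assoc, ← mul_assoc b, hbc, mul_assoc, mul_assoc]
  intro i j k l
  simp only [inU_sum_mul, inV_sum_mul]
  set z : Series₂ A := yy A - xx A with hz
  set w : Series₂ A := xx A * yy A with hw
  have zc : ∀ F : Series₂ A, z * F = F * z := fun F =>
    ((commute_yy F).sub_left (commute_xx F)).eq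
  have wc : ∀ F : Series₂ A, w * F = F * w := fun F =>
    ((commute_xx F).mul_left (commute_yy F)).eq
  have main : ∀ a b,
      z * (inU (P i a) * inU (Q a j) * (inV (P k b) * inV (Q b l))
        - inV (P k b) * inV (Q b l) * (inU (P i a) * inU (Q a j)))
      = w * (inU (P k a) * inV (P i b) * (inU (Q a j) * inV (Q b l))
          - inV (P k a) * inU (P i b) * (inU (Q a j) * inV (Q b l))
          + (inV (P k b) * inU (P i a) * (inU (Q b j) * inV (Q a l))
          - inV (P k b) * inU (P i a) * (inV (Q b j) * inU (Q a l)))) := by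
    intro a b
    rw [sw _ _ _ _ (c1 a j k b), sw _ _ _ _ (c2 b l i a)]
    have e1 := hP i a k b
    have e2 := hQ a j b l
    rw [← hz, ← hw] at e1 e2
    calc _ = (z * (inU (P i a) * inV (P k b) - inV (P k b) * inU (P i a)))
            * (inU (Q a j) * inV (Q b l))
          + inV (P k b) * inU (P i a)
            * (z * (inU (Q a j) * inV (Q b l) - inV (Q b l) * inU (Q a j))) := by
          rw [← mul_assoc _ z, ← zc (inV (P k b) * inU (P i a))]
          noncomm_ring
      _ = _ := by
          rw [e1, e2, ← mul_assoc _ w, ← wc (inV (P k b) * inU (P i a))]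
          noncomm_ring
  simp only [Finset.sum_mul_sum]
  have hcomm : ∑ b, ∑ a, inV (P k b) * inV (Q b l) * (inU (P i a) * inU (Q a j))
      = ∑ a, ∑ b, inV (P k b) * inV (Q b l) * (inU (P i a) * inU (Q a j)) := Finset.sum_comm
  rw [hcomm, ← Finset.sum_sub_distrib]
  simp only [← Finset.sum_sub_distrib]
  rw [Finset.mul_sum, Finset.mul_sum]
  simp only [Finset.mul_sum, main]
  simp only [← Finset.mul_sum]
  congr 1
  simp only [Finset.sum_add_distrib, Finset.sum_sub_distrib]
  have s1 : ∑ a, ∑ b, inV (P k b) * inU (P i a) * (inU (Q b j) * inV (Q a l))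
      = ∑ a, ∑ b, inV (P k a) * inU (P i b) * (inU (Q a j) * inV (Q b l)) := Finset.sum_comm
  have s2 : ∑ a, ∑ b, inV (P k b) * inU (P i a) * (inV (Q b j) * inU (Q a l))
      = ∑ a, ∑ b, inV (P k a) * inV (Q a j) * (inU (P i b) * inU (Q b l)) := by
    rw [Finset.sum_comm]
    refine Finset.sum_congr rfl fun a _ => Finset.sum_congr rfl fun b _ => ?_
    rw [sw _ _ _ _ (c2 a j i b)]
  have s3 : ∑ a, ∑ b, inU (P k a) * inU (Q a j) * (inV (P i b) * inV (Q b l))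
      = ∑ a, ∑ b, inU (P k a) * inV (P i b) * (inU (Q a j) * inV (Q b l)) :=
    Finset.sum_congr rfl fun a _ => Finset.sum_congr rfl fun b _ => sw _ _ _ _ (c1 a j i b)
  rw [s1, s2, s3]
  abel

lemma IsRTTCoeff.map {B : Type*} [Ring B] (φ : A →+* B) {n : ℕ} {P : Fin n → Fin n → ℕ → A}
    (h : IsRTTCoeff P) : IsRTTCoeff fun i j r => φ (P i j r) := by
  intro i j k l r s
  simpa only [map_sub, map_mul] using congrArg φ (h i j k l r s)

end RTT

section Comultiplication

lemma Yangian.isRTTCoeff (n : ℕ) : IsRTTCoeff fun i j r => (Yangian.t i j r : Yangian n) := by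
  intro i j k l r s
  have h := RingQuot.mkAlgHom_rel ℂ (YRel.rtt i j k l r s)
  change Yangian.mk n _ = Yangian.mk n _ at h
  simp only [map_sub, map_mul] at h
  exact h

lemma Yangian.t_zero {n : ℕ} (i j : Fin n) : Yangian.t i j 0 = if i = j then 1 else 0 := by
  unfold Yangian.t freeT
  split_ifs <;> simp

/-- A family of elements satisfying the defining relations of the Yangian gives an algebra map. -/
def Yangian.lift {B : Type*} [Ring B] [Algebra ℂ B] {n : ℕ} (P : Fin n → Fin n → ℕ → B)
    (h0 : ∀ i j, P i j 0 = if i = j then 1 else 0) (h : IsRTTCoeff P) : Yangian n →ₐ[ℂ] B :=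
  RingQuot.liftAlgHom ℂ ⟨FreeAlgebra.lift ℂ fun x : YGen n => P x.1 x.2.1 (x.2.2 + 1), by
    have key : ∀ i j r, FreeAlgebra.lift ℂ (fun x : YGen n => P x.1 x.2.1 (x.2.2 + 1))
        (freeT i j r) = P i j r := by
      intro i j r
      cases r with
      | zero => rw [h0]; unfold freeT; split_ifs <;> simp
      | succ r => simp [freeT]
    rintro _ _ ⟨i, j, k, l, r, s⟩
    simpa only [map_sub, map_mul, key] using h i j k l r s⟩

lemma Yangian.lift_t {B : Type*} [Ring B] [Algebra ℂ B] {n : ℕ} (P : Fin n → Fin n → ℕ → B)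
    (h0 : ∀ i j, P i j 0 = if i = j then 1 else 0) (h : IsRTTCoeff P) (i j : Fin n) (r : ℕ) :
    Yangian.lift P h0 h (Yangian.t i j r) = P i j r := by
  cases r with
  | zero => rw [h0, Yangian.t_zero]; split_ifs <;> simp
  | succ r =>
    unfold Yangian.lift Yangian.t Yangian.mk
    refine (RingQuot.liftAlgHom_mkAlgHom_apply ℂ _ _ _).trans ?_
    simp [freeT]

lemma Yangian.hom_ext {B : Type*} [Ring B] [Algebra ℂ B] {n : ℕ} {φ ψ : Yangian n →ₐ[ℂ] B}
    (h : ∀ i j r, φ (Yangian.t i j r) = ψ (Yangian.t i j r)) : φ = ψ := by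
  refine RingQuot.ringQuot_ext' ℂ φ ψ (FreeAlgebra.hom_ext (funext fun x => ?_))
  exact h x.1 x.2.1 (x.2.2 + 1)

/-- `Δ t_{ij}(u) = ∑_k t_{ik}(u) ⊗ t_{kj}(u)`. -/
def Yangian.comulSeries {n : ℕ} (i j : Fin n) : PowerSeries (Yangian n ⊗[ℂ] Yangian n) :=
  ∑ k, tensorSeries (Yangian.tSeries i k) (Yangian.tSeries k j)

lemma tensorSeries_eq_mul {A B : Type*} [Ring A] [Algebra ℂ A] [Ring B] [Algebra ℂ B]
    (f : PowerSeries A) (g : PowerSeries B) : tensorSeries f g =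
      PowerSeries.map (Algebra.TensorProduct.includeLeft : A →ₐ[ℂ] A ⊗[ℂ] B).toRingHom f *
      PowerSeries.map (Algebra.TensorProduct.includeRight : B →ₐ[ℂ] A ⊗[ℂ] B).toRingHom g := by
  ext r
  simp [tensorSeries, PowerSeries.coeff_mul]

lemma Yangian.comulSeries_isRTT (n : ℕ) :
    IsRTT fun i j => (Yangian.comulSeries i j : PowerSeries (Yangian n ⊗[ℂ] Yangian n)) := by
  have hL := (Yangian.isRTTCoeff n).map
    (Algebra.TensorProduct.includeLeft : Yangian n →ₐ[ℂ] Yangian n ⊗[ℂ] Yangian n).toRingHom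
  have hR := (Yangian.isRTTCoeff n).map
    (Algebra.TensorProduct.includeRight : Yangian n →ₐ[ℂ] Yangian n ⊗[ℂ] Yangian n).toRingHom
  have hL2 := isRTT_of_coeff (fun i j a => by
    rw [Yangian.t_zero]
    split_ifs
    · rw [map_one]
      exact Commute.one_left a
    · rw [map_zero]
      exact Commute.zero_left a) hL
  have hR2 := isRTT_of_coeff (fun i j a => by
    rw [Yangian.t_zero]
    split_ifs
    · rw [map_one]
      exact Commute.one_left a
    · rw [map_zero]
      exact Commute.zero_left a) hR
  have := hL2.mul hR2 (fun i j k l r s => by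
    simp [Commute, SemiconjBy])
  unfold Yangian.comulSeries
  simp only [tensorSeries_eq_mul]
  convert this using 6
  · ext r; simp [Yangian.tSeries]
  · ext r; simp [Yangian.tSeries]

lemma Yangian.coeff_comulSeries {n : ℕ} (i j : Fin n) (r : ℕ) :
    PowerSeries.coeff r (Yangian.comulSeries i j) =
      ∑ k, ∑ x ∈ Finset.HasAntidiagonal.antidiagonal r,
        Yangian.t i k x.1 ⊗ₜ[ℂ] Yangian.t k j x.2 := by
  simp [Yangian.comulSeries, tensorSeries, Yangian.tSeries]

/-- The comultiplication of the Yangian. -/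
def Yangian.comul (n : ℕ) : Yangian n →ₐ[ℂ] Yangian n ⊗[ℂ] Yangian n :=
  Yangian.lift (fun i j r => PowerSeries.coeff r (Yangian.comulSeries i j))
    (by
      intro i j
      rw [Yangian.coeff_comulSeries]
      simp [Yangian.t_zero, TensorProduct.ite_tmul, TensorProduct.tmul_ite,
        Algebra.TensorProduct.one_def])
    (Yangian.comulSeries_isRTT n).coeff

/-- The values of the counit on the generators. -/
def counitValue {n : ℕ} (i j : Fin n) (r : ℕ) : ℂ :=
  if r = 0 then (if i = j then 1 else 0) else 0

lemma counitValue_isRTTCoeff (n : ℕ) : IsRTTCoeff (counitValue : Fin n → Fin n → ℕ → ℂ) := by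
  intro i j k l r s
  unfold counitValue
  split_ifs <;> simp_all

/-- The counit of the Yangian, `ε t_{ij}^{(r)} = 0` for `r ≥ 1`. -/
def Yangian.counit (n : ℕ) : Yangian n →ₐ[ℂ] ℂ :=
  Yangian.lift counitValue (fun i j => by simp [counitValue]) (counitValue_isRTTCoeff n)

lemma Yangian.comul_t {n : ℕ} (i j : Fin n) (r : ℕ) : Yangian.comul n (Yangian.t i j r) =
    ∑ k, ∑ x ∈ Finset.HasAntidiagonal.antidiagonal r,
      Yangian.t i k x.1 ⊗ₜ[ℂ] Yangian.t k j x.2 := by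
  rw [Yangian.comul, Yangian.lift_t, Yangian.coeff_comulSeries]

lemma Yangian.counit_t {n : ℕ} (i j : Fin n) (r : ℕ) : Yangian.counit n (Yangian.t i j r) =
    if r = 0 then (if i = j then 1 else 0) else 0 := by
  rw [Yangian.counit, Yangian.lift_t, counitValue]

lemma sum_antidiagonal_triple {M : Type*} [AddCommMonoid M] (f : ℕ → ℕ → ℕ → M) (r : ℕ) :
    ∑ x ∈ Finset.HasAntidiagonal.antidiagonal r,
      ∑ y ∈ Finset.HasAntidiagonal.antidiagonal x.1, f y.1 y.2 x.2
    = ∑ x ∈ Finset.HasAntidiagonal.antidiagonal r,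
      ∑ y ∈ Finset.HasAntidiagonal.antidiagonal x.2, f x.1 y.1 y.2 := by
  rw [Finset.sum_sigma', Finset.sum_sigma']
  refine Finset.sum_nbij'
    (fun x => ⟨(x.2.1, x.2.2 + x.1.2), (x.2.2, x.1.2)⟩)
    (fun x => ⟨(x.1.1 + x.2.1, x.2.2), (x.1.1, x.2.1)⟩) ?_ ?_ ?_ ?_ ?_
  · rintro ⟨⟨a, b⟩, ⟨c, d⟩⟩ h
    simp only [Finset.mem_sigma, Finset.HasAntidiagonal.mem_antidiagonal] at h ⊢
    obtain ⟨rfl, rfl⟩ := h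
    exact ⟨by omega, trivial⟩
  · rintro ⟨⟨a, b⟩, ⟨c, d⟩⟩ h
    simp only [Finset.mem_sigma, Finset.HasAntidiagonal.mem_antidiagonal] at h ⊢
    obtain ⟨rfl, rfl⟩ := h
    exact ⟨by omega, trivial⟩
  · rintro ⟨⟨a, b⟩, ⟨c, d⟩⟩ h
    simp only [Finset.mem_sigma, Finset.HasAntidiagonal.mem_antidiagonal] at h
    obtain ⟨rfl, rfl⟩ := h
    rfl
  · rintro ⟨⟨a, b⟩, ⟨c, d⟩⟩ h
    simp only [Finset.mem_sigma, Finset.HasAntidiagonal.mem_antidiagonal] at h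
    obtain ⟨rfl, rfl⟩ := h
    rfl
  · intro x _
    rfl

lemma Yangian.coassoc (n : ℕ) :
    (Algebra.TensorProduct.assoc ℂ ℂ ℂ (Yangian n) (Yangian n) (Yangian n)).toAlgHom.comp
      ((Algebra.TensorProduct.map (Yangian.comul n) (.id ℂ (Yangian n))).comp (Yangian.comul n))
      = (Algebra.TensorProduct.map (.id ℂ (Yangian n)) (Yangian.comul n)).comp
        (Yangian.comul n) := by
  refine Yangian.hom_ext fun i j r => ?_
  simp only [AlgHom.comp_apply, Yangian.comul_t, map_sum, Algebra.TensorProduct.map_tmul,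
    TensorProduct.sum_tmul, TensorProduct.tmul_sum, AlgHom.id_apply]
  have hL : ∀ k, ∑ x ∈ Finset.HasAntidiagonal.antidiagonal r, ∑ l,
      ∑ y ∈ Finset.HasAntidiagonal.antidiagonal x.1,
        (Algebra.TensorProduct.assoc ℂ ℂ ℂ (Yangian n) (Yangian n) (Yangian n)).toAlgHom
          ((Yangian.t i l y.1 ⊗ₜ[ℂ] Yangian.t l k y.2) ⊗ₜ[ℂ] Yangian.t k j x.2)
      = ∑ l, ∑ x ∈ Finset.HasAntidiagonal.antidiagonal r,
      ∑ y ∈ Finset.HasAntidiagonal.antidiagonal x.2,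
        Yangian.t i l x.1 ⊗ₜ[ℂ] (Yangian.t l k y.1 ⊗ₜ[ℂ] Yangian.t k j y.2) := fun k => by
    rw [Finset.sum_comm]
    exact Finset.sum_congr rfl fun l _ => sum_antidiagonal_triple
      (fun a b c => Yangian.t i l a ⊗ₜ[ℂ] (Yangian.t l k b ⊗ₜ[ℂ] Yangian.t k j c)) r
  have hR : ∀ l, ∑ x ∈ Finset.HasAntidiagonal.antidiagonal r, ∑ k,
      ∑ y ∈ Finset.HasAntidiagonal.antidiagonal x.2,
        Yangian.t i l x.1 ⊗ₜ[ℂ] (Yangian.t l k y.1 ⊗ₜ[ℂ] Yangian.t k j y.2)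
      = ∑ k, ∑ x ∈ Finset.HasAntidiagonal.antidiagonal r,
      ∑ y ∈ Finset.HasAntidiagonal.antidiagonal x.2,
        Yangian.t i l x.1 ⊗ₜ[ℂ] (Yangian.t l k y.1 ⊗ₜ[ℂ] Yangian.t k j y.2) := fun l =>
    Finset.sum_comm
  refine (Finset.sum_congr rfl fun k _ => hL k).trans ?_
  refine Finset.sum_comm.trans ?_
  exact Finset.sum_congr rfl fun l _ => (hR l).symm

lemma Yangian.counit_left (n : ℕ) :
    (Algebra.TensorProduct.map (Yangian.counit n) (.id ℂ (Yangian n))).comp (Yangian.comul n)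
      = (Algebra.TensorProduct.lid ℂ (Yangian n)).symm := by
  refine Yangian.hom_ext fun i j r => ?_
  simp only [AlgHom.comp_apply, Yangian.comul_t, map_sum, Algebra.TensorProduct.map_tmul,
    AlgHom.id_apply, Yangian.counit_t]
  refine (Finset.sum_eq_single_of_mem i (Finset.mem_univ _) fun k _ hk => ?_).trans ?_
  · refine Finset.sum_eq_zero fun x _ => ?_
    simp [hk.symm]
  · refine (Finset.sum_eq_single_of_mem (0, r) (by simp) fun x hx hne => ?_).trans ?_
    · have : x.1 ≠ 0 := fun h0 => hne (by
        have := Finset.HasAntidiagonal.mem_antidiagonal.1 hx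
        ext <;> simp <;> omega)
      simp [this]
    · simp

lemma Yangian.counit_right (n : ℕ) :
    (Algebra.TensorProduct.map (.id ℂ (Yangian n)) (Yangian.counit n)).comp (Yangian.comul n)
      = (Algebra.TensorProduct.rid ℂ ℂ (Yangian n)).symm := by
  refine Yangian.hom_ext fun i j r => ?_
  simp only [AlgHom.comp_apply, Yangian.comul_t, map_sum, Algebra.TensorProduct.map_tmul,
    AlgHom.id_apply, Yangian.counit_t]
  refine (Finset.sum_eq_single_of_mem j (Finset.mem_univ _) fun k _ hk => ?_).trans ?_
  · refine Finset.sum_eq_zero fun x _ => ?_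
    simp [hk]
  · refine (Finset.sum_eq_single_of_mem (r, 0) (by simp) fun x hx hne => ?_).trans ?_
    · have : x.2 ≠ 0 := fun h0 => hne (by
        have := Finset.HasAntidiagonal.mem_antidiagonal.1 hx
        ext <;> simp <;> omega)
      simp [this]
    · simp

end Comultiplication

/-- The Yangian as a bialgebra, with `Δ t_{ij}(u) = ∑_k t_{ik}(u) ⊗ t_{kj}(u)`, `ε T(u) = 1`. -/
instance (n : ℕ) : Bialgebra ℂ (Yangian n) :=
  Bialgebra.ofAlgHom (Yangian.comul n) (Yangian.counit n) (Yangian.coassoc n)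
    (Yangian.counit_left n) (Yangian.counit_right n)

/-! ### Comodule algebras -/

/-- The algebra map `ρ : A → A ⊗ H` makes the algebra `A` a right comodule algebra over the
bialgebra `H`: it is coassociative and counital. -/
structure IsRightComoduleAlgebra {A H : Type*} [Ring A] [Algebra ℂ A] [Ring H] [Bialgebra ℂ H]
    (ρ : A →ₐ[ℂ] A ⊗[ℂ] H) : Prop where
  coassoc : (Algebra.TensorProduct.assoc ℂ ℂ ℂ A H H).toAlgHom.comp
      ((Algebra.TensorProduct.map ρ (AlgHom.id ℂ H)).comp ρ)
    = (Algebra.TensorProduct.map (AlgHom.id ℂ A) (Bialgebra.comulAlgHom ℂ H)).comp ρ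
  counit : (Algebra.TensorProduct.rid ℂ ℂ A).toAlgHom.comp
      ((Algebra.TensorProduct.map (AlgHom.id ℂ A) (Bialgebra.counitAlgHom ℂ H)).comp ρ)
    = AlgHom.id ℂ A

/-! ### The Yangian flag algebra -/

section Flag

/-- `‖γ‖`: the proper partial sums `γ_1 + ⋯ + γ_i`, `1 ≤ i < r`, of `γ = (γ_1, …, γ_r)`. -/
def flagSizes {n : ℕ} (γ : Composition n) : Set ℕ :=
  {d | ∃ i, 0 < i ∧ i < γ.length ∧ γ.sizeUpTo i = d}

/-- The generators `f_I^{(r)}`, for `I ∈ [n]^d` with `d ∈ ‖γ‖` and `r ≥ r₀`. -/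
abbrev FGen {n : ℕ} (γ : Composition n) (r₀ : ℕ) :=
  (Σ d : flagSizes γ, Fin (d : ℕ) → Fin n) × {r : ℕ // r₀ ≤ r}

/-- `f_I(u) = ∑_{r ≥ r₀} f_I^{(r)} u^{-r}` with coefficients in the free algebra. -/
def freeF {n : ℕ} (γ : Composition n) (r₀ : ℕ) {d : ℕ} (hd : d ∈ flagSizes γ)
    (I : Fin d → Fin n) : PowerSeries (FreeAlgebra ℂ (FGen γ r₀)) :=
  PowerSeries.mk fun r =>
    if h : r₀ ≤ r then FreeAlgebra.ι ℂ (⟨⟨d, hd⟩, I⟩, ⟨r, h⟩) else 0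

/-! The two sides of the relations are written for arbitrary families `f`, `g` of series, indexed
by tuples of two (possibly equal) lengths, with coefficients in an algebra `A`. -/

variable {A : Type*} [Ring A] [Algebra ℂ A]

/-- `∏_{q = p+1}^{d} (u - v - e + q)`, multiplied by `(u⁻¹ v⁻¹)^{d-p}`. -/
def denom (A : Type*) [Ring A] [Algebra ℂ A] (e p d : ℕ) : Series₂ A :=
  scalar₂ A (∏ q ∈ Finset.Icc (p + 1) d, linearFactor ((q : ℤ) - (e : ℤ)))

/-- `u⁻¹ v⁻¹`. -/
def uv (A : Type*) [Ring A] [Algebra ℂ A] : Series₂ A :=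
  scalar₂ A (PowerSeries.C PowerSeries.X * PowerSeries.X)

/-- The commutator `[g_J(u), f_I(v)]` multiplied by the common denominator
`∏_{q = 1}^{d} (u - v - e + q)` (and by `(u⁻¹ v⁻¹)^d`). -/
def commutingLHS {n d e : ℕ} (f : (Fin d → Fin n) → PowerSeries A)
    (g : (Fin e → Fin n) → PowerSeries A) (I : Fin d → Fin n) (J : Fin e → Fin n) : Series₂ A :=
  denom A e 0 d * (inU (g J) * inV (f I) - inV (f I) * inU (g J))

/-- The sum
`∑_{p=1}^{d} (-1)^{p-1} p! / ((u-v-e+1) ⋯ (u-v-e+p))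
  (binom(d,p) g_J(u) f_I(v) - ∑_{K,L} f_{i_1⋯j_{ℓ_1}⋯j_{ℓ_p}⋯i_d}(v) g_{j_1⋯i_{k_1}⋯i_{k_p}⋯j_e}(u))`,
`K` and `L` running over the `p`-element sets of positions in `I` and in `J`, multiplied by the
common denominator `∏_{q = 1}^{d} (u - v - e + q)` (and by `(u⁻¹ v⁻¹)^d`). -/
def commutingRHS {n d e : ℕ} (f : (Fin d → Fin n) → PowerSeries A)
    (g : (Fin e → Fin n) → PowerSeries A) (I : Fin d → Fin n) (J : Fin e → Fin n) : Series₂ A :=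
  ∑ p ∈ Finset.Icc 1 d, ((-1 : ℤ) ^ (p - 1) * (p.factorial : ℤ)) •
    (uv A ^ p * denom A e p d *
      ((d.choose p : ℤ) • (inU (g J) * inV (f I))
        - ∑ K : Sub d p, ∑ L : Sub e p,
            inV (f (exchange I J K L)) * inU (g (exchange J I L K))))

/-- `∑_{Λ ⊆ J, |Λ| = p} (-1)^{ℓ(Λ | J∖Λ)} f_{I|Λ}(u + d) g_{J∖Λ}(u + e + p)`, with `|I| = a`,
`d = a + p` and `|J| = p + e`. -/
def youngSum {n a p e : ℕ} (f : (Fin (a + p) → Fin n) → PowerSeries A)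
    (g : (Fin e → Fin n) → PowerSeries A) (I : Fin a → Fin n) (J : Sub n (p + e)) :
    PowerSeries A :=
  ∑ x ∈ splittings J p e, splitSign x •
    (shift ((a + p : ℕ) : ℤ) (f (Fin.append I x.1.tup)) * shift ((e + p : ℕ) : ℤ) (g x.2.tup))

/-- `g_J(u + e) f_I(u + d)`. -/
def straightenLHS {n d e : ℕ} (f : (Fin d → Fin n) → PowerSeries A)
    (g : (Fin e → Fin n) → PowerSeries A) (I : Sub n d) (J : Sub n e) : PowerSeries A :=
  shift (e : ℤ) (g J.tup) * shift (d : ℤ) (f I.tup)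

/-- `∑_{Λ ⊆ J, |Λ| = e - d} (-1)^{ℓ(Λ | J∖Λ)} f_{J∖Λ}(u + d) g_{Λ|I}(u + e)`, with `e = a + d`. -/
def straightenRHS {n a d : ℕ} (f : (Fin d → Fin n) → PowerSeries A)
    (g : (Fin (a + d) → Fin n) → PowerSeries A) (I : Sub n d) (J : Sub n (a + d)) :
    PowerSeries A :=
  ∑ x ∈ splittings J a d, splitSign x •
    (shift (d : ℤ) (f x.2.tup) * shift ((a + d : ℕ) : ℤ) (g (Fin.append x.1.tup I.tup)))

/-- The defining relations of the Yangian flag algebra: all coefficients of the alternating,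
commuting, Young symmetry and monomial straightening relations.  In the commuting relations the
denominators are cleared; they are central, and invertible in iterated Laurent series in `u⁻¹` and
`v⁻¹`, so this generates the same ideal. -/
inductive FRel {n : ℕ} (γ : Composition n) (r₀ : ℕ) :
    FreeAlgebra ℂ (FGen γ r₀) → FreeAlgebra ℂ (FGen γ r₀) → Prop
  | alternating {d : ℕ} (hd : d ∈ flagSizes γ) (J : Fin d → Fin n) (σ : Equiv.Perm (Fin d))
      (r : ℕ) : FRel γ r₀
        (PowerSeries.coeff r (freeF γ r₀ hd (J ∘ σ)))
        (PowerSeries.coeff r ((Equiv.Perm.sign σ : ℤ) • freeF γ r₀ hd J))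
  | commuting {d e : ℕ} (hd : d ∈ flagSizes γ) (he : e ∈ flagSizes γ) (hde : d ≤ e)
      (I : Fin d → Fin n) (J : Fin e → Fin n) (r s : ℕ) : FRel γ r₀
        (coeff₂ r s (commutingLHS (freeF γ r₀ hd) (freeF γ r₀ he) I J))
        (coeff₂ r s (commutingRHS (freeF γ r₀ hd) (freeF γ r₀ he) I J))
  | young {a p e : ℕ} (hp : 1 ≤ p) (hd : a + p ∈ flagSizes γ) (he : e ∈ flagSizes γ)
      (hde : a + p ≤ e) (I : Fin a → Fin n) (J : Sub n (p + e)) (r : ℕ) : FRel γ r₀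
        0
        (PowerSeries.coeff r (youngSum (freeF γ r₀ hd) (freeF γ r₀ he) I J))
  | straightening {a d : ℕ} (hd : d ∈ flagSizes γ) (he : a + d ∈ flagSizes γ)
      (I : Sub n d) (J : Sub n (a + d)) (r : ℕ) : FRel γ r₀
        (PowerSeries.coeff r (straightenLHS (freeF γ r₀ hd) (freeF γ r₀ he) I J))
        (PowerSeries.coeff r (straightenRHS (freeF γ r₀ hd) (freeF γ r₀ he) I J))

/-- The Yangian flag algebra `Fl_{Y_n}(γ)`, with generating series
`f_I(u) = ∑_{r ≥ r₀} f_I^{(r)} u^{-r}`. -/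
def FlagAlgebra {n : ℕ} (γ : Composition n) (r₀ : ℕ) : Type := RingQuot (FRel γ r₀)

instance {n : ℕ} (γ : Composition n) (r₀ : ℕ) : Ring (FlagAlgebra γ r₀) :=
  inferInstanceAs (Ring (RingQuot (FRel γ r₀)))

instance {n : ℕ} (γ : Composition n) (r₀ : ℕ) : Algebra ℂ (FlagAlgebra γ r₀) :=
  inferInstanceAs (Algebra ℂ (RingQuot (FRel γ r₀)))

/-- The quotient map from the free algebra onto the flag algebra. -/
def FlagAlgebra.mk {n : ℕ} (γ : Composition n) (r₀ : ℕ) :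
    FreeAlgebra ℂ (FGen γ r₀) →ₐ[ℂ] FlagAlgebra γ r₀ :=
  RingQuot.mkAlgHom ℂ (FRel γ r₀)

/-- The series `f_I(u)` with coefficients in the flag algebra. -/
def FlagAlgebra.f {n : ℕ} (γ : Composition n) (r₀ : ℕ) {d : ℕ} (hd : d ∈ flagSizes γ)
    (I : Fin d → Fin n) : PowerSeries (FlagAlgebra γ r₀) :=
  PowerSeries.map (FlagAlgebra.mk γ r₀).toRingHom (freeF γ r₀ hd I)

end Flag

end YangianFlag

end

open YangianFlag

/-!
Expanding the minors and using that `f_I(u)` is alternating, the prescribed value of `ρ` becomes a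
sum over all tuples `J`, not only increasing ones:
`ρ(f_I(u)) = ∑_J f_J(u) ⊗ t_{j_1 i_1}(u) t_{j_2 i_2}(u - 1) ⋯` (`sum_tensorSeries_minor`). In this
form `I` may be read as the index of a covector with entries in a ring, and the coaction is right
multiplication by `T_1(u) T_2(u - 1) ⋯ T_d(u - d + 1)`, where `T_a(u)` is the matrix `(t_{ij}(u))`
acting in the tensor factor `a`. A product of two families is a covector carrying two tuples.
Coassociativity and the counit are immediate from this formula, and uniqueness holds because the
`f_I^{(r)}` generate; the content is that the formula respects the relations (`IsFlagFamily.coact`).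
The main tool is the relation `R(u - v) T_a(u) T_b(v) = T_b(v) T_a(u) R(u - v)`, with
`R(u) = 1 - P_{ab} / u` and `P_{ab}` the transposition of two factors, and its fusion.

* Fusion. On covectors antisymmetric in the factors `1, …, m`, the product of the R-matrices between
  these factors and a further one `c`, for parameters `u, u - 1, …, u - m + 1`, collapses to a
  multiple of `z - ∑_k P_{kc}` for a scalar `z`, so this operator intertwines
  `T_1(u) ⋯ T_m(u - m + 1) T_c(v)` with `T_c(v) T_1(u) ⋯ T_m(u - m + 1)` (`fusion`). Taking for `c`
  the next factor of the string gives, by induction,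
  `A T_1(u) ⋯ T_m(u - m + 1) = T_m(u - m + 1) ⋯ T_1(u) A` for the antisymmetrizer `A`
  (`descProd_mul_altOp`). Hence fused products preserve antisymmetry.

* Young symmetry and straightening are identities `A Φ = 0` and `A Φ' = N Φ` for covectors `Φ`, `Φ'`
  built from products of two families, with `A` the antisymmetrizer over part of the positions,
  because on covectors antisymmetric in two blocks `A` is a sum over splittings
  (`altOp_apply_eq_splittings`). The shifts of the series are such that the parameters of the
  antisymmetrized positions form one string decreasing by `1`, so the two fused products combine to
  a fused product over all these positions (`altOp_descProd_descProd`), through which `A` passes.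

* The commuting relations, with denominators cleared, say that `c Φ = W Φ'`, where `Φ` and `Φ'` are
  the covectors `g_J(u) f_I(v)` and `f_I(v) g_J(u)`, `c` is a scalar, and
  `W = ∏_b (u - v - e + b - ∑_k P_{kb})`, with `b` in the block of `I` and `k` in that of `J`, is
  the R-matrix between the two blocks, fused over the block of `J`. Indeed, on covectors
  antisymmetric in the block of `I`, expanding `W` gives a sum over partial matchings of the two
  blocks (`fusedR_apply_eq_sum`), and matchings with `p` pairs correspond to two sets of `p`
  positions and a bijection, which antisymmetry turns into the factor `p!` (`fusedR_prodCov`). The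
  operator `W` intertwines the fused products of the two blocks in either order
  (`descProd_descProd_fusedR`), so the relation persists.

The operators act on covectors with entries in an arbitrary algebra over a commutative ring. For
Young symmetry and straightening this is the ring of series in `u⁻¹`; for the commuting relations it
is the ring of series in `u⁻¹, v⁻¹`, over the scalar series in these variables, where multiplication
by `u⁻¹ v⁻¹ (u - v + c)` is injective.
-/

noncomputable section

namespace YangianFlag

/-! ### Operators on covectors -/

section Operators

variable (𝕜 : Type*) {B : Type*} [CommRing 𝕜] [Ring B] [Algebra 𝕜 B] {n : ℕ}

/-- The permutation `σ` of the positions, acting on covectors. -/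
def permOp (σ : Equiv.Perm ℕ) : Module.End 𝕜 ((ℕ → Fin n) → B) where
  toFun Φ y := Φ (y ∘ σ)
  map_add' _ _ := rfl
  map_smul' _ _ := rfl

/-- The matrix `P`, acting on covectors from the right in the tensor factor `a`:
the component of `Φ T_a` at `y` is `∑_j Φ_{y(a ↦ j)} P_{j, y(a)}`. -/
def siteOp (a : ℕ) (P : Fin n → Fin n → B) : Module.End 𝕜 ((ℕ → Fin n) → B) where
  toFun Φ y := ∑ j, Φ (Function.update y a j) * P j (y a)
  map_add' _ _ := by
    ext y
    simp [add_mul, Finset.sum_add_distrib]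
  map_smul' _ _ := by
    ext y
    simp [Finset.smul_sum]

lemma permOp_apply (σ : Equiv.Perm ℕ) (Φ : (ℕ → Fin n) → B) (y : ℕ → Fin n) :
    permOp 𝕜 σ Φ y = Φ (y ∘ σ) := rfl

lemma siteOp_apply (a : ℕ) (P : Fin n → Fin n → B) (Φ : (ℕ → Fin n) → B) (y : ℕ → Fin n) :
    siteOp 𝕜 a P Φ y = ∑ j, Φ (Function.update y a j) * P j (y a) := rfl

lemma permOp_mul (σ τ : Equiv.Perm ℕ) :
    permOp 𝕜 (σ * τ) = (permOp 𝕜 σ * permOp 𝕜 τ : Module.End 𝕜 ((ℕ → Fin n) → B)) := rfl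

lemma permOp_mul_siteOp (σ : Equiv.Perm ℕ) (a : ℕ) (P : Fin n → Fin n → B) :
    permOp 𝕜 σ * siteOp 𝕜 a P = siteOp 𝕜 (σ a) P * permOp 𝕜 σ := by
  refine LinearMap.ext fun Φ => funext fun y => ?_
  simp only [Module.End.mul_apply, permOp_apply, siteOp_apply, Function.update_comp_equiv,
    Equiv.symm_apply_apply, Function.comp_apply]

lemma permOp_swap_commute_siteOp {a b c : ℕ} (P : Fin n → Fin n → B) (ha : c ≠ a) (hb : c ≠ b) :
    Commute (permOp 𝕜 (Equiv.swap a b)) (siteOp 𝕜 c P) := by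
  rw [Commute, SemiconjBy, permOp_mul_siteOp, Equiv.swap_apply_of_ne_of_ne ha hb]

/-- The relation `z [P_{ij}, Q_{kl}] = δ (P_{kj} Q_{il} - Q_{kj} P_{il})`: for `P = T(u)`,
`Q = T(v)`, `z = u - v` and `δ = 1` these are the defining relations of the Yangian. -/
def RTTRel {𝕜 : Type*} [CommRing 𝕜] [Algebra 𝕜 B] (z δ : 𝕜) (P Q : Fin n → Fin n → B) : Prop :=
  ∀ i j k l, z • (P i j * Q k l - Q k l * P i j) = δ • (P k j * Q i l - Q k j * P i l)

variable {𝕜}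

/-- The relation `R T_a(u) T_b(v) = T_b(v) T_a(u) R`, with `R` proportional to `1 - P_{ab}/(u-v)`;
as covectors are multiplied from the right, a product of operators is read from right to left. -/
lemma RTTRel.siteOp_mul_siteOp {z δ : 𝕜} {P Q : Fin n → Fin n → B} (h : RTTRel z δ P Q) {a b : ℕ}
    (hab : a ≠ b) :
    siteOp 𝕜 b Q * siteOp 𝕜 a P * (z • 1 - δ • permOp 𝕜 (Equiv.swap a b))
      = (z • 1 - δ • permOp 𝕜 (Equiv.swap a b)) * (siteOp 𝕜 a P * siteOp 𝕜 b Q) := by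
  refine LinearMap.ext fun Φ => funext fun y => ?_
  have e1 : ∀ Ψ : (ℕ → Fin n) → B, siteOp 𝕜 b Q (siteOp 𝕜 a P Ψ) y
      = ∑ j, ∑ k, Ψ (Function.update (Function.update y b k) a j)
        * (P j (y a) * Q k (y b)) := by
    intro Ψ
    simp only [siteOp_apply, Finset.sum_mul, Function.update_of_ne hab, mul_assoc]
    rw [Finset.sum_comm]
  have e2 : ∀ x, siteOp 𝕜 a P (siteOp 𝕜 b Q Φ) x
      = ∑ j, ∑ k, Φ (Function.update (Function.update x b k) a j)
        * (Q k (x b) * P j (x a)) := by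
    intro x
    simp only [siteOp_apply, Finset.sum_mul, Function.update_of_ne hab.symm, mul_assoc]
    refine Finset.sum_congr rfl fun j _ => Finset.sum_congr rfl fun k _ => ?_
    rw [Function.update_comm hab]
  simp only [Module.End.mul_apply, LinearMap.sub_apply, LinearMap.smul_apply, map_sub, map_smul,
    Module.End.one_apply, Pi.sub_apply, Pi.smul_apply, e1, e2, permOp_apply]
  rw [sub_eq_sub_iff_sub_eq_sub, ← smul_sub, ← smul_sub]
  have e3 : ∑ j, ∑ k, Φ (Function.update (Function.update y b k) a j ∘ Equiv.swap a b)
        * (P j (y a) * Q k (y b))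
      = ∑ j, ∑ k, Φ (Function.update (Function.update y b k) a j)
        * (P k (y a) * Q j (y b)) := by
    rw [Finset.sum_comm]
    refine Finset.sum_congr rfl fun j _ => Finset.sum_congr rfl fun k _ => ?_
    congr 2
    ext i
    by_cases hia : i = a
    · subst hia; simp [hab.symm]
    · by_cases hib : i = b
      · subst hib; simp [hia]
      · simp [Equiv.swap_apply_of_ne_of_ne hia hib, hia, hib]
  have e4 : ∑ j, ∑ k, Φ (Function.update (Function.update (y ∘ Equiv.swap a b) b k) a j)
        * (Q k ((y ∘ Equiv.swap a b) b) * P j ((y ∘ Equiv.swap a b) a))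
      = ∑ j, ∑ k, Φ (Function.update (Function.update y b k) a j)
        * (Q k (y a) * P j (y b)) := by
    refine Finset.sum_congr rfl fun j _ => Finset.sum_congr rfl fun k _ => ?_
    simp only [Function.comp_apply, Equiv.swap_apply_left, Equiv.swap_apply_right]
    congr 2
    ext i
    by_cases hia : i = a
    · subst hia; simp
    · by_cases hib : i = b
      · subst hib; simp [hia]
      · simp [Equiv.swap_apply_of_ne_of_ne hia hib, hia, hib]
  rw [e3, e4]
  simp only [← Finset.sum_sub_distrib, Finset.smul_sum, ← mul_sub, ← mul_smul_comm]
  refine Finset.sum_congr rfl fun j _ => Finset.sum_congr rfl fun k _ => ?_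
  rw [h j (y a) k (y b)]

end Operators

/-! ### Fusion -/

section Fusion

variable (𝕜 : Type*) {B : Type*} [CommRing 𝕜] [Ring B] [Algebra 𝕜 B] {n : ℕ}

/-- The covector `Φ` changes sign when two of the positions in `s` are interchanged. -/
def AntisymmOn (s : Set ℕ) (Φ : (ℕ → Fin n) → B) : Prop :=
  ∀ i ∈ s, ∀ j ∈ s, i ≠ j → ∀ y, Φ (y ∘ Equiv.swap i j) = -Φ y

lemma AntisymmOn.permOp_swap {s : Set ℕ} {Φ : (ℕ → Fin n) → B} (h : AntisymmOn s Φ) {i j : ℕ}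
    (hi : i ∈ s) (hj : j ∈ s) (hij : i ≠ j) : permOp 𝕜 (Equiv.swap i j) Φ = -Φ :=
  funext fun y => h i hi j hj hij y

variable {𝕜} in
lemma antisymmOn_of_permOp {s : Set ℕ} {Φ : (ℕ → Fin n) → B}
    (h : ∀ i ∈ s, ∀ j ∈ s, i ≠ j → permOp 𝕜 (Equiv.swap i j) Φ = -Φ) : AntisymmOn s Φ :=
  fun i hi j hj hij y => congrFun (h i hi j hj hij) y

lemma AntisymmOn.mono {s t : Set ℕ} {Φ : (ℕ → Fin n) → B} (h : AntisymmOn s Φ) (hst : t ⊆ s) :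
    AntisymmOn t Φ := fun i hi j hj => h i (hst hi) j (hst hj)

/-- An operator that commutes with the transpositions of `s` preserves antisymmetry on `s`. -/
lemma AntisymmOn.apply {s : Set ℕ} {Φ : (ℕ → Fin n) → B} (h : AntisymmOn s Φ)
    {X : Module.End 𝕜 ((ℕ → Fin n) → B)}
    (hX : ∀ i ∈ s, ∀ j ∈ s, i ≠ j → Commute (permOp 𝕜 (Equiv.swap i j)) X) :
    AntisymmOn s (X Φ) := by
  refine antisymmOn_of_permOp (𝕜 := 𝕜) fun i hi j hj hij => ?_
  rw [← Module.End.mul_apply, (hX i hi j hj hij).eq, Module.End.mul_apply,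
    h.permOp_swap 𝕜 hi hj hij, map_neg]

/-- Right multiplication of covectors by `T_{p 0} T_{p 1} ⋯ T_{p (m - 1)}`. -/
def descProd (p : ℕ → ℕ) (P : ℕ → Fin n → Fin n → B) : ℕ → Module.End 𝕜 ((ℕ → Fin n) → B)
  | 0 => 1
  | m + 1 => siteOp 𝕜 (p m) (P m) * descProd p P m

/-- Right multiplication of covectors by `T_{p (m - 1)} ⋯ T_{p 1} T_{p 0}`. -/
def ascProd (p : ℕ → ℕ) (P : ℕ → Fin n → Fin n → B) : ℕ → Module.End 𝕜 ((ℕ → Fin n) → B)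
  | 0 => 1
  | m + 1 => ascProd p P m * siteOp 𝕜 (p m) (P m)

/-- The sum of the transpositions of `c` with the positions `p 0, …, p (m - 1)`. -/
def swapSum (p : ℕ → ℕ) (m c : ℕ) : Module.End 𝕜 ((ℕ → Fin n) → B) :=
  ∑ k ∈ Finset.range m, permOp 𝕜 (Equiv.swap (p k) c)

/-- The antisymmetrizer in the positions `p 0, …, p (m - 1)`, built from coset representatives
of `𝔖_m` in `𝔖_{m+1}`. -/
def altOp (p : ℕ → ℕ) : ℕ → Module.End 𝕜 ((ℕ → Fin n) → B)
  | 0 => 1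
  | m + 1 => (1 - swapSum 𝕜 p m (p m)) * altOp p m

lemma commute_descProd {X : Module.End 𝕜 ((ℕ → Fin n) → B)} {p : ℕ → ℕ}
    {P : ℕ → Fin n → Fin n → B} {m : ℕ} (h : ∀ k < m, Commute X (siteOp 𝕜 (p k) (P k))) :
    Commute X (descProd 𝕜 p P m) := by
  induction m with
  | zero => exact Commute.one_right _
  | succ m ih => exact (h m (Nat.lt_succ_self m)).mul_right (ih fun k hk => h k (by omega))

lemma commute_ascProd {X : Module.End 𝕜 ((ℕ → Fin n) → B)} {p : ℕ → ℕ}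
    {P : ℕ → Fin n → Fin n → B} {m : ℕ} (h : ∀ k < m, Commute X (siteOp 𝕜 (p k) (P k))) :
    Commute X (ascProd 𝕜 p P m) := by
  induction m with
  | zero => exact Commute.one_right _
  | succ m ih => exact (ih fun k hk => h k (by omega)).mul_right (h m (Nat.lt_succ_self m))

lemma commute_swapSum {X : Module.End 𝕜 ((ℕ → Fin n) → B)} {p : ℕ → ℕ} {m c : ℕ}
    (h : ∀ k < m, Commute (permOp 𝕜 (Equiv.swap (p k) c)) X) :
    Commute (swapSum 𝕜 p m c) X :=
  Commute.sum_left _ _ _ fun k hk => h k (Finset.mem_range.1 hk)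

lemma commute_altOp {X : Module.End 𝕜 ((ℕ → Fin n) → B)} {p : ℕ → ℕ} {m : ℕ}
    (h : ∀ j < m, ∀ k < m, j ≠ k → Commute (permOp 𝕜 (Equiv.swap (p j) (p k))) X) :
    Commute (altOp 𝕜 p m) X := by
  induction m with
  | zero => exact Commute.one_left _
  | succ m ih =>
    refine Commute.mul_left ?_ (ih fun j hj k hk => h j (by omega) k (by omega))
    exact (Commute.one_left _).sub_left
      (commute_swapSum 𝕜 fun k hk => h k (by omega) m (by omega) (by omega))

lemma permOp_commute_swapSum {p : ℕ → ℕ} (hp : p.Injective) {m i j c : ℕ} (hi : i < m) (hj : j < m)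
    (hc : ∀ k < m, p k ≠ c) :
    Commute (permOp 𝕜 (Equiv.swap (p i) (p j)))
      (swapSum 𝕜 p m c : Module.End 𝕜 ((ℕ → Fin n) → B)) := by
  rw [Commute, SemiconjBy, swapSum, Finset.mul_sum, Finset.sum_mul]
  refine Finset.sum_bij' (fun k _ => Equiv.swap i j k) (fun k _ => Equiv.swap i j k) ?_ ?_ ?_ ?_ ?_
  · intro k hk
    simp only [Finset.mem_range] at hk ⊢
    rw [Equiv.swap_apply_def]; split_ifs <;> assumption
  · intro k hk
    simp only [Finset.mem_range] at hk ⊢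
    rw [Equiv.swap_apply_def]; split_ifs <;> assumption
  · intro k _; simp
  · intro k _; simp
  · intro k hk
    rw [← permOp_mul, ← permOp_mul, Equiv.mul_swap_eq_swap_mul]
    congr 3
    · rw [hp.swap_apply]
    · exact Equiv.swap_apply_of_ne_of_ne (hc i hi).symm (hc j hj).symm

/-- A transposition of `c` with a position of a block, following another one, is absorbed up to
sign by a covector antisymmetric on the block. -/
lemma permOp_swap_swap {s : Set ℕ} {Φ : (ℕ → Fin n) → B} (h : AntisymmOn s Φ) {i j c : ℕ}
    (hi : i ∈ s) (hj : j ∈ s) (hij : i ≠ j) (hc : c ≠ j) :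
    permOp 𝕜 (Equiv.swap j c) (permOp 𝕜 (Equiv.swap i c) Φ)
      = -permOp 𝕜 (Equiv.swap i c) Φ := by
  have : Equiv.swap j c * Equiv.swap i c = Equiv.swap i c * Equiv.swap i j := by
    rw [Equiv.mul_swap_eq_swap_mul (Equiv.swap i c) i j, Equiv.swap_apply_left,
      Equiv.swap_apply_of_ne_of_ne hij.symm hc.symm, Equiv.swap_comm c j]
  rw [← Module.End.mul_apply, ← permOp_mul, this, permOp_mul, Module.End.mul_apply,
    h.permOp_swap 𝕜 hi hj hij, map_neg]

lemma mem_image_Iio {p : ℕ → ℕ} {k m : ℕ} (h : k < m) : p k ∈ p '' Set.Iio m := ⟨k, h, rfl⟩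

variable {𝕜}

/-- The operator `z - δ X`. -/
def linOp (z δ : 𝕜) (X : Module.End 𝕜 ((ℕ → Fin n) → B)) : Module.End 𝕜 ((ℕ → Fin n) → B) :=
  z • 1 - δ • X

lemma linOp_apply (z δ : 𝕜) (X : Module.End 𝕜 ((ℕ → Fin n) → B)) (Φ : (ℕ → Fin n) → B) :
    linOp z δ X Φ = z • Φ - δ • X Φ := rfl

lemma commute_linOp (z δ : 𝕜) {X Y : Module.End 𝕜 ((ℕ → Fin n) → B)} (h : Commute X Y) :
    Commute (linOp z δ X) Y :=
  ((Commute.one_left Y).smul_left z).sub_left (h.smul_left δ)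

/-- On covectors antisymmetric in `p 0, …, p m`, one more R-matrix factor only extends the sum of
transpositions, up to the scalar `z`. -/
lemma collapse_step {p : ℕ → ℕ} (hp : p.Injective) {m c : ℕ} (hc : p m ≠ c) {z w δ : 𝕜}
    (hz : w = z - δ) {Φ : (ℕ → Fin n) → B} (h : AntisymmOn (p '' Set.Iio (m + 1)) Φ) :
    (linOp w δ (permOp 𝕜 (Equiv.swap (p m) c))) ((linOp z δ (swapSum 𝕜 p m c)) Φ)
      = z • (linOp w δ (swapSum 𝕜 p (m + 1) c)) Φ := by
  have key : permOp 𝕜 (Equiv.swap (p m) c) (swapSum 𝕜 p m c Φ) = -swapSum 𝕜 p m c Φ := by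
    simp only [swapSum, LinearMap.sum_apply, map_sum, ← Finset.sum_neg_distrib]
    refine Finset.sum_congr rfl fun k hk => ?_
    have hk := Finset.mem_range.1 hk
    exact permOp_swap_swap 𝕜 h (mem_image_Iio (by omega)) (mem_image_Iio (by omega))
      (hp.ne (by omega)) hc.symm
  have e : swapSum 𝕜 p (m + 1) c = (swapSum 𝕜 p m c + permOp 𝕜 (Equiv.swap (p m) c) :
      Module.End 𝕜 ((ℕ → Fin n) → B)) := Finset.sum_range_succ _ _
  simp only [e, linOp_apply, LinearMap.add_apply, map_sub, map_smul, key, hz]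
  module

/-- The exchange relation between a fused product `T_{p 0} ⋯ T_{p (m-1)}` and one more factor,
on covectors antisymmetric in the positions of the product. -/
theorem fusion {p : ℕ → ℕ} (hp : p.Injective) {c : ℕ}
    {P : ℕ → Fin n → Fin n → B} {Q : Fin n → Fin n → B} {z : ℕ → 𝕜} {δ : 𝕜}
    (hz : ∀ j, z (j + 1) = z j - δ) (m : ℕ) (hc : ∀ k < m, p k ≠ c)
    (hR : ∀ j < m, RTTRel (z (j + 1)) δ (P j) Q)
    (hzd : ∀ j < m, ∀ b : B, z j • b = 0 → b = 0)
    (hA : ∀ j ≤ m, ∀ Ψ : (ℕ → Fin n) → B, AntisymmOn (p '' Set.Iio j) Ψ →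
      AntisymmOn (p '' Set.Iio j) (descProd 𝕜 p P j Ψ))
    {Ψ : (ℕ → Fin n) → B} (hΨ : AntisymmOn (p '' Set.Iio m) Ψ) :
    siteOp 𝕜 c Q (descProd 𝕜 p P m ((linOp (z m) δ (swapSum 𝕜 p m c)) Ψ))
      = (linOp (z m) δ (swapSum 𝕜 p m c)) (descProd 𝕜 p P m (siteOp 𝕜 c Q Ψ)) := by
  induction m generalizing Ψ with
  | zero => simp [descProd, swapSum, linOp_apply]
  | succ m ih =>
    have hcm := hc m (Nat.lt_succ_self m)
    have hΨ' : AntisymmOn (p '' Set.Iio m) Ψ :=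
      hΨ.mono (Set.image_mono (Set.Iio_subset_Iio (Nat.le_succ m)))
    have ih' := ih (fun j hj => hc j (by omega)) (fun j hj => hR j (by omega))
      (fun j hj => hzd j (by omega))
      (fun j hj => hA j (by omega)) hΨ'
    have hcancel : ∀ v w : (ℕ → Fin n) → B, z m • v = z m • w → v = w := fun v w hvw =>
      funext fun y => sub_eq_zero.1 (hzd m (Nat.lt_succ_self m) _ (by
        rw [smul_sub, sub_eq_zero]; exact congrFun hvw y))
    have hQ : AntisymmOn (p '' Set.Iio (m + 1)) (siteOp 𝕜 c Q Ψ) := by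
      refine hΨ.apply 𝕜 ?_
      rintro _ ⟨i, hi, rfl⟩ _ ⟨j, hj, rfl⟩ -
      exact permOp_swap_commute_siteOp 𝕜 Q (hc i hi).symm (hc j hj).symm
    have hDQ := hA (m + 1) le_rfl _ hQ
    have c1 : Commute (linOp (z (m + 1)) δ (permOp 𝕜 (Equiv.swap (p m) c))) (descProd 𝕜 p P m) := by
      refine commute_linOp _ _ ?_
      exact commute_descProd 𝕜 fun k hk =>
        permOp_swap_commute_siteOp 𝕜 _ (hp.ne (by omega)) (hc k (by omega))
    have c2 : Commute (linOp (z m) δ (swapSum 𝕜 p m c)) (siteOp 𝕜 (p m) (P m)) := by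
      refine commute_linOp _ _ ?_
      exact commute_swapSum 𝕜 fun k hk =>
        permOp_swap_commute_siteOp 𝕜 _ (hp.ne (by omega)) hcm
    have rtt := (hR m (Nat.lt_succ_self m)).siteOp_mul_siteOp (a := p m) (b := c) hcm
    -- multiplied by `z m`, the operator splits off its last factor, which is exchanged by `rtt`
    refine hcancel _ _ ?_
    rw [← map_smul, ← map_smul, ← collapse_step hp hcm (hz m) hΨ,
      ← collapse_step hp hcm (hz m) hDQ]
    simp only [descProd, Module.End.mul_apply]
    have r1 : ∀ v, siteOp 𝕜 c Q (siteOp 𝕜 (p m) (P m)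
        ((linOp (z (m + 1)) δ (permOp 𝕜 (Equiv.swap (p m) c))) v))
        = (linOp (z (m + 1)) δ (permOp 𝕜 (Equiv.swap (p m) c)))
          (siteOp 𝕜 (p m) (P m) (siteOp 𝕜 c Q v)) := fun v => LinearMap.congr_fun rtt v
    have r2 : ∀ v, (linOp (z (m + 1)) δ (permOp 𝕜 (Equiv.swap (p m) c))) (descProd 𝕜 p P m v)
        = descProd 𝕜 p P m ((linOp (z (m + 1)) δ (permOp 𝕜 (Equiv.swap (p m) c))) v) :=
      fun v => LinearMap.congr_fun c1.eq v
    have r3 : ∀ v, (linOp (z m) δ (swapSum 𝕜 p m c)) (siteOp 𝕜 (p m) (P m) v)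
        = siteOp 𝕜 (p m) (P m) ((linOp (z m) δ (swapSum 𝕜 p m c)) v) :=
      fun v => LinearMap.congr_fun c2.eq v
    rw [← r2, r1, ih', r3]

end Fusion

/-! ### Antisymmetrizers and reversal of fused products -/

section Reversal

variable (𝕜 : Type*) {B : Type*} [CommRing 𝕜] [Ring B] [Algebra 𝕜 B] {n : ℕ}

lemma antisymmOn_altOp {p : ℕ → ℕ} (hp : p.Injective) (m : ℕ) (Φ : (ℕ → Fin n) → B) :
    AntisymmOn (p '' Set.Iio m) (altOp 𝕜 p m Φ) := by
  induction m with
  | zero => simp [AntisymmOn]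
  | succ m ih =>
    have e : altOp 𝕜 p (m + 1) Φ
        = altOp 𝕜 p m Φ - swapSum 𝕜 p m (p m) (altOp 𝕜 p m Φ) := rfl
    rw [e]
    generalize altOp 𝕜 p m Φ = Ψ at ih
    clear e
    -- the transposition of the last position with an earlier one
    have last : ∀ a < m, permOp 𝕜 (Equiv.swap (p a) (p m)) (Ψ - swapSum 𝕜 p m (p m) Ψ)
        = -(Ψ - swapSum 𝕜 p m (p m) Ψ) := by
      intro a ha
      have ha' := Finset.mem_range.2 ha
      simp only [swapSum, LinearMap.sum_apply, map_sub, map_sum]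
      rw [← Finset.add_sum_erase _ _ ha', ← Finset.add_sum_erase _ _ ha',
        ← Module.End.mul_apply, ← permOp_mul, Equiv.swap_mul_self,
        Finset.sum_congr rfl fun k hk => permOp_swap_swap 𝕜 ih
          (mem_image_Iio (Finset.mem_range.1 (Finset.mem_of_mem_erase hk)))
          (mem_image_Iio ha) (hp.ne (Finset.ne_of_mem_erase hk)) (hp.ne ha.ne')]
      have h1 : permOp 𝕜 1 Ψ = Ψ := rfl
      rw [h1, Finset.sum_neg_distrib]
      abel
    refine antisymmOn_of_permOp (𝕜 := 𝕜) ?_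
    rintro _ ⟨i, hi, rfl⟩ _ ⟨j, hj, rfl⟩ hij
    have hi := Set.mem_Iio.1 hi
    have hj := Set.mem_Iio.1 hj
    rcases Nat.lt_succ_iff_lt_or_eq.1 hi with hi | rfl <;>
      rcases Nat.lt_succ_iff_lt_or_eq.1 hj with hj | rfl
    · have hc := permOp_commute_swapSum (𝕜 := 𝕜) (B := B) (n := n) hp hi hj (c := p m)
        fun k hk => hp.ne hk.ne
      rw [map_sub, ← Module.End.mul_apply, hc.eq, Module.End.mul_apply,
        ih.permOp_swap 𝕜 (mem_image_Iio hi) (mem_image_Iio hj) hij, map_neg]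
      abel
    · exact last i hi
    · rw [Equiv.swap_comm]
      exact last j hj
    · exact absurd rfl hij

lemma altOp_apply_of_antisymmOn {p : ℕ → ℕ} (hp : p.Injective) {m : ℕ} {Φ : (ℕ → Fin n) → B}
    (h : AntisymmOn (p '' Set.Iio m) Φ) : altOp 𝕜 p m Φ = (m.factorial : 𝕜) • Φ := by
  induction m with
  | zero => simp [altOp]
  | succ m ih =>
    have e : swapSum 𝕜 p m (p m) Φ = -((m : 𝕜) • Φ) := by
      rw [swapSum, LinearMap.sum_apply, Finset.sum_congr rfl fun k hk => h.permOp_swap 𝕜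
        (mem_image_Iio (Nat.lt_succ_of_lt (Finset.mem_range.1 hk)))
        (mem_image_Iio (Nat.lt_succ_self m)) (hp.ne (Finset.mem_range.1 hk).ne)]
      rw [Finset.sum_const, Finset.card_range, ← Nat.cast_smul_eq_nsmul 𝕜, smul_neg]
    rw [altOp, Module.End.mul_apply,
      ih (h.mono (Set.image_mono (Set.Iio_subset_Iio (Nat.le_succ m)))), map_smul,
      LinearMap.sub_apply, e, Module.End.one_apply, Nat.factorial_succ]
    push_cast
    module

/-- An operator that changes sign under right multiplication by the transpositions of a block
absorbs the antisymmetrizer of the block. -/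
lemma mul_altOp_of_antisymm {p : ℕ → ℕ} {m : ℕ}
    {X : Module.End 𝕜 ((ℕ → Fin n) → B)}
    (h : ∀ i < m, ∀ j < m, i ≠ j → X * permOp 𝕜 (Equiv.swap (p i) (p j)) = -X) :
    X * altOp 𝕜 p m = (m.factorial : 𝕜) • X := by
  induction m with
  | zero => simp [altOp]
  | succ m ih =>
    have e : X * swapSum 𝕜 p m (p m) = -((m : 𝕜) • X) := by
      rw [swapSum, Finset.mul_sum, Finset.sum_congr rfl fun k hk =>
        h k (Nat.lt_succ_of_lt (Finset.mem_range.1 hk)) m (Nat.lt_succ_self m)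
          (Finset.mem_range.1 hk).ne]
      rw [Finset.sum_const, Finset.card_range, ← Nat.cast_smul_eq_nsmul 𝕜, smul_neg]
    rw [altOp, ← mul_assoc, mul_sub, mul_one, e, sub_neg_eq_add, add_mul, smul_mul_assoc,
      ih fun i hi j hj => h i (by omega) j (by omega), Nat.factorial_succ]
    push_cast
    module

/-- The embedding of `Fin m` as the positions `p 0, …, p (m - 1)`. -/
def posEmb {p : ℕ → ℕ} (hp : p.Injective) (m : ℕ) : Fin m ↪ ℕ :=
  ⟨fun k => p k, fun _ _ h => Fin.ext (hp h)⟩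

lemma viaEmbedding_swap {p : ℕ → ℕ} (hp : p.Injective) {m : ℕ} (i j : Fin m) :
    (Equiv.swap i j).viaEmbedding (posEmb hp m) = Equiv.swap (p i) (p j) := by
  ext x
  by_cases hx : x ∈ Set.range (posEmb hp m)
  · obtain ⟨k, rfl⟩ := hx
    rw [Equiv.Perm.viaEmbedding_apply]
    change (posEmb hp m) _ = Equiv.swap (posEmb hp m i) (posEmb hp m j) _
    rw [(posEmb hp m).injective.swap_apply]
  · rw [Equiv.Perm.viaEmbedding_apply_of_notMem _ _ _ hx, Equiv.swap_apply_of_ne_of_ne]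
    · rintro rfl; exact hx ⟨i, rfl⟩
    · rintro rfl; exact hx ⟨j, rfl⟩

lemma viaEmbedding_mul {α β : Type*} (e : α ↪ β) (σ τ : Equiv.Perm α) :
    (σ * τ).viaEmbedding e = σ.viaEmbedding e * τ.viaEmbedding e :=
  map_mul (Equiv.Perm.viaEmbeddingHom e) σ τ

lemma AntisymmOn.permOp_viaEmbedding {p : ℕ → ℕ} (hp : p.Injective) {m : ℕ}
    {Φ : (ℕ → Fin n) → B} (h : AntisymmOn (p '' Set.Iio m) Φ) (σ : Equiv.Perm (Fin m)) :
    permOp 𝕜 (σ.viaEmbedding (posEmb hp m)) Φ = (Equiv.Perm.sign σ : ℤ) • Φ := by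
  induction σ using Equiv.Perm.swap_induction_on with
  | one =>
    have : (1 : Equiv.Perm (Fin m)).viaEmbedding (posEmb hp m) = 1 :=
      map_one (Equiv.Perm.viaEmbeddingHom (posEmb hp m))
    rw [this]
    simp [permOp]
  | swap_mul σ x y hxy ih =>
    rw [viaEmbedding_mul, permOp_mul, Module.End.mul_apply, ih, viaEmbedding_swap, map_zsmul,
      h.permOp_swap 𝕜 (mem_image_Iio x.2) (mem_image_Iio y.2)
        (hp.ne fun hh => hxy (Fin.ext hh)), Equiv.Perm.sign_mul, Equiv.Perm.sign_swap hxy]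
    simp

/-- The antisymmetrizer as the signed sum over all permutations of the positions. -/
def signedSum {p : ℕ → ℕ} (hp : p.Injective) (m : ℕ) : Module.End 𝕜 ((ℕ → Fin n) → B) :=
  ∑ σ : Equiv.Perm (Fin m), (Equiv.Perm.sign σ : ℤ) • permOp 𝕜 (σ.viaEmbedding (posEmb hp m))

lemma signedSum_mul_permOp {p : ℕ → ℕ} (hp : p.Injective) {m i j : ℕ} (hi : i < m) (hj : j < m)
    (hij : i ≠ j) : signedSum 𝕜 hp m * permOp 𝕜 (Equiv.swap (p i) (p j))
      = -(signedSum 𝕜 hp m : Module.End 𝕜 ((ℕ → Fin n) → B)) := by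
  have hs : Equiv.swap (⟨i, hi⟩ : Fin m) ⟨j, hj⟩ ≠ 1 := fun h => hij (by
    simpa using Equiv.swap_eq_one_iff.1 h)
  have hne : (⟨i, hi⟩ : Fin m) ≠ ⟨j, hj⟩ := fun h => hij (by simpa using h)
  rw [signedSum, Finset.sum_mul, ← Finset.sum_neg_distrib]
  refine Fintype.sum_equiv (Equiv.mulRight (Equiv.swap (⟨i, hi⟩ : Fin m) ⟨j, hj⟩)) _ _ fun σ => ?_
  rw [Equiv.coe_mulRight, viaEmbedding_mul, viaEmbedding_swap, permOp_mul, Equiv.Perm.sign_mul,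
    Equiv.Perm.sign_swap hne, smul_mul_assoc]
  simp

variable {𝕜}

lemma smul_left_cancel_fun {c : 𝕜} (hc : ∀ b : B, c • b = 0 → b = 0) {v w : (ℕ → Fin n) → B}
    (h : c • v = c • w) : v = w :=
  funext fun y => sub_eq_zero.1 (hc _ (by rw [smul_sub, sub_eq_zero]; exact congrFun h y))

lemma eq_zero_of_natCast_smul [IsAddTorsionFree B] {N : ℕ} (hN : N ≠ 0) (b : B)
    (h : (N : 𝕜) • b = 0) : b = 0 := by
  rw [Nat.cast_smul_eq_nsmul] at h
  exact (nsmul_eq_zero_iff.1 h).resolve_right hN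

lemma altOp_eq_signedSum [IsAddTorsionFree B] {p : ℕ → ℕ} (hp : p.Injective) (m : ℕ) :
    (altOp 𝕜 p m : Module.End 𝕜 ((ℕ → Fin n) → B)) = signedSum 𝕜 hp m := by
  refine LinearMap.ext fun Φ => smul_left_cancel_fun
    (eq_zero_of_natCast_smul (𝕜 := 𝕜) m.factorial_ne_zero) ?_
  have h1 : signedSum 𝕜 hp m (altOp 𝕜 p m Φ) = (m.factorial : 𝕜) • altOp 𝕜 p m Φ := by
    have := (antisymmOn_altOp 𝕜 hp m Φ).permOp_viaEmbedding 𝕜 hp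
    rw [signedSum, LinearMap.sum_apply]
    simp only [LinearMap.smul_apply, this, smul_smul]
    simp only [← Units.val_mul, Int.units_mul_self, Units.val_one, one_smul, Finset.sum_const,
      Finset.card_univ, Fintype.card_perm, Fintype.card_fin, Nat.cast_smul_eq_nsmul]
  have h2 := LinearMap.congr_fun (mul_altOp_of_antisymm 𝕜 (m := m) fun i hi j hj hij =>
    signedSum_mul_permOp 𝕜 (B := B) (n := n) (m := m) hp hi hj hij) Φ
  rw [← h1, ← Module.End.mul_apply, h2, LinearMap.smul_apply]

lemma altOp_mul_permOp [IsAddTorsionFree B] {p : ℕ → ℕ} (hp : p.Injective) {m i j : ℕ}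
    (hi : i < m) (hj : j < m) (hij : i ≠ j) : altOp 𝕜 p m * permOp 𝕜 (Equiv.swap (p i) (p j))
      = -(altOp 𝕜 p m : Module.End 𝕜 ((ℕ → Fin n) → B)) := by
  rw [altOp_eq_signedSum hp, signedSum_mul_permOp 𝕜 hp hi hj hij]

lemma altOp_apply_eq_sum [IsAddTorsionFree B] {p : ℕ → ℕ} (hp : p.Injective) (m : ℕ)
    (Φ : (ℕ → Fin n) → B) (y : ℕ → Fin n) : altOp 𝕜 p m Φ y = ∑ σ : Equiv.Perm (Fin m),
      (Equiv.Perm.sign σ : ℤ) • Φ (y ∘ σ.viaEmbedding (posEmb hp m)) := by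
  rw [altOp_eq_signedSum hp, signedSum]
  simp [LinearMap.sum_apply, permOp_apply]

/-- Consecutive factors `T(u), T(u - 1), T(u - 2), …`. -/
def IsDescending (𝕜 : Type*) [CommRing 𝕜] [Algebra 𝕜 B] (P : ℕ → Fin n → Fin n → B) : Prop :=
  ∀ i j, i < j → RTTRel (((j - i : ℕ) : 𝕜)) 1 (P i) (P j)

lemma IsDescending.shift {P : ℕ → Fin n → Fin n → B} (h : IsDescending 𝕜 P) (a : ℕ) :
    IsDescending 𝕜 fun k => P (a + k) := fun i j hij => by
  have := h (a + i) (a + j) (by omega)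
  rwa [Nat.add_sub_add_left] at this

lemma antisymmOn_of_reversal [IsAddTorsionFree B] {p : ℕ → ℕ} (hp : p.Injective)
    {P : ℕ → Fin n → Fin n → B} {m : ℕ}
    (h : descProd 𝕜 p P m * altOp 𝕜 p m = altOp 𝕜 p m * ascProd 𝕜 p P m)
    {Ψ : (ℕ → Fin n) → B} (hΨ : AntisymmOn (p '' Set.Iio m) Ψ) :
    AntisymmOn (p '' Set.Iio m) (descProd 𝕜 p P m Ψ) := by
  have e : (m.factorial : 𝕜) • descProd 𝕜 p P m Ψ = altOp 𝕜 p m (ascProd 𝕜 p P m Ψ) := by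
    rw [← map_smul, ← altOp_apply_of_antisymmOn 𝕜 hp hΨ]
    exact LinearMap.congr_fun h Ψ
  refine antisymmOn_of_permOp (𝕜 := 𝕜) fun i hi j hj hij =>
    smul_left_cancel_fun (eq_zero_of_natCast_smul (𝕜 := 𝕜) m.factorial_ne_zero) ?_
  rw [← map_smul, smul_neg, e]
  exact (antisymmOn_altOp 𝕜 hp m _).permOp_swap 𝕜 hi hj hij

/-- The identity `A T_1(u) T_2(u-1) ⋯ T_m(u-m+1) = T_m(u-m+1) ⋯ T_1(u) A`. -/
theorem descProd_mul_altOp [IsAddTorsionFree B] {p : ℕ → ℕ} (hp : p.Injective)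
    {P : ℕ → Fin n → Fin n → B}
    (hP : IsDescending 𝕜 P) (m : ℕ) :
    descProd 𝕜 p P m * altOp 𝕜 p m = altOp 𝕜 p m * ascProd 𝕜 p P m := by
  induction m using Nat.strong_induction_on with
  | _ m ih =>
  rcases m with _ | m
  · rfl
  have fus := fun Φ : (ℕ → Fin n) → B => fusion (𝕜 := 𝕜) hp (c := p m) (P := P) (Q := P m)
    (z := fun j => (m : 𝕜) + 1 - j) (δ := 1) (fun j => by push_cast; ring) m
    (fun k hk => hp.ne hk.ne)
    (fun j hj => by
      have := hP j m hj
      rw [Nat.cast_sub hj.le] at this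
      push_cast
      convert this using 1
      ring)
    (fun j hj b hb => by
      refine eq_zero_of_natCast_smul (𝕜 := 𝕜) (N := m + 1 - j) (by omega) b ?_
      rw [Nat.cast_sub (by omega)]
      exact_mod_cast hb)
    (fun j hj Ψ hΨ => antisymmOn_of_reversal hp (ih j (by omega)) hΨ)
    (antisymmOn_altOp 𝕜 hp m Φ)
  have e : ∀ v, linOp ((m : 𝕜) + 1 - m) 1 (swapSum 𝕜 p m (p m)) v
      = (1 - swapSum 𝕜 p m (p m) : Module.End 𝕜 ((ℕ → Fin n) → B)) v := by
    intro v
    simp [linOp_apply]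
  have hcomm : Commute (altOp 𝕜 p m) (siteOp 𝕜 (p m) (P m)) := commute_altOp 𝕜 fun i hi j hj _ =>
    permOp_swap_commute_siteOp 𝕜 _ (hp.ne hi.ne') (hp.ne hj.ne')
  refine LinearMap.ext fun Φ => ?_
  have fus := fus Φ
  rw [e, e] at fus
  have ihm := LinearMap.congr_fun (ih m (Nat.lt_succ_self m)) (siteOp 𝕜 (p m) (P m) Φ)
  have hcomm := LinearMap.congr_fun hcomm.eq Φ
  simp only [Module.End.mul_apply] at ihm hcomm
  simp only [descProd, altOp, ascProd, Module.End.mul_apply]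
  rw [fus, ← hcomm, ihm]

lemma AntisymmOn.descProd [IsAddTorsionFree B] {p : ℕ → ℕ} (hp : p.Injective)
    {P : ℕ → Fin n → Fin n → B}
    (hP : IsDescending 𝕜 P) {m : ℕ} {Ψ : (ℕ → Fin n) → B} (hΨ : AntisymmOn (p '' Set.Iio m) Ψ) :
    AntisymmOn (p '' Set.Iio m) (descProd 𝕜 p P m Ψ) :=
  antisymmOn_of_reversal hp (descProd_mul_altOp hp hP m) hΨ

lemma ascProd_add (p : ℕ → ℕ) (P : ℕ → Fin n → Fin n → B) (a b : ℕ) :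
    ascProd 𝕜 p P (a + b)
      = ascProd 𝕜 p P a * ascProd 𝕜 (fun k => p (a + k)) (fun k => P (a + k)) b := by
  induction b with
  | zero => simp [ascProd]
  | succ b ih => rw [← add_assoc, ascProd, ascProd, ih, mul_assoc]

lemma descProd_add (p : ℕ → ℕ) (P : ℕ → Fin n → Fin n → B) (a b : ℕ) :
    descProd 𝕜 p P (a + b)
      = descProd 𝕜 (fun k => p (a + k)) (fun k => P (a + k)) b * descProd 𝕜 p P a := by
  induction b with
  | zero => simp [descProd]
  | succ b ih => rw [← add_assoc, descProd, descProd, ih, mul_assoc]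

/-- Two fused products whose parameters together form one descending string, applied in the wrong
order: after antisymmetrization over all positions they become the fused product of the whole
string, because the antisymmetrizer reverses each of the two products and then the string. -/
theorem altOp_descProd_descProd [IsAddTorsionFree B] {r : ℕ → ℕ} (hr : r.Injective)
    {P : ℕ → Fin n → Fin n → B}
    (hP : IsDescending 𝕜 P) {a b : ℕ} {Ψ : (ℕ → Fin n) → B}
    (h1 : AntisymmOn (r '' Set.Iio a) Ψ)
    (h2 : AntisymmOn ((fun k => r (a + k)) '' Set.Iio b) Ψ) :
    altOp 𝕜 r (a + b) (descProd 𝕜 r P a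
        (descProd 𝕜 (fun k => r (a + k)) (fun k => P (a + k)) b Ψ))
      = descProd 𝕜 r P (a + b) (altOp 𝕜 r (a + b) Ψ) := by
  set r' : ℕ → ℕ := fun k => r (a + k) with hr'
  set P' : ℕ → Fin n → Fin n → B := fun k => P (a + k) with hP'
  have hr'i : r'.Injective := fun x y h => by
    have := hr h
    omega
  have A1 : altOp 𝕜 r (a + b) * altOp 𝕜 r a
      = (a.factorial : 𝕜) • (altOp 𝕜 r (a + b) : Module.End 𝕜 ((ℕ → Fin n) → B)) :=
    mul_altOp_of_antisymm 𝕜 fun i hi j hj hij =>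
      altOp_mul_permOp hr (by omega) (by omega) hij
  have A2 : altOp 𝕜 r (a + b) * altOp 𝕜 r' b
      = (b.factorial : 𝕜) • (altOp 𝕜 r (a + b) : Module.End 𝕜 ((ℕ → Fin n) → B)) :=
    mul_altOp_of_antisymm 𝕜 fun i hi j hj hij =>
      altOp_mul_permOp hr (by omega) (by omega) (by omega)
  have R1 := descProd_mul_altOp hr hP a
  have R2 := descProd_mul_altOp hr'i (hP.shift a) b
  have R := descProd_mul_altOp hr hP (a + b)
  have c1 : Commute (altOp 𝕜 r' b) (descProd 𝕜 r P a) :=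
    commute_descProd 𝕜 fun k hk => commute_altOp 𝕜 fun i hi j hj _ =>
      permOp_swap_commute_siteOp 𝕜 _ (hr.ne (by omega)) (hr.ne (by omega))
  have c2 : Commute (altOp 𝕜 r a) (ascProd 𝕜 r' P' b) :=
    commute_ascProd 𝕜 fun k hk => commute_altOp 𝕜 fun i hi j hj _ =>
      permOp_swap_commute_siteOp 𝕜 _ (hr.ne (by omega)) (hr.ne (by omega))
  refine smul_left_cancel_fun (eq_zero_of_natCast_smul (𝕜 := 𝕜) b.factorial_ne_zero)
    (smul_left_cancel_fun (eq_zero_of_natCast_smul (𝕜 := 𝕜) a.factorial_ne_zero) ?_)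
  have key : altOp 𝕜 r (a + b) * (descProd 𝕜 r P a * (descProd 𝕜 r' P' b
        * (altOp 𝕜 r' b * altOp 𝕜 r a)))
      = (a.factorial : 𝕜) • (b.factorial : 𝕜) • (descProd 𝕜 r P (a + b) * altOp 𝕜 r (a + b)) := by
    rw [R, ascProd_add, ← mul_assoc (descProd 𝕜 r' P' b), R2, mul_assoc (altOp 𝕜 r' b),
      ← c2.eq, ← mul_assoc (descProd 𝕜 r P a), ← c1.eq, mul_assoc (altOp 𝕜 r' b),
      ← mul_assoc (descProd 𝕜 r P a), R1, ← mul_assoc (altOp 𝕜 r (a + b)), A2, smul_mul_assoc,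
      mul_assoc (altOp 𝕜 r a), ← mul_assoc (altOp 𝕜 r (a + b)), A1, smul_mul_assoc, smul_comm]
  have e1 : altOp 𝕜 r' b (altOp 𝕜 r a Ψ) = (a.factorial : 𝕜) • (b.factorial : 𝕜) • Ψ := by
    rw [altOp_apply_of_antisymmOn 𝕜 hr h1, map_smul, altOp_apply_of_antisymmOn 𝕜 hr'i h2]
  have := LinearMap.congr_fun key Ψ
  simp only [Module.End.mul_apply, e1, map_smul, LinearMap.smul_apply] at this
  exact this

end Reversal

/-! ### Tuples, subsets and permutations -/

section TupleLemmas

lemma Sub.tup_injective {n d : ℕ} (J : Sub n d) : Function.Injective J.tup :=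
  (J.1.orderEmbOfFin J.2).injective

lemma Sub.tup_mem {n d : ℕ} (J : Sub n d) (i : Fin d) : J.tup i ∈ J.1 :=
  J.1.orderEmbOfFin_mem J.2 i

lemma Sub.exists_tup_eq {n d : ℕ} (J : Sub n d) {x : Fin n} (hx : x ∈ J.1) : ∃ i, J.tup i = x := by
  have : x ∈ Set.range (J.1.orderEmbOfFin J.2) := by rwa [Finset.range_orderEmbOfFin]
  exact this

lemma Sub.image_tup {n d : ℕ} (J : Sub n d) : Finset.univ.image J.tup = J.1 := by
  ext x
  simp only [Finset.mem_image, Finset.mem_univ, true_and]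
  exact ⟨by rintro ⟨i, rfl⟩; exact J.tup_mem i, J.exists_tup_eq⟩

/-- The index of an element of a subset in its increasing enumeration. -/
lemma Sub.orderIso_symm_tup {n d : ℕ} (J : Sub n d) (i : Fin d) (h : J.tup i ∈ J.1) :
    (J.1.orderIsoOfFin J.2).symm ⟨J.tup i, h⟩ = i := by
  rw [OrderIso.symm_apply_eq]
  rfl

lemma Sub.exists_comp_perm {n d : ℕ} {t : Fin d → Fin n} (ht : Function.Injective t) :
    ∃ (J : Sub n d) (σ : Equiv.Perm (Fin d)), t = J.tup ∘ σ := by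
  let J : Sub n d := ⟨Finset.univ.image t, by
    rw [Finset.card_image_of_injective _ ht, Finset.card_univ, Fintype.card_fin]⟩
  have hmem : ∀ i, ∃ k, J.tup k = t i := fun i =>
    J.exists_tup_eq (Finset.mem_image_of_mem t (Finset.mem_univ i))
  choose s hs using hmem
  have hsi : Function.Injective s := fun i j hij => ht (by rw [← hs i, ← hs j, hij])
  exact ⟨J, Equiv.ofBijective s (Finite.injective_iff_bijective.1 hsi),
    funext fun i => (hs i).symm⟩

lemma Sub.tup_comp_perm_inj {n d : ℕ} {J J' : Sub n d} {σ σ' : Equiv.Perm (Fin d)}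
    (h : J.tup ∘ σ = J'.tup ∘ σ') : J = J' ∧ σ = σ' := by
  have hJ : J = J' := by
    refine Subtype.ext ?_
    rw [← J.image_tup, ← J'.image_tup]
    ext x
    simp only [Finset.mem_image, Finset.mem_univ, true_and]
    constructor
    · rintro ⟨i, rfl⟩
      exact ⟨σ' (σ.symm i), by simpa using (congrFun h (σ.symm i)).symm⟩
    · rintro ⟨i, rfl⟩
      exact ⟨σ (σ'.symm i), by simpa using congrFun h (σ'.symm i)⟩
  subst hJ
  exact ⟨rfl, Equiv.ext fun i => J.tup_injective (congrFun h i)⟩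

/-- The order-preserving embedding of `Fin d` with image a given subset. -/
def Sub.emb {n d : ℕ} (J : Sub n d) : Fin d ↪ Fin n := ⟨J.tup, J.tup_injective⟩

/-- A sum over all tuples of a function vanishing on tuples with a repetition is a sum over subsets
and permutations. -/
lemma sum_tuples_eq {n d : ℕ} {M : Type*} [AddCommMonoid M] (F : (Fin d → Fin n) → M)
    (hF : ∀ t, ¬ Function.Injective t → F t = 0) :
    ∑ t, F t = ∑ J : Sub n d, ∑ σ : Equiv.Perm (Fin d), F (J.tup ∘ σ) := by
  rw [← Fintype.sum_prod_type' (f := fun (J : Sub n d) (σ : Equiv.Perm (Fin d)) => F (J.tup ∘ σ))]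
  symm
  refine Finset.sum_of_injOn (fun x : Sub n d × Equiv.Perm (Fin d) => x.1.tup ∘ x.2) ?_ ?_ ?_ ?_
  · rintro ⟨J, σ⟩ - ⟨J', σ'⟩ - h
    obtain ⟨rfl, rfl⟩ := Sub.tup_comp_perm_inj h
    rfl
  · intro _ _
    simp
  · intro t _ ht
    refine hF t fun hinj => ht ?_
    obtain ⟨J, σ, rfl⟩ := Sub.exists_comp_perm hinj
    exact ⟨(J, σ), by simp, rfl⟩
  · intro _ _
    rfl

/-- A family indexed by tuples that changes by the sign under permutations. -/
def IsAlternating {n d : ℕ} {M : Type*} [AddCommGroup M] (F : (Fin d → Fin n) → M) : Prop :=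
  ∀ (σ : Equiv.Perm (Fin d)) (t), F (t ∘ σ) = (Equiv.Perm.sign σ : ℤ) • F t

lemma IsAlternating.eq_zero {n d : ℕ} {M : Type*} [AddCommGroup M] [IsAddTorsionFree M]
    {F : (Fin d → Fin n) → M} (hF : IsAlternating F) {t : Fin d → Fin n}
    (ht : ¬ Function.Injective t) : F t = 0 := by
  obtain ⟨i, j, hij, hne⟩ := Function.not_injective_iff.1 ht
  have h1 : t ∘ Equiv.swap i j = t := by
    funext k
    rcases eq_or_ne k i with rfl | hi
    · simp [hij]
    · rcases eq_or_ne k j with rfl | hj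
      · simp [hij]
      · simp [Equiv.swap_apply_of_ne_of_ne hi hj]
  have h2 := hF (Equiv.swap i j) t
  rw [h1, Equiv.Perm.sign_swap hne] at h2
  have h3 : 2 • F t = 0 := by
    rw [two_nsmul]
    nth_rewrite 1 [h2]
    simp
  exact (nsmul_eq_zero_iff.1 h3).resolve_right two_ne_zero

lemma IsAlternating.eq_zero_of_tup {n d : ℕ} {M : Type*} [AddCommGroup M] [IsAddTorsionFree M]
    {F : (Fin d → Fin n) → M} (hF : IsAlternating F) (h : ∀ J : Sub n d, F J.tup = 0)
    (t : Fin d → Fin n) : F t = 0 := by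
  by_cases ht : Function.Injective t
  · obtain ⟨J, σ, rfl⟩ := Sub.exists_comp_perm ht
    rw [hF, h, smul_zero]
  · exact hF.eq_zero ht

end TupleLemmas

/-! ### Partial matchings -/

section Matching

variable {d e n : ℕ}

/-- A partial matching of `Fin d` with `Fin e`: `φ b = some a` says that `b` is matched with `a`. -/
abbrev IsMatching (φ : Fin d → Option (Fin e)) : Prop :=
  ∀ b b' a, φ b = some a → φ b' = some a → b = b'

/-- The number of matched pairs. -/
def matchCard (φ : Fin d → Option (Fin e)) : ℕ := (Finset.univ.filter fun b => φ b ≠ none).card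

lemma matchCard_le (φ : Fin d → Option (Fin e)) : matchCard φ ≤ d :=
  (Finset.card_le_univ _).trans_eq (Fintype.card_fin d)

lemma matchCard_eq_sum (φ : Fin d → Option (Fin e)) :
    matchCard φ = ∑ b, if φ b ≠ none then 1 else 0 := by
  rw [matchCard, Finset.card_filter]

lemma matchCard_cons_none (φ : Fin d → Option (Fin e)) :
    matchCard (Fin.cons none φ : Fin (d + 1) → Option (Fin e)) = matchCard φ := by
  simp [matchCard_eq_sum, Fin.sum_univ_succ]

lemma matchCard_cons_some (φ : Fin d → Option (Fin e)) (a : Fin e) :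
    matchCard (Fin.cons (some a) φ : Fin (d + 1) → Option (Fin e)) = matchCard φ + 1 := by
  simp [matchCard_eq_sum, Fin.sum_univ_succ, add_comm]

lemma isMatching_cons_none {φ : Fin d → Option (Fin e)} :
    IsMatching (Fin.cons none φ : Fin (d + 1) → Option (Fin e)) ↔ IsMatching φ := by
  simp [IsMatching, Fin.forall_fin_succ]

lemma isMatching_cons_some {φ : Fin d → Option (Fin e)} {a : Fin e} :
    IsMatching (Fin.cons (some a) φ : Fin (d + 1) → Option (Fin e)) ↔
      IsMatching φ ∧ ∀ b, φ b ≠ some a := by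
  constructor
  · intro h
    refine ⟨fun b b' x hb hb' => ?_, fun b hb => ?_⟩
    · exact Fin.succ_injective _ (h b.succ b'.succ x (by simpa using hb) (by simpa using hb'))
    · exact Fin.succ_ne_zero b (h b.succ 0 a (by simpa using hb) (by simp))
  · rintro ⟨h1, h2⟩ b b' x
    refine Fin.cases ?_ (fun b => ?_) b <;> refine Fin.cases ?_ (fun b' => ?_) b'
    · simp
    · simp only [Fin.cons_zero, Fin.cons_succ, Option.some.injEq]
      rintro rfl hb
      exact absurd hb (h2 b')
    · simp only [Fin.cons_zero, Fin.cons_succ, Option.some.injEq]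
      rintro hb rfl
      exact absurd hb (h2 b)
    · simp only [Fin.cons_succ]
      intro hb hb'
      rw [h1 b b' x hb hb']

/-- The number of matched elements is the same on both sides. -/
lemma IsMatching.card_image {φ : Fin d → Option (Fin e)} (h : IsMatching φ) :
    (Finset.univ.filter fun a => ∃ b, φ b = some a).card = matchCard φ := by
  symm
  refine Finset.card_bij (fun b hb => (φ b).get
    (Option.ne_none_iff_isSome.1 (Finset.mem_filter.1 hb).2)) ?_ ?_ ?_
  · intro b hb
    simp only [Finset.mem_filter, Finset.mem_univ, true_and]
    exact ⟨b, by simp⟩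
  · intro b hb b' hb' hbb
    refine h b b' ((φ b).get (Option.ne_none_iff_isSome.1 (Finset.mem_filter.1 hb).2)) (by simp) ?_
    rw [hbb]
    simp
  · intro a ha
    obtain ⟨b, hb⟩ := (Finset.mem_filter.1 ha).2
    exact ⟨b, by simp [hb], by simp [hb]⟩

/-- The matching of the elements of `K`, in increasing order, with the entries of `l`. -/
def matchingOf {p : ℕ} (K : Sub d p) (l : Fin p → Fin e) (b : Fin d) : Option (Fin e) :=
  if h : b ∈ K.1 then some (l ((K.1.orderIsoOfFin K.2).symm ⟨b, h⟩)) else none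

lemma matchingOf_tup {p : ℕ} (K : Sub d p) (l : Fin p → Fin e) (i : Fin p) :
    matchingOf K l (K.tup i) = some (l i) := by
  rw [matchingOf, dif_pos (K.tup_mem i), K.orderIso_symm_tup]

lemma matchingOf_of_notMem {p : ℕ} (K : Sub d p) (l : Fin p → Fin e) {b : Fin d} (hb : b ∉ K.1) :
    matchingOf K l b = none := dif_neg hb

lemma matchingOf_ne_none_iff {p : ℕ} (K : Sub d p) (l : Fin p → Fin e) (b : Fin d) :
    matchingOf K l b ≠ none ↔ b ∈ K.1 := by
  by_cases hb : b ∈ K.1 <;> simp [matchingOf, hb]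

lemma isMatching_matchingOf {p : ℕ} (K : Sub d p) {l : Fin p → Fin e} (hl : Function.Injective l) :
    IsMatching (matchingOf K l) := by
  intro b b' a hb hb'
  obtain ⟨i, rfl⟩ := K.exists_tup_eq ((matchingOf_ne_none_iff K l b).1 (by simp [hb]))
  obtain ⟨j, rfl⟩ := K.exists_tup_eq ((matchingOf_ne_none_iff K l b').1 (by simp [hb']))
  rw [matchingOf_tup, Option.some.injEq] at hb hb'
  rw [hl (hb.trans hb'.symm)]

lemma matchCard_matchingOf {p : ℕ} (K : Sub d p) (l : Fin p → Fin e) :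
    matchCard (matchingOf K l) = p := by
  rw [matchCard]
  simp only [matchingOf_ne_none_iff, Finset.filter_univ_mem, K.2]

/-- Matchings with `p` pairs are given by two `p`-element subsets and a bijection between them. -/
lemma sum_matchings_eq {M : Type*} [AddCommMonoid M] (p : ℕ) (F : (Fin d → Option (Fin e)) → M) :
    ∑ φ : Fin d → Option (Fin e) with IsMatching φ ∧ matchCard φ = p, F φ
      = ∑ K : Sub d p, ∑ L : Sub e p, ∑ τ : Equiv.Perm (Fin p), F (matchingOf K (L.tup ∘ τ)) := by
  rw [← Fintype.sum_prod_type' (f := fun (K : Sub d p) (L : Sub e p) =>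
      ∑ τ : Equiv.Perm (Fin p), F (matchingOf K (L.tup ∘ τ))),
    ← Fintype.sum_prod_type' (f := fun (x : Sub d p × Sub e p) (τ : Equiv.Perm (Fin p)) =>
      F (matchingOf x.1 (x.2.tup ∘ τ)))]
  symm
  refine Finset.sum_nbij (fun x => matchingOf x.1.1 (x.1.2.tup ∘ x.2)) ?_ ?_ ?_ fun _ _ => rfl
  · rintro ⟨⟨K, L⟩, τ⟩ -
    simp only [Finset.mem_filter, Finset.mem_univ, true_and]
    exact ⟨isMatching_matchingOf K (L.tup_injective.comp τ.injective), matchCard_matchingOf K _⟩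
  · rintro ⟨⟨K, L⟩, τ⟩ - ⟨⟨K', L'⟩, τ'⟩ - h
    have h : matchingOf K (L.tup ∘ τ) = matchingOf K' (L'.tup ∘ τ') := h
    have hK : K = K' := by
      refine Subtype.ext (Finset.ext fun b => ?_)
      rw [← matchingOf_ne_none_iff K (L.tup ∘ τ), ← matchingOf_ne_none_iff K' (L'.tup ∘ τ'), h]
    subst hK
    have h2 : L.tup ∘ τ = L'.tup ∘ τ' := funext fun i => by
      have := congrFun h (K.tup i)
      rwa [matchingOf_tup, matchingOf_tup, Option.some.injEq] at this
    obtain ⟨rfl, rfl⟩ := Sub.tup_comp_perm_inj h2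
    rfl
  · intro φ hφ
    obtain ⟨h1, h2⟩ := (Finset.mem_filter.1 hφ).2
    let K : Sub d p := ⟨Finset.univ.filter fun b => φ b ≠ none, h2⟩
    have hK : ∀ i, ∃ a, φ (K.tup i) = some a := fun i =>
      Option.ne_none_iff_exists'.1 (Finset.mem_filter.1 (K.tup_mem i)).2
    choose l hl using hK
    have hli : Function.Injective l := fun i j hij =>
      K.tup_injective (h1 _ _ (l i) (hl i) (by rw [hl j, hij]))
    obtain ⟨L, τ, hLτ⟩ := Sub.exists_comp_perm hli
    refine ⟨((K, L), τ), by simp, ?_⟩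
    funext b
    change matchingOf K (L.tup ∘ τ) b = φ b
    rw [← hLτ]
    by_cases hb : b ∈ K.1
    · obtain ⟨i, rfl⟩ := K.exists_tup_eq hb
      rw [matchingOf_tup, hl]
    · rw [matchingOf_of_notMem K l hb]
      by_contra hne
      exact hb (Finset.mem_filter.2 ⟨Finset.mem_univ _, fun h => hne h.symm⟩)

lemma exchange_tup {p : ℕ} (I : Fin d → Fin n) (J : Fin e → Fin n) (K : Sub d p) (L : Sub e p)
    (i : Fin p) : exchange I J K L (K.tup i) = J (L.tup i) := by
  rw [exchange, dif_pos (K.tup_mem i), K.orderIso_symm_tup]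

lemma exchange_of_notMem {p : ℕ} (I : Fin d → Fin n) (J : Fin e → Fin n) (K : Sub d p) (L : Sub e p)
    {b : Fin d} (hb : b ∉ K.1) : exchange I J K L b = I b := dif_neg hb

end Matching

/-! ### The fused R-matrix -/

section ExchangeOperator

variable {𝕜 B : Type*} [CommRing 𝕜] [Ring B] [Algebra 𝕜 B] {n : ℕ}

lemma descProd_succ' (q : ℕ → ℕ) (Q : ℕ → Fin n → Fin n → B) (d : ℕ) :
    descProd 𝕜 q Q (d + 1)
      = descProd 𝕜 (fun k => q (k + 1)) (fun k => Q (k + 1)) d * siteOp 𝕜 (q 0) (Q 0) := by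
  rw [add_comm d 1, descProd_add]
  simp only [descProd, mul_one, add_comm 1]

/-- The fused R-matrix between the blocks `p 0, …, p (e - 1)` and `q 0, …, q (d - 1)`, on covectors
antisymmetric in the first block: the product of the operators `w_b - δ ∑_k P_{p k, q b}`. -/
def fusedR (p : ℕ → ℕ) (e : ℕ) (δ : 𝕜) :
    ℕ → (ℕ → ℕ) → (ℕ → 𝕜) → Module.End 𝕜 ((ℕ → Fin n) → B)
  | 0, _, _ => 1
  | d + 1, q, w => linOp (w 0) δ (swapSum 𝕜 p e (q 0))
      * fusedR p e δ d (fun k => q (k + 1)) fun k => w (k + 1)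

lemma commute_fusedR {p : ℕ → ℕ} {e : ℕ} {δ : 𝕜} {X : Module.End 𝕜 ((ℕ → Fin n) → B)} (d : ℕ)
    (q : ℕ → ℕ) (w : ℕ → 𝕜)
    (h : ∀ k < e, ∀ b < d, Commute (permOp 𝕜 (Equiv.swap (p k) (q b))) X) :
    Commute (fusedR p e δ d q w) X := by
  induction d generalizing q w with
  | zero => exact Commute.one_left _
  | succ d ih =>
    exact (commute_linOp _ _ (commute_swapSum 𝕜 fun k hk => h k hk 0 (Nat.succ_pos d))).mul_left
      (ih _ _ fun k hk b hb => h k hk (b + 1) (by omega))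

lemma AntisymmOn.fusedR {p : ℕ → ℕ} (hp : p.Injective) {e : ℕ} {δ : 𝕜}
    {Φ : (ℕ → Fin n) → B} (h : AntisymmOn (p '' Set.Iio e) Φ) (d : ℕ) (q : ℕ → ℕ) (w : ℕ → 𝕜)
    (hpq : ∀ k b, p k ≠ q b) : AntisymmOn (p '' Set.Iio e) (fusedR p e δ d q w Φ) := by
  induction d generalizing q w with
  | zero => exact h
  | succ d ih =>
    refine (ih (fun k => q (k + 1)) (fun k => w (k + 1)) fun k b => hpq k _).apply 𝕜
      (X := linOp (w 0) δ (swapSum 𝕜 p e (q 0))) ?_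
    rintro _ ⟨i, hi, rfl⟩ _ ⟨j, hj, rfl⟩ -
    exact (commute_linOp _ _ (permOp_commute_swapSum 𝕜 hp hi hj fun k _ => hpq k 0).symm).symm

/-- The fused form of the relation `R(u - v) T_1(u) T_2(v) = T_2(v) T_1(u) R(u - v)`. -/
theorem descProd_descProd_fusedR [IsAddTorsionFree B] {p : ℕ → ℕ} (hp : p.Injective)
    {P : ℕ → Fin n → Fin n → B} (hP : IsDescending 𝕜 P) {e : ℕ} {δ : 𝕜} (d : ℕ)
    {q : ℕ → ℕ} (hq : q.Injective) (hpq : ∀ k b, p k ≠ q b) {Q : ℕ → Fin n → Fin n → B}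
    {w : ℕ → 𝕜} (hR : ∀ j < e, ∀ b < d, RTTRel (w b + ((e : 𝕜) - (j + 1)) * δ) δ (P j) (Q b))
    (hzd : ∀ j < e, ∀ b < d, ∀ x : B, (w b + ((e : 𝕜) - j) * δ) • x = 0 → x = 0)
    {Φ : (ℕ → Fin n) → B} (hΦ : AntisymmOn (p '' Set.Iio e) Φ) :
    descProd 𝕜 q Q d (descProd 𝕜 p P e (fusedR p e δ d q w Φ))
      = fusedR p e δ d q w (descProd 𝕜 p P e (descProd 𝕜 q Q d Φ)) := by
  induction d generalizing q Q w Φ with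
  | zero => rfl
  | succ d ih =>
    set q' : ℕ → ℕ := fun k => q (k + 1) with hq'
    set w' : ℕ → 𝕜 := fun k => w (k + 1) with hw'
    set Q' : ℕ → Fin n → Fin n → B := fun k => Q (k + 1) with hQ'
    have hΨ : AntisymmOn (p '' Set.Iio e) (fusedR p e δ d q' w' Φ) :=
      hΦ.fusedR hp d q' w' fun k b => hpq k _
    have hT : AntisymmOn (p '' Set.Iio e) (siteOp 𝕜 (q 0) (Q 0) Φ) := by
      refine hΦ.apply 𝕜 ?_
      rintro _ ⟨i, hi, rfl⟩ _ ⟨j, hj, rfl⟩ -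
      exact permOp_swap_commute_siteOp 𝕜 _ (hpq i 0).symm (hpq j 0).symm
    -- the factor for `q 0` is fused with the first block, then passes the rest of the second
    have fus := fusion (𝕜 := 𝕜) hp (c := q 0) (P := P) (Q := Q 0)
      (z := fun j => w 0 + ((e : 𝕜) - j) * δ) (δ := δ) (fun j => by push_cast; ring) e
      (fun k _ => hpq k 0) (fun j hj => by
        have := hR j hj 0 (Nat.succ_pos d)
        push_cast
        exact this)
      (fun j hj => hzd j hj 0 (Nat.succ_pos d))
      (fun j _ Ψ hΨ => hΨ.descProd hp hP) hΨ
    have e0 : w 0 + ((e : 𝕜) - e) * δ = w 0 := by ring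
    simp only [e0] at fus
    have c1 : Commute (linOp (w 0) δ (swapSum 𝕜 p e (q 0))) (descProd 𝕜 q' Q' d) :=
      commute_linOp _ _ (commute_swapSum 𝕜 fun k hk => commute_descProd 𝕜 fun b hb =>
        permOp_swap_commute_siteOp 𝕜 _ (hpq k _).symm (hq.ne (Nat.succ_ne_zero b)))
    have c2 : Commute (fusedR p e δ d q' w') (siteOp 𝕜 (q 0) (Q 0)) :=
      commute_fusedR d q' w' fun k hk b hb =>
        permOp_swap_commute_siteOp 𝕜 _ (hpq k _).symm (hq.ne (Nat.succ_ne_zero b).symm)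
    have ih' := ih (q := q') (fun x y h => by have := hq h; omega) (fun k b => hpq k _) (Q := Q')
      (w := w') (fun j hj b hb => hR j hj (b + 1) (by omega))
      (fun j hj b hb => hzd j hj (b + 1) (by omega)) hT
    have c1 := fun v => LinearMap.congr_fun c1.eq v
    have c2 := fun v => LinearMap.congr_fun c2.eq v
    simp only [Module.End.mul_apply] at c1 c2
    rw [descProd_succ']
    simp only [fusedR, Module.End.mul_apply]
    rw [fus, ← c1, ← c2, ih']

/-- The permutation interchanging the matched positions, when `φ` is a matching: a product of
transpositions, which are then disjoint. -/
def matchPerm (p : ℕ → ℕ) {e : ℕ} :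
    (d : ℕ) → (ℕ → ℕ) → (Fin d → Option (Fin e)) → Equiv.Perm ℕ
  | 0, _, _ => 1
  | d + 1, q, φ => (φ 0).elim 1 (fun a => Equiv.swap (p a) (q 0))
      * matchPerm p d (fun k => q (k + 1)) (Fin.tail φ)

section MatchPerm

variable {p q : ℕ → ℕ} {d e : ℕ}

lemma matchPerm_apply_of_ne {φ : Fin d → Option (Fin e)} {x : ℕ} (hp : ∀ a : Fin e, x ≠ p a)
    (hq : ∀ b < d, x ≠ q b) : matchPerm p d q φ x = x := by
  induction d generalizing q with
  | zero => rfl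
  | succ d ih =>
    rw [matchPerm, Equiv.Perm.mul_apply, ih fun b hb => hq (b + 1) (by omega)]
    cases φ 0 with
    | none => rfl
    | some a => exact Equiv.swap_apply_of_ne_of_ne (hp a) (hq 0 (Nat.succ_pos d))

lemma tail_isMatching {φ : Fin (d + 1) → Option (Fin e)} (h : IsMatching φ) :
    IsMatching (Fin.tail φ) := fun b b' a hb hb' =>
  Fin.succ_injective _ (h b.succ b'.succ a hb hb')

lemma matchPerm_q (hp : p.Injective) (hq : q.Injective) (hpq : ∀ k b, p k ≠ q b)
    {φ : Fin d → Option (Fin e)} (hφ : IsMatching φ) (b : Fin d) :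
    matchPerm p d q φ (q b) = (φ b).elim (q b) fun a => p a := by
  induction d generalizing q with
  | zero => exact b.elim0
  | succ d ih =>
    have hq' : Function.Injective fun k => q (k + 1) := fun x y h => by have := hq h; omega
    rw [matchPerm, Equiv.Perm.mul_apply]
    refine Fin.cases ?_ (fun b => ?_) b
    · rw [matchPerm_apply_of_ne (fun a => (hpq a _).symm)
        fun b _ => hq.ne (by simp)]
      cases φ 0 with
      | none => rfl
      | some a => exact Equiv.swap_apply_right _ _
    · have := ih hq' (fun k b => hpq k _) (tail_isMatching hφ) b
      rw [Fin.val_succ, this, Fin.tail]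
      rcases h0 : φ 0 with _ | a0 <;> rcases h1 : φ b.succ with _ | a
      · rfl
      · rfl
      · exact Equiv.swap_apply_of_ne_of_ne (hpq _ _).symm (hq.ne (by simp))
      · refine Equiv.swap_apply_of_ne_of_ne (hp.ne fun h => ?_) (hpq _ _)
        have h := Fin.ext h
        subst h
        exact Fin.succ_ne_zero b (hφ _ _ a h1 h0)

lemma matchPerm_p_of_ne (hp : p.Injective) (hpq : ∀ k b, p k ≠ q b) {φ : Fin d → Option (Fin e)}
    {a : Fin e} (ha : ∀ b, φ b ≠ some a) : matchPerm p d q φ (p a) = p a := by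
  induction d generalizing q with
  | zero => rfl
  | succ d ih =>
    rw [matchPerm, Equiv.Perm.mul_apply,
      ih (fun k b => hpq k _) (φ := Fin.tail φ) fun b => ha b.succ]
    rcases h0 : φ 0 with _ | a0
    · rfl
    · refine Equiv.swap_apply_of_ne_of_ne (hp.ne fun h => ha 0 ?_) (hpq _ _)
      rw [h0, Fin.ext h]

lemma matchPerm_p (hp : p.Injective) (hq : q.Injective) (hpq : ∀ k b, p k ≠ q b)
    {φ : Fin d → Option (Fin e)} (hφ : IsMatching φ) {a : Fin e} {b : Fin d} (hab : φ b = some a) :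
    matchPerm p d q φ (p a) = q b := by
  induction d generalizing q with
  | zero => exact b.elim0
  | succ d ih =>
    have hq' : Function.Injective fun k => q (k + 1) := fun x y h => by have := hq h; omega
    rw [matchPerm, Equiv.Perm.mul_apply]
    revert hab
    refine Fin.cases (fun hab => ?_) (fun b hab => ?_) b
    · rw [matchPerm_p_of_ne hp (fun k b => hpq k _) (φ := Fin.tail φ)
        fun b hb => Fin.succ_ne_zero b (hφ _ _ a hb hab), hab]
      exact Equiv.swap_apply_left _ _
    · rw [ih hq' (fun k b => hpq k _) (tail_isMatching hφ) hab]
      rcases h0 : φ 0 with _ | a0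
      · rfl
      · exact Equiv.swap_apply_of_ne_of_ne (hpq _ _).symm (hq.ne (by simp))

end MatchPerm

/-- The coefficient of a partial matching with `m` pairs in the fused R-matrix. -/
def matchWeight (δ : 𝕜) (w : ℕ → 𝕜) (d m : ℕ) : 𝕜 := (-δ) ^ m * ∏ b ∈ Finset.Ico m d, w b

lemma matchWeight_succ_none {δ : 𝕜} {w : ℕ → 𝕜} (hw : ∀ b, w (b + 1) = w b + δ) {d m : ℕ}
    (hm : m ≤ d) :
    matchWeight δ w (d + 1) m = (w 0 + m * δ) * matchWeight δ (fun k => w (k + 1)) d m := by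
  have h0 : ∀ b : ℕ, w b = w 0 + b * δ := by
    intro b
    induction b with
    | zero => simp
    | succ b ih => rw [hw, ih]; push_cast; ring
  rw [matchWeight, matchWeight, Finset.prod_eq_prod_Ico_succ_bot (Nat.lt_succ_of_le hm),
    Finset.prod_Ico_add' w m d 1, h0 m]
  ring

lemma matchWeight_succ_some (δ : 𝕜) (w : ℕ → 𝕜) (d m : ℕ) :
    matchWeight δ w (d + 1) (m + 1) = -(δ * matchWeight δ (fun k => w (k + 1)) d m) := by
  rw [matchWeight, matchWeight, Finset.prod_Ico_add' w m d 1]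
  ring

/-- On covectors antisymmetric in the second block, the fused R-matrix is a sum over partial
matchings of the two blocks: a transposition meeting an already matched position reproduces, up to
sign, the same matching, which changes `w 0` into `w m`. -/
theorem fusedR_apply_eq_sum {p : ℕ → ℕ} (hp : p.Injective) {e : ℕ} {δ : 𝕜} (d : ℕ) {q : ℕ → ℕ}
    (hq : q.Injective) (hpq : ∀ k b, p k ≠ q b) {w : ℕ → 𝕜} (hw : ∀ b, w (b + 1) = w b + δ)
    {Φ : (ℕ → Fin n) → B} (hΦ : AntisymmOn (q '' Set.Iio d) Φ) :
    fusedR p e δ d q w Φ = ∑ φ : Fin d → Option (Fin e) with IsMatching φ,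
      matchWeight δ w d (matchCard φ) • permOp 𝕜 (matchPerm p d q φ) Φ := by
  induction d generalizing q w with
  | zero =>
    simp [fusedR, matchWeight, matchPerm, matchCard, permOp]
  | succ d ih =>
    set q' : ℕ → ℕ := fun k => q (k + 1) with hq'
    set w' : ℕ → 𝕜 := fun k => w (k + 1) with hw'
    have hq'i : q'.Injective := fun x y h => by have := hq h; omega
    have hΦ' : AntisymmOn (q' '' Set.Iio d) Φ := hΦ.mono (by
      rintro _ ⟨k, hk, rfl⟩
      exact ⟨k + 1, Nat.succ_lt_succ hk, rfl⟩)
    have step : ∀ φ : Fin d → Option (Fin e), IsMatching φ →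
        linOp (w 0) δ (swapSum 𝕜 p e (q 0))
          (matchWeight δ w' d (matchCard φ) • permOp 𝕜 (matchPerm p d q' φ) Φ)
        = matchWeight δ w (d + 1) (matchCard φ) • permOp 𝕜 (matchPerm p d q' φ) Φ
          + ∑ a : Fin e, if ∀ b, φ b ≠ some a then matchWeight δ w (d + 1) (matchCard φ + 1) •
            permOp 𝕜 (Equiv.swap (p a) (q 0) * matchPerm p d q' φ) Φ else 0 := by
      intro φ hφ
      have hs : ∀ a : Fin e, permOp 𝕜 (Equiv.swap (p a) (q 0)) (permOp 𝕜 (matchPerm p d q' φ) Φ)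
          = (if ∀ b, φ b ≠ some a then
              permOp 𝕜 (Equiv.swap (p a) (q 0) * matchPerm p d q' φ) Φ else 0)
            - (if ∃ b, φ b = some a then permOp 𝕜 (matchPerm p d q' φ) Φ else 0) := by
        intro a
        by_cases ha : ∃ b, φ b = some a
        · rw [if_neg (by push Not; exact ha), if_pos ha, zero_sub]
          obtain ⟨b, hb⟩ := ha
          have e1 := matchPerm_q hp hq'i (fun k b => hpq k _) hφ b
          rw [hb, Option.elim_some] at e1
          -- conjugation turns the transposition into one inside the second block
          have e2 : matchPerm p d q' φ (q 0) = q 0 :=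
            matchPerm_apply_of_ne (fun a => (hpq a _).symm) fun b _ => hq.ne (by simp)
          have e3 := Equiv.mul_swap_eq_swap_mul (matchPerm p d q' φ) (q' b) (q 0)
          rw [e1, e2] at e3
          rw [← Module.End.mul_apply, ← permOp_mul, ← e3]
          change permOp 𝕜 (matchPerm p d q' φ * Equiv.swap (q' b) (q 0)) Φ = _
          rw [permOp_mul, Module.End.mul_apply, hΦ.permOp_swap 𝕜
            ⟨b + 1, Nat.succ_lt_succ b.2, rfl⟩ ⟨0, Nat.succ_pos d, rfl⟩ (hq.ne (by simp)), map_neg]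
        · rw [if_pos (by push Not at ha; exact ha), if_neg ha, sub_zero]
          rfl
      rw [map_smul, linOp_apply, swapSum, LinearMap.sum_apply, Finset.sum_range]
      simp only [hs, Finset.sum_sub_distrib]
      rw [← Finset.sum_filter (p := fun a => ∃ b, φ b = some a), Finset.sum_const, hφ.card_image,
        ← Nat.cast_smul_eq_nsmul 𝕜, matchWeight_succ_none hw (matchCard_le φ),
        matchWeight_succ_some]
      have e4 : (∑ a : Fin e, if ∀ b, φ b ≠ some a then
            -(δ * matchWeight δ w' d (matchCard φ)) •
            permOp 𝕜 (Equiv.swap (p a) (q 0) * matchPerm p d q' φ) Φ else 0)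
          = -(δ * matchWeight δ w' d (matchCard φ)) • ∑ a : Fin e, if ∀ b, φ b ≠ some a then
            permOp 𝕜 (Equiv.swap (p a) (q 0) * matchPerm p d q' φ) Φ else 0 := by
        rw [Finset.smul_sum]
        refine Finset.sum_congr rfl fun a _ => ?_
        split_ifs <;> simp
      rw [e4]
      module
    rw [fusedR, Module.End.mul_apply,
      ih hq'i (fun k b => hpq k _) (w := w') (fun b => hw _) hΦ', map_sum,
      Finset.sum_congr rfl fun φ hφ => step φ (Finset.mem_filter.1 hφ).2, Finset.sum_filter,
      Finset.sum_filter, ← (Fin.consEquiv fun _ => Option (Fin e)).sum_comp,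
      Fintype.sum_prod_type_right]
    refine Finset.sum_congr rfl fun φ _ => ?_
    have hcons : ∀ o, (Fin.consEquiv fun _ => Option (Fin e)) (o, φ) = Fin.cons o φ := fun _ => rfl
    rw [Fintype.sum_option]
    simp only [hcons, isMatching_cons_none, isMatching_cons_some,
      matchCard_cons_none, matchCard_cons_some, matchPerm, Fin.cons_zero, Option.elim_none,
      Option.elim_some, Fin.tail_cons, one_mul]
    by_cases hφ : IsMatching φ
    · rw [if_pos hφ, if_pos hφ]
      refine congrArg _ (Finset.sum_congr rfl fun a _ => ?_)
      by_cases ha : ∀ b, φ b ≠ some a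
      · rw [if_pos ha, if_pos ⟨hφ, ha⟩]
      · rw [if_neg ha, if_neg fun h => ha h.2]
    · simp only [hφ, if_false, false_and, Finset.sum_const_zero, add_zero]

end ExchangeOperator

/-! ### Sums over splittings -/

section Splittings

lemma neg_one_pow_len {n m : ℕ} {t : Fin m → Fin n} (ht : Function.Injective t) :
    ((-1) ^ len t : ℤ)
      = ∏ j, ∏ i ∈ Finset.Iio j, if t i < t j then 1 else if t j < t i then -1 else 0 := by
  rw [Finset.prod_sigma', len, ← Finset.prod_const]
  have e : ∀ x ∈ (Finset.univ : Finset (Fin m)).sigma (fun j => Finset.Iio j),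
      (if t x.2 < t x.1 then (1 : ℤ) else if t x.1 < t x.2 then -1 else 0)
        = if t x.1 < t x.2 then -1 else 1 := by
    rintro ⟨j, i⟩ hx
    have hij : i < j := by simpa using hx
    rcases lt_or_gt_of_ne (ht.ne hij.ne) with h | h
    · simp [h, h.not_gt]
    · simp [h, h.not_gt]
  rw [Finset.prod_congr rfl e, ← Finset.prod_filter]
  refine Finset.prod_bij' (fun x _ => ⟨x.2, x.1⟩) (fun x _ => (x.2, x.1)) ?_ ?_ ?_ ?_ ?_
  · rintro ⟨i, j⟩ h
    simpa using h
  · rintro ⟨j, i⟩ h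
    simpa using h
  · simp
  · simp
  · simp

lemma neg_one_pow_len_comp {n m : ℕ} {t : Fin m → Fin n} (ht : Function.Injective t)
    (σ : Equiv.Perm (Fin m)) :
    ((-1) ^ len (t ∘ σ) : ℤ) = (Equiv.Perm.sign σ : ℤ) * (-1) ^ len t := by
  rw [neg_one_pow_len ht, neg_one_pow_len (ht.comp σ.injective)]
  have := σ.prod_Iio_comp_eq_sign_mul_prod (R := ℤ)
    (f := fun i j => if t i < t j then 1 else if t j < t i then -1 else 0) (by
      intro i j
      rcases lt_trichotomy (t i) (t j) with h | h | h
      · simp [h, h.not_gt]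
      · simp [h]
      · simp [h, h.not_gt])
  simpa using this

lemma len_tup {n m : ℕ} (J : Sub n m) : len J.tup = 0 := by
  rw [len, Finset.card_eq_zero, Finset.filter_eq_empty_iff]
  rintro ⟨i, j⟩ - ⟨hij, h⟩
  exact absurd h ((J.1.orderEmbOfFin J.2).strictMono hij).le.not_gt

/-- The block permutation `σ ⊕ τ` of `Fin (a + b)`. -/
def blockPerm {a b : ℕ} (σ : Equiv.Perm (Fin a)) (τ : Equiv.Perm (Fin b)) :
    Equiv.Perm (Fin (a + b)) :=
  finSumFinEquiv.permCongr (Equiv.Perm.sumCongr σ τ)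

lemma sign_blockPerm {a b : ℕ} (σ : Equiv.Perm (Fin a)) (τ : Equiv.Perm (Fin b)) :
    Equiv.Perm.sign (blockPerm σ τ) = Equiv.Perm.sign σ * Equiv.Perm.sign τ := by
  rw [blockPerm, Equiv.Perm.sign_permCongr, Equiv.Perm.sign_sumCongr]

lemma append_comp_blockPerm {X : Type*} {a b : ℕ} (s : Fin a → X) (t : Fin b → X)
    (σ : Equiv.Perm (Fin a)) (τ : Equiv.Perm (Fin b)) :
    Fin.append s t ∘ blockPerm σ τ = Fin.append (s ∘ σ) (t ∘ τ) := by
  funext i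
  refine Fin.addCases (fun i => ?_) (fun i => ?_) i <;>
    simp [blockPerm, Equiv.permCongr_apply]

lemma append_injective_iff_disjoint {n a b : ℕ} (K : Sub n a) (L : Sub n b) :
    Function.Injective (Fin.append K.tup L.tup) ↔ Disjoint K.1 L.1 := by
  rw [Fin.append_injective_iff, Finset.disjoint_left]
  constructor
  · rintro ⟨-, -, h⟩ x hx hx'
    obtain ⟨i, rfl⟩ := K.exists_tup_eq hx
    obtain ⟨j, hj⟩ := L.exists_tup_eq hx'
    exact h i j hj.symm
  · intro h
    exact ⟨K.tup_injective, L.tup_injective, fun i j hij =>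
      h (K.tup_mem i) (hij ▸ L.tup_mem j)⟩

lemma image_append {n a b : ℕ} (s : Fin a → Fin n) (t : Fin b → Fin n) :
    Finset.univ.image (Fin.append s t) = Finset.univ.image s ∪ Finset.univ.image t := by
  ext x
  simp only [Finset.mem_image, Finset.mem_univ, true_and, Finset.mem_union]
  constructor
  · rintro ⟨i, rfl⟩
    refine Fin.addCases (fun i => ?_) (fun i => ?_) i
    · exact Or.inl ⟨i, by simp⟩
    · exact Or.inr ⟨i, by simp⟩
  · rintro (⟨i, rfl⟩ | ⟨i, rfl⟩)
    · exact ⟨Fin.castAdd b i, by simp⟩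
    · exact ⟨Fin.natAdd a i, by simp⟩

lemma image_comp_perm {n d : ℕ} (t : Fin d → Fin n) (σ : Equiv.Perm (Fin d)) :
    Finset.univ.image (t ∘ σ) = Finset.univ.image t := by
  ext x
  simp only [Finset.mem_image, Finset.mem_univ, true_and, Function.comp_apply]
  exact ⟨fun ⟨i, hi⟩ => ⟨σ i, hi⟩, fun ⟨i, hi⟩ => ⟨σ.symm i, by simpa using hi⟩⟩

/-- The pairs of tuples correspond to tuples of the added length. -/
def appendPairEquiv (X : Type*) (a b : ℕ) : (Fin a → X) × (Fin b → X) ≃ (Fin (a + b) → X) where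
  toFun x := Fin.append x.1 x.2
  invFun t := (fun i => t (Fin.castAdd b i), fun i => t (Fin.natAdd a i))
  left_inv x := by ext i <;> simp
  right_inv t := Fin.append_castAdd_natAdd

/-- The antisymmetrization of a function alternating in the first `a` and in the last `b` entries
is, up to the factor `a! b!`, the signed sum over splittings: both compute the signed sum of `H`
over all tuples with underlying set `J`. -/
theorem sum_perm_eq_sum_splittings {n a b : ℕ} {M : Type*} [AddCommGroup M]
    (H : (Fin (a + b) → Fin n) → M)
    (hH : ∀ (σ : Equiv.Perm (Fin a)) (τ : Equiv.Perm (Fin b)) s t, H (Fin.append (s ∘ σ) (t ∘ τ))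
      = (Equiv.Perm.sign σ * Equiv.Perm.sign τ : ℤ) • H (Fin.append s t)) (J : Sub n (a + b)) :
    ∑ σ : Equiv.Perm (Fin (a + b)), (Equiv.Perm.sign σ : ℤ) • H (J.tup ∘ σ)
      = (a.factorial * b.factorial) • ∑ x ∈ splittings J a b,
          splitSign x • H (Fin.append x.1.tup x.2.tup) := by
  classical
  set F : (Fin (a + b) → Fin n) → M := fun t =>
    if Function.Injective t ∧ Finset.univ.image t = J.1 then ((-1) ^ len t : ℤ) • H t else 0 with hF
  have h1 : ∑ t, F t = ∑ σ : Equiv.Perm (Fin (a + b)),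
      (Equiv.Perm.sign σ : ℤ) • H (J.tup ∘ σ) := by
    rw [sum_tuples_eq F fun t ht => if_neg fun h => ht h.1, Finset.sum_eq_single_of_mem J
      (Finset.mem_univ J)]
    · refine Finset.sum_congr rfl fun σ _ => ?_
      rw [hF]
      dsimp only
      rw [if_pos ⟨J.tup_injective.comp σ.injective, by rw [image_comp_perm, J.image_tup]⟩,
        neg_one_pow_len_comp J.tup_injective, len_tup, pow_zero, mul_one]
    · intro J' _ hJ'
      refine Finset.sum_eq_zero fun σ _ => if_neg fun h => hJ' (Subtype.ext ?_)
      rw [← h.2, image_comp_perm, J'.image_tup]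
  have h2 : ∑ t, F t = ∑ x : Sub n a × Sub n b, (a.factorial * b.factorial) •
      if x.1.1 ∪ x.2.1 = J.1 ∧ Disjoint x.1.1 x.2.1 then
        splitSign x • H (Fin.append x.1.tup x.2.tup) else 0 := by
    rw [← (appendPairEquiv (Fin n) a b).sum_comp, Fintype.sum_prod_type]
    have hz : ∀ (s : Fin a → Fin n) (t : Fin b → Fin n),
        ¬ (Function.Injective s ∧ Function.Injective t) → F (Fin.append s t) = 0 := by
      intro s t h
      refine if_neg fun h' => h ?_
      exact ⟨(Fin.append_injective_iff.1 h'.1).1, (Fin.append_injective_iff.1 h'.1).2.1⟩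
    change ∑ s, ∑ t, F (Fin.append s t) = _
    rw [sum_tuples_eq _ fun s hs => Finset.sum_eq_zero fun t _ => hz s t fun h => hs h.1,
      Fintype.sum_prod_type]
    refine Finset.sum_congr rfl fun K _ => ?_
    rw [Finset.sum_congr rfl fun σ _ => sum_tuples_eq _ fun t ht => hz _ t fun h => ht h.2,
      Finset.sum_comm]
    refine Finset.sum_congr rfl fun L _ => ?_
    have hc : ∀ (σ : Equiv.Perm (Fin a)) (τ : Equiv.Perm (Fin b)),
        F (Fin.append (K.tup ∘ σ) (L.tup ∘ τ)) = if K.1 ∪ L.1 = J.1 ∧ Disjoint K.1 L.1 then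
          splitSign (K, L) • H (Fin.append K.tup L.tup) else 0 := by
      intro σ τ
      rw [hF]
      dsimp only
      have e : (Function.Injective (Fin.append (K.tup ∘ σ) (L.tup ∘ τ)) ∧
          Finset.univ.image (Fin.append (K.tup ∘ σ) (L.tup ∘ τ)) = J.1)
          ↔ (K.1 ∪ L.1 = J.1 ∧ Disjoint K.1 L.1) := by
        rw [← append_comp_blockPerm, Equiv.injective_comp, append_injective_iff_disjoint,
          image_comp_perm, image_append, K.image_tup, L.image_tup, and_comm]
      by_cases h : K.1 ∪ L.1 = J.1 ∧ Disjoint K.1 L.1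
      · rw [if_pos (e.2 h), if_pos h, hH, ← append_comp_blockPerm,
          neg_one_pow_len_comp ((append_injective_iff_disjoint K L).2 h.2), sign_blockPerm,
          smul_smul, splitSign]
        congr 1
        push_cast
        rw [mul_right_comm, ← Units.val_mul, ← Units.val_mul, Int.units_mul_self]
        simp
      · rw [if_neg fun h' => h (e.1 h'), if_neg h]
    simp only [hc, Finset.sum_const, Finset.card_univ, Fintype.card_perm, Fintype.card_fin,
      smul_smul]
  rw [← h1, h2, ← Finset.smul_sum, splittings, Finset.sum_filter]

end Splittings

/-! ### Evaluation of the operators -/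

section Evaluation

variable {𝕜 B : Type*} [CommRing 𝕜] [Ring B] [Algebra 𝕜 B] {n : ℕ}

/-- The entries of `y` in the positions `p 0, …, p (d - 1)`. -/
def rd (p : ℕ → ℕ) (d : ℕ) (y : ℕ → Fin n) : Fin d → Fin n := fun k => y (p k)

/-- The tuple `t` written into the positions `p 0, …, p (d - 1)` of `y`. -/
def wr (p : ℕ → ℕ) {d : ℕ} (t : Fin d → Fin n) (y : ℕ → Fin n) : ℕ → Fin n :=
  Function.extend (fun k : Fin d => p k) t y

lemma wr_apply {p : ℕ → ℕ} (hp : p.Injective) {d : ℕ} (t : Fin d → Fin n) (y : ℕ → Fin n)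
    (k : Fin d) : wr p t y (p k) = t k :=
  Function.Injective.extend_apply (fun _ _ h => Fin.ext (hp h)) _ _ _

lemma wr_apply_of_ne {p : ℕ → ℕ} {d : ℕ} (t : Fin d → Fin n) (y : ℕ → Fin n) {x : ℕ}
    (hx : ∀ k < d, p k ≠ x) : wr p t y x = y x :=
  Function.extend_apply' _ _ _ fun ⟨k, hk⟩ => hx k k.2 hk

lemma rd_wr {p : ℕ → ℕ} (hp : p.Injective) {d : ℕ} (t : Fin d → Fin n) (y : ℕ → Fin n) :
    rd p d (wr p t y) = t := funext fun k => wr_apply hp t y k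

lemma rd_wr_of_ne {p q : ℕ → ℕ} {d e : ℕ} (t : Fin d → Fin n) (y : ℕ → Fin n)
    (h : ∀ k < d, ∀ b < e, p k ≠ q b) : rd q e (wr p t y) = rd q e y :=
  funext fun b => wr_apply_of_ne t y fun k hk => h k hk b b.2

lemma exists_rd [NeZero n] {p q : ℕ → ℕ} (hp : p.Injective) (hq : q.Injective)
    (hpq : ∀ k b, p k ≠ q b) {d e : ℕ} (t : Fin d → Fin n) (s : Fin e → Fin n) :
    ∃ y, rd p d y = t ∧ rd q e y = s :=
  ⟨wr p t (wr q s fun _ => 0), rd_wr hp _ _, by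
    rw [rd_wr_of_ne _ _ fun k _ b _ => hpq k b, rd_wr hq]⟩

/-- The product of the entries `(P_k)_{J_k, I_k}`: for `P_k = T(u - k)` the signed sum of these over
the permutations of `J` is the minor. -/
def tupleProd {d : ℕ} (P : ℕ → Fin n → Fin n → B) (J I : Fin d → Fin n) : B :=
  (List.ofFn fun k => P k (J k) (I k)).prod

lemma tupleProd_cons {d : ℕ} (P : ℕ → Fin n → Fin n → B) (j : Fin n) (J : Fin d → Fin n)
    (I : Fin (d + 1) → Fin n) : tupleProd P (Fin.cons j J : Fin (d + 1) → Fin n) I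
      = P 0 j (I 0) * tupleProd (fun k => P (k + 1)) J fun k => I k.succ := by
  simp [tupleProd, List.ofFn_succ]

/-- The coaction on families indexed by tuples: `F_I ↦ ∑_J F_J (P_0)_{j_1 i_1} (P_1)_{j_2 i_2} ⋯`,
the sum being over all tuples `J`. -/
def coact {d : ℕ} (P : ℕ → Fin n → Fin n → B) (F : (Fin d → Fin n) → B) (I : Fin d → Fin n) : B :=
  ∑ J, F J * tupleProd P J I

lemma descProd_apply {p : ℕ → ℕ} (hp : p.Injective) (P : ℕ → Fin n → Fin n → B) (d : ℕ)
    (Φ : (ℕ → Fin n) → B) (y : ℕ → Fin n) :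
    descProd 𝕜 p P d Φ y = ∑ J : Fin d → Fin n, Φ (wr p J y) * tupleProd P J (rd p d y) := by
  induction d generalizing p P Φ with
  | zero =>
    rw [Fintype.sum_unique]
    have : wr p (default : Fin 0 → Fin n) y = y :=
      funext fun x => wr_apply_of_ne _ _ fun k hk => absurd hk (Nat.not_lt_zero k)
    simp [this, tupleProd, descProd]
  | succ d ih =>
    have hp' : Function.Injective fun k => p (k + 1) := fun x y h => by have := hp h; omega
    rw [descProd_succ', Module.End.mul_apply, ih hp',
      ← (Fin.consEquiv fun _ => Fin n).sum_comp, Fintype.sum_prod_type_right]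
    refine Finset.sum_congr rfl fun J _ => ?_
    rw [siteOp_apply, Finset.sum_mul]
    refine Finset.sum_congr rfl fun j _ => ?_
    change _ = Φ (wr p (Fin.cons j J : Fin (d + 1) → Fin n) y)
      * tupleProd P (Fin.cons j J : Fin (d + 1) → Fin n) _
    rw [tupleProd_cons, mul_assoc]
    have e1 : wr (fun k => p (k + 1)) J y (p 0) = y (p 0) :=
      wr_apply_of_ne _ _ fun k _ => hp.ne (by simp)
    have e2 : Function.update (wr (fun k => p (k + 1)) J y) (p 0) j
        = wr p (Fin.cons j J : Fin (d + 1) → Fin n) y := by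
      funext x
      by_cases hx : ∃ k < d + 1, p k = x
      · obtain ⟨k, hk, rfl⟩ := hx
        rw [show p k = p ((⟨k, hk⟩ : Fin (d + 1)) : ℕ) from rfl, wr_apply hp]
        rcases k with _ | k
        · simp
        · rw [Function.update_of_ne (hp.ne (by simp))]
          exact wr_apply hp' J y ⟨k, by omega⟩
      · push Not at hx
        rw [Function.update_of_ne (hx 0 (by omega)).symm, wr_apply_of_ne _ _ hx,
          wr_apply_of_ne _ _ fun k hk => hx (k + 1) (by omega)]
    rw [e1, e2]
    rfl

/-- The covector `F_I G_J`, with `I` and `J` in the positions given by `p` and `q`. -/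
def prodCov (p : ℕ → ℕ) (d : ℕ) (q : ℕ → ℕ) (e : ℕ) (F : (Fin d → Fin n) → B)
    (G : (Fin e → Fin n) → B) (y : ℕ → Fin n) : B := F (rd p d y) * G (rd q e y)

lemma tupleProd_commute {d : ℕ} {P : ℕ → Fin n → Fin n → B} {x : B}
    (h : ∀ k i j, Commute (P k i j) x) (J I : Fin d → Fin n) : Commute (tupleProd P J I) x :=
  Commute.list_prod_left _ _ fun a ha => by
    obtain ⟨k, rfl⟩ := List.mem_ofFn.1 ha
    exact h _ _ _

lemma descProd_descProd_prodCov {p q : ℕ → ℕ} (hp : p.Injective) (hq : q.Injective) {d e : ℕ}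
    (hpq : ∀ k < d, ∀ b < e, p k ≠ q b) (P Q : ℕ → Fin n → Fin n → B) (F : (Fin d → Fin n) → B)
    (G : (Fin e → Fin n) → B) (hPG : ∀ k i j J, Commute (P k i j) (G J)) :
    descProd 𝕜 q Q e (descProd 𝕜 p P d (prodCov p d q e F G))
      = prodCov p d q e (coact P F) (coact Q G) := by
  funext y
  rw [descProd_apply hq, prodCov, coact, coact, Finset.mul_sum]
  refine Finset.sum_congr rfl fun K _ => ?_
  rw [descProd_apply hp, Finset.sum_mul, Finset.sum_mul]
  refine Finset.sum_congr rfl fun J _ => ?_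
  have hqp : ∀ b < e, ∀ k < d, q b ≠ p k := fun b hb k hk => (hpq k hk b hb).symm
  rw [prodCov, rd_wr hp, rd_wr_of_ne _ _ hpq, rd_wr hq, rd_wr_of_ne _ _ hqp, mul_assoc (F J),
    ← (tupleProd_commute (fun k i j => hPG k i j K) J _).eq, ← mul_assoc, mul_assoc]

lemma rd_comp_swap {p : ℕ → ℕ} (hp : p.Injective) {d : ℕ} (i j : Fin d) (y : ℕ → Fin n) :
    rd p d (y ∘ Equiv.swap (p i) (p j)) = rd p d y ∘ Equiv.swap i j := by
  funext k
  change y (Equiv.swap (posEmb hp d i) (posEmb hp d j) (posEmb hp d k)) = _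
  rw [(posEmb hp d).injective.swap_apply]
  rfl

lemma rd_comp_swap_of_ne {q : ℕ → ℕ} {e i j : ℕ} (hi : ∀ b < e, q b ≠ i) (hj : ∀ b < e, q b ≠ j)
    (y : ℕ → Fin n) : rd q e (y ∘ Equiv.swap i j) = rd q e y :=
  funext fun b => congrArg y (Equiv.swap_apply_of_ne_of_ne (hi b b.2) (hj b b.2))

lemma antisymmOn_prodCov_left {p q : ℕ → ℕ} (hp : p.Injective) {d e : ℕ}
    (hpq : ∀ k < d, ∀ b < e, p k ≠ q b) {F : (Fin d → Fin n) → B} (hF : IsAlternating F)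
    (G : (Fin e → Fin n) → B) : AntisymmOn (p '' Set.Iio d) (prodCov p d q e F G) := by
  rintro _ ⟨i, hi, rfl⟩ _ ⟨j, hj, rfl⟩ hij y
  have hi : i < d := hi
  have hj : j < d := hj
  have hne : (⟨i, hi⟩ : Fin d) ≠ ⟨j, hj⟩ := fun h => hij (by rw [Fin.mk.inj_iff.1 h])
  have := rd_comp_swap hp (⟨i, hi⟩ : Fin d) ⟨j, hj⟩ y
  rw [prodCov, prodCov, this, rd_comp_swap_of_ne (fun b hb => (hpq i hi b hb).symm)
    (fun b hb => (hpq j hj b hb).symm), hF, Equiv.Perm.sign_swap hne]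
  simp

lemma antisymmOn_prodCov_right {p q : ℕ → ℕ} (hq : q.Injective) {d e : ℕ}
    (hpq : ∀ k < d, ∀ b < e, p k ≠ q b) (F : (Fin d → Fin n) → B) {G : (Fin e → Fin n) → B}
    (hG : IsAlternating G) : AntisymmOn (q '' Set.Iio e) (prodCov p d q e F G) := by
  rintro _ ⟨i, hi, rfl⟩ _ ⟨j, hj, rfl⟩ hij y
  have hi : i < e := hi
  have hj : j < e := hj
  have hne : (⟨i, hi⟩ : Fin e) ≠ ⟨j, hj⟩ := fun h => hij (by rw [Fin.mk.inj_iff.1 h])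
  have := rd_comp_swap hq (⟨i, hi⟩ : Fin e) ⟨j, hj⟩ y
  rw [prodCov, prodCov, this, rd_comp_swap_of_ne (fun b hb => hpq b hb i hi)
    (fun b hb => hpq b hb j hj), hG, Equiv.Perm.sign_swap hne]
  simp

lemma wr_comp_viaEmbedding {r : ℕ → ℕ} (hr : r.Injective) {m : ℕ} (t : Fin m → Fin n)
    (y : ℕ → Fin n) (σ : Equiv.Perm (Fin m)) :
    wr r t y ∘ σ.viaEmbedding (posEmb hr m) = wr r (t ∘ σ) y := by
  funext x
  by_cases hx : x ∈ Set.range (posEmb hr m)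
  · obtain ⟨k, rfl⟩ := hx
    rw [Function.comp_apply, Equiv.Perm.viaEmbedding_apply]
    exact (wr_apply hr t y (σ k)).trans (wr_apply hr (t ∘ σ) y k).symm
  · rw [Function.comp_apply, Equiv.Perm.viaEmbedding_apply_of_notMem _ _ _ hx]
    have h : ∀ k < m, r k ≠ x := fun k hk hkx => hx ⟨⟨k, hk⟩, hkx⟩
    rw [wr_apply_of_ne _ _ h, wr_apply_of_ne _ _ h]

lemma wr_rd (r : ℕ → ℕ) (hr : r.Injective) (m : ℕ) (y : ℕ → Fin n) : wr r (rd r m y) y = y := by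
  funext x
  by_cases hx : ∃ k < m, r k = x
  · obtain ⟨k, hk, rfl⟩ := hx
    exact wr_apply hr (rd r m y) y ⟨k, hk⟩
  · push Not at hx
    exact wr_apply_of_ne _ _ hx

/-- An alternating family stays alternating under the coaction. -/
lemma IsAlternating.coact [NeZero n] (𝕜 : Type*) [CommRing 𝕜] [Algebra 𝕜 B] [IsAddTorsionFree B]
    {d : ℕ} {P : ℕ → Fin n → Fin n → B} (hP : IsDescending 𝕜 P) {F : (Fin d → Fin n) → B}
    (hF : IsAlternating F) : IsAlternating (coact P F) := by
  intro σ t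
  have hid : Function.Injective (id : ℕ → ℕ) := Function.injective_id
  have h0 : AntisymmOn (id '' Set.Iio d) (prodCov id d id 0 F fun _ => (1 : B)) :=
    antisymmOn_prodCov_left hid (fun k _ b hb => absurd hb (Nat.not_lt_zero b)) hF _
  have h1 := congrFun ((h0.descProd (𝕜 := 𝕜) hid hP).permOp_viaEmbedding 𝕜 hid σ)
    (wr id t fun _ => 0)
  have h2 : ∀ y : ℕ → Fin n, descProd 𝕜 id P d (prodCov id d id 0 F fun _ => (1 : B)) y
      = YangianFlag.coact P F (rd id d y) := by
    intro y
    rw [descProd_apply hid]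
    refine Finset.sum_congr rfl fun J _ => ?_
    rw [prodCov, rd_wr hid, mul_one]
  rw [permOp_apply, Pi.smul_apply, h2, h2, wr_comp_viaEmbedding, rd_wr hid, rd_wr hid] at h1
  exact h1

/-- On a covector antisymmetric in two blocks, the antisymmetrizer of their union is a signed sum
over splittings. -/
lemma altOp_apply_eq_splittings [IsAddTorsionFree B] {r : ℕ → ℕ} (hr : r.Injective) {a b : ℕ}
    {Φ : (ℕ → Fin n) → B} (h1 : AntisymmOn (r '' Set.Iio a) Φ)
    (h2 : AntisymmOn ((fun k => r (a + k)) '' Set.Iio b) Φ) (J : Sub n (a + b)) {y : ℕ → Fin n}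
    (hy : rd r (a + b) y = J.tup) :
    altOp 𝕜 r (a + b) Φ y = (a.factorial * b.factorial) • ∑ x ∈ splittings J a b,
      splitSign x • Φ (wr r (Fin.append x.1.tup x.2.tup) y) := by
  have hr' : Function.Injective fun k => r (a + k) := fun x y h => by have := hr h; omega
  have e1 : ∀ (σ : Equiv.Perm (Fin a)) s (t : Fin b → Fin n),
      wr r (Fin.append s t) y ∘ σ.viaEmbedding (posEmb hr a)
        = wr r (Fin.append (s ∘ σ) t) y := by
    intro σ s t
    funext x
    by_cases hx : x ∈ Set.range (posEmb hr a)
    · obtain ⟨k, rfl⟩ := hx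
      rw [Function.comp_apply, Equiv.Perm.viaEmbedding_apply]
      refine (wr_apply hr _ y (Fin.castAdd b (σ k))).trans
        (Eq.trans ?_ (wr_apply hr _ y (Fin.castAdd b k)).symm)
      simp
    · rw [Function.comp_apply, Equiv.Perm.viaEmbedding_apply_of_notMem _ _ _ hx]
      by_cases hx' : ∃ k < a + b, r k = x
      · obtain ⟨k, hk, rfl⟩ := hx'
        have hak : a ≤ k := by
          by_contra hak
          exact hx ⟨⟨k, by omega⟩, rfl⟩
        obtain ⟨k, rfl⟩ := Nat.exists_eq_add_of_le hak
        refine (wr_apply hr _ y (Fin.natAdd a ⟨k, by omega⟩)).trans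
          (Eq.trans ?_ (wr_apply hr _ y (Fin.natAdd a ⟨k, by omega⟩)).symm)
        rw [Fin.append_right, Fin.append_right]
      · push Not at hx'
        rw [wr_apply_of_ne _ _ hx', wr_apply_of_ne _ _ hx']
  have e2 : ∀ (τ : Equiv.Perm (Fin b)) (s : Fin a → Fin n) t,
      wr r (Fin.append s t) y ∘ τ.viaEmbedding (posEmb hr' b)
        = wr r (Fin.append s (t ∘ τ)) y := by
    intro τ s t
    funext x
    by_cases hx : x ∈ Set.range (posEmb hr' b)
    · obtain ⟨k, rfl⟩ := hx
      rw [Function.comp_apply, Equiv.Perm.viaEmbedding_apply]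
      refine (wr_apply hr _ y (Fin.natAdd a (τ k))).trans
        (Eq.trans ?_ (wr_apply hr _ y (Fin.natAdd a k)).symm)
      simp
    · rw [Function.comp_apply, Equiv.Perm.viaEmbedding_apply_of_notMem _ _ _ hx]
      by_cases hx' : ∃ k < a + b, r k = x
      · obtain ⟨k, hk, rfl⟩ := hx'
        have hak : k < a := by
          by_contra hak
          refine hx ⟨⟨k - a, by omega⟩, ?_⟩
          change r (a + (k - a)) = r k
          congr 1
          omega
        refine (wr_apply hr _ y (Fin.castAdd b ⟨k, hak⟩)).trans
          (Eq.trans ?_ (wr_apply hr _ y (Fin.castAdd b ⟨k, hak⟩)).symm)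
        rw [Fin.append_left, Fin.append_left]
      · push Not at hx'
        rw [wr_apply_of_ne _ _ hx', wr_apply_of_ne _ _ hx']
  rw [altOp_apply_eq_sum hr, ← sum_perm_eq_sum_splittings fun t => Φ (wr r t y)]
  · refine Finset.sum_congr rfl fun σ _ => ?_
    have : y ∘ σ.viaEmbedding (posEmb hr (a + b)) = wr r (J.tup ∘ σ) y := by
      rw [← hy, ← wr_comp_viaEmbedding hr, wr_rd r hr]
    rw [this]
  · intro σ τ s t
    have f1 := congrFun (h1.permOp_viaEmbedding 𝕜 hr σ) (wr r (Fin.append s (t ∘ τ)) y)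
    have f2 := congrFun (h2.permOp_viaEmbedding 𝕜 hr' τ) (wr r (Fin.append s t) y)
    rw [permOp_apply, e1, Pi.smul_apply] at f1
    rw [permOp_apply, e2, Pi.smul_apply] at f2
    rw [f1, f2, smul_smul]

/-- The antisymmetrizer of a block vanishes on a covector as soon as it vanishes where the entries
in the block are increasing. -/
lemma altOp_eq_zero_of_tup [IsAddTorsionFree B] {r : ℕ → ℕ} (hr : r.Injective) {m : ℕ}
    {Φ : (ℕ → Fin n) → B} {y : ℕ → Fin n} (h : ∀ J : Sub n m, altOp 𝕜 r m Φ (wr r J.tup y) = 0) :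
    altOp 𝕜 r m Φ y = 0 := by
  have halt : IsAlternating fun t => altOp 𝕜 r m Φ (wr r t y) := fun σ t => by
    have := congrFun ((antisymmOn_altOp 𝕜 hr m Φ).permOp_viaEmbedding 𝕜 hr σ) (wr r t y)
    rwa [permOp_apply, wr_comp_viaEmbedding] at this
  have := halt.eq_zero_of_tup h (rd r m y)
  rwa [wr_rd r hr] at this

/-- The antisymmetrizer depends only on the set of positions. -/
lemma altOp_congr [IsAddTorsionFree B] {r s : ℕ → ℕ} (hr : r.Injective) (hs : s.Injective) {m : ℕ}
    (hrs : r '' Set.Iio m = s '' Set.Iio m) :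
    (altOp 𝕜 r m : Module.End 𝕜 ((ℕ → Fin n) → B)) = altOp 𝕜 s m := by
  refine LinearMap.ext fun Φ => smul_left_cancel_fun
    (eq_zero_of_natCast_smul (𝕜 := 𝕜) m.factorial_ne_zero) ?_
  have h1 : altOp 𝕜 r m * altOp 𝕜 s m
      = (m.factorial : 𝕜) • (altOp 𝕜 r m : Module.End 𝕜 ((ℕ → Fin n) → B)) := by
    refine mul_altOp_of_antisymm 𝕜 fun i hi j hj hij => ?_
    obtain ⟨i', hi', hi''⟩ : s i ∈ r '' Set.Iio m := hrs ▸ mem_image_Iio hi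
    obtain ⟨j', hj', hj''⟩ : s j ∈ r '' Set.Iio m := hrs ▸ mem_image_Iio hj
    rw [← hi'', ← hj'']
    refine altOp_mul_permOp hr hi' hj' ?_
    rintro rfl
    exact hij (hs (hi''.symm.trans hj''))
  have h2 := altOp_apply_of_antisymmOn 𝕜 hr (hrs ▸ antisymmOn_altOp 𝕜 hs m Φ)
  rw [← h2]
  exact (LinearMap.congr_fun h1 Φ).symm

lemma descProd_congr {p p' : ℕ → ℕ} {P P' : ℕ → Fin n → Fin n → B} {m : ℕ}
    (h : ∀ k < m, p k = p' k) (h' : ∀ k < m, P k = P' k) :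
    descProd 𝕜 p P m = descProd 𝕜 p' P' m := by
  induction m with
  | zero => rfl
  | succ m ih =>
    rw [descProd, descProd, h m (by omega), h' m (by omega),
      ih (fun k hk => h k (by omega)) fun k hk => h' k (by omega)]

/-- The sequence `f 0, …, f (m - 1), g 0, g 1, …`. -/
def glue {X : Type*} (m : ℕ) (f g : ℕ → X) (k : ℕ) : X := if k < m then f k else g (k - m)

lemma glue_of_lt {X : Type*} {m : ℕ} (f g : ℕ → X) {k : ℕ} (hk : k < m) : glue m f g k = f k :=
  if_pos hk

lemma glue_add {X : Type*} (m : ℕ) (f g : ℕ → X) (k : ℕ) : glue m f g (m + k) = g k := by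
  rw [glue, if_neg (by omega), Nat.add_sub_cancel_left]

lemma glue_injective {m : ℕ} {f g : ℕ → ℕ} (hf : f.Injective) (hg : g.Injective)
    (hfg : ∀ k b, f k ≠ g b) : (glue m f g).Injective := by
  intro x y h
  unfold glue at h
  split_ifs at h with h1 h2 h2
  · exact hf h
  · exact absurd h (hfg _ _)
  · exact absurd h.symm (hfg _ _)
  · have := hg h
    omega

lemma image_glue (m k : ℕ) (f g : ℕ → ℕ) :
    glue m f g '' Set.Iio (m + k) = f '' Set.Iio m ∪ g '' Set.Iio k := by
  ext x
  constructor
  · rintro ⟨i, hi, rfl⟩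
    have hi : i < m + k := hi
    rcases lt_or_ge i m with h | h
    · exact Or.inl ⟨i, h, (glue_of_lt f g h).symm⟩
    · obtain ⟨i, rfl⟩ := Nat.exists_eq_add_of_le h
      exact Or.inr ⟨i, Nat.lt_of_add_lt_add_left hi, (glue_add m f g i).symm⟩
  · rintro (⟨i, hi, rfl⟩ | ⟨i, hi, rfl⟩)
    · exact ⟨i, Nat.lt_add_right k hi, glue_of_lt f g hi⟩
    · exact ⟨m + i, Nat.add_lt_add_left hi m, glue_add m f g i⟩

lemma rd_add (p : ℕ → ℕ) (a b : ℕ) (y : ℕ → Fin n) :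
    rd p (a + b) y = Fin.append (rd p a y) (rd (fun k => p (a + k)) b y) := by
  funext i
  refine Fin.addCases (fun i => ?_) (fun i => ?_) i <;> simp [rd]

end Evaluation

/-! ### Pairs of tuples in even and odd positions -/

section Covariance

variable {B : Type*} [Ring B] {n : ℕ}

lemma rd_glue (m k : ℕ) (f g : ℕ → ℕ) (y : ℕ → Fin n) :
    rd (glue m f g) (m + k) y = Fin.append (rd f m y) (rd g k y) := by
  rw [rd_add]
  congr 1
  · exact funext fun i => congrArg y (glue_of_lt f g i.2)
  · exact funext fun i => congrArg y (glue_add m f g i)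

lemma rd_wr_append_left {p : ℕ → ℕ} (hp : p.Injective) {a b : ℕ} (s : Fin a → Fin n)
    (t : Fin b → Fin n) (y : ℕ → Fin n) : rd p a (wr p (Fin.append s t) y) = s :=
  funext fun k => (wr_apply hp _ y (Fin.castAdd b k)).trans (Fin.append_left s t k)

lemma rd_wr_append_right {p : ℕ → ℕ} (hp : p.Injective) {a b : ℕ} (s : Fin a → Fin n)
    (t : Fin b → Fin n) (y : ℕ → Fin n) :
    rd (fun k => p (a + k)) b (wr p (Fin.append s t) y) = t :=
  funext fun k => (wr_apply hp _ y (Fin.natAdd a k)).trans (Fin.append_right s t k)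

lemma AntisymmOn.eq_zero_of_tup [IsAddTorsionFree B] {r : ℕ → ℕ} (hr : r.Injective) {m : ℕ}
    {Φ : (ℕ → Fin n) → B} (hΦ : AntisymmOn (r '' Set.Iio m) Φ) {y : ℕ → Fin n}
    (h : ∀ J : Sub n m, Φ (wr r J.tup y) = 0) : Φ y = 0 := by
  have halt : IsAlternating fun t => Φ (wr r t y) := fun σ t => by
    have := congrFun (hΦ.permOp_viaEmbedding ℤ hr σ) (wr r t y)
    rwa [permOp_apply, wr_comp_viaEmbedding] at this
  have := halt.eq_zero_of_tup h (rd r m y)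
  rwa [wr_rd r hr] at this

/-- The even positions: these and the odd ones hold the two tuples of a product of two families. -/
def evenPos (k : ℕ) : ℕ := 2 * k

/-- The odd positions. -/
def oddPos (k : ℕ) : ℕ := 2 * k + 1

lemma evenPos_injective : Function.Injective evenPos := fun x y h => by
  unfold evenPos at h; omega

lemma oddPos_injective : Function.Injective oddPos := fun x y h => by
  unfold oddPos at h; omega

lemma evenPos_ne_oddPos (k b : ℕ) : evenPos k ≠ oddPos b := by
  unfold evenPos oddPos; omega

lemma shift_injective {p : ℕ → ℕ} (hp : p.Injective) (a : ℕ) :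
    Function.Injective fun k => p (a + k) := fun x y h => by have := hp h; omega

/-! ### Covariance of Young symmetry -/

/-- The Young symmetry sum for two families with coefficients in a ring. -/
def youngExpr {a b e : ℕ} (f : (Fin (a + b) → Fin n) → B) (g : (Fin e → Fin n) → B)
    (I : Fin a → Fin n) (J : Sub n (b + e)) : B :=
  ∑ x ∈ splittings J b e, splitSign x • (f (Fin.append I x.1.tup) * g x.2.tup)

lemma altOp_prodCov_young (𝕜 : Type*) [CommRing 𝕜] [Algebra 𝕜 B] [IsAddTorsionFree B] {a b e : ℕ}
    {f : (Fin (a + b) → Fin n) → B} (hf : IsAlternating f) {g : (Fin e → Fin n) → B}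
    (hg : IsAlternating g) (J : Sub n (b + e)) {y : ℕ → Fin n}
    (hy : rd (glue b (fun k => evenPos (a + k)) oddPos) (b + e) y = J.tup) :
    altOp 𝕜 (glue b (fun k => evenPos (a + k)) oddPos) (b + e)
        (prodCov evenPos (a + b) oddPos e f g) y
      = (b.factorial * e.factorial) • youngExpr f g (rd evenPos a y) J := by
  have hr : (glue b (fun k => evenPos (a + k)) oddPos).Injective :=
    glue_injective (shift_injective evenPos_injective a) oddPos_injective
      fun k b => evenPos_ne_oddPos _ b
  rw [altOp_apply_eq_splittings hr _ _ J hy, youngExpr]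
  · congr 1
    refine Finset.sum_congr rfl fun x _ => ?_
    have e1 := rd_wr_append_left hr x.1.tup x.2.tup y
    have e2 := rd_wr_append_right hr x.1.tup x.2.tup y
    have e3 : rd evenPos a (wr (glue b (fun k => evenPos (a + k)) oddPos)
        (Fin.append x.1.tup x.2.tup) y) = rd evenPos a y := by
      refine rd_wr_of_ne _ _ fun k _ j hj => ?_
      unfold glue
      split_ifs
      · exact evenPos_injective.ne (by omega)
      · exact (evenPos_ne_oddPos _ _).symm
    have e4 : rd (fun k => evenPos (a + k)) b (wr (glue b (fun k => evenPos (a + k)) oddPos)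
        (Fin.append x.1.tup x.2.tup) y) = x.1.tup := by
      refine Eq.trans ?_ e1
      exact funext fun k => congrArg _ (glue_of_lt (fun k => evenPos (a + k)) oddPos k.2).symm
    have e5 : rd oddPos e (wr (glue b (fun k => evenPos (a + k)) oddPos)
        (Fin.append x.1.tup x.2.tup) y) = x.2.tup := by
      refine Eq.trans ?_ e2
      funext k
      simp only [rd, glue_add]
    rw [prodCov, rd_add, e3, e4, e5]
  · refine (antisymmOn_prodCov_left evenPos_injective
      (fun k _ b _ => evenPos_ne_oddPos k b) hf g).mono ?_
    rintro _ ⟨k, hk, rfl⟩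
    exact ⟨a + k, Nat.add_lt_add_left hk a,
      (glue_of_lt (fun k => evenPos (a + k)) oddPos hk).symm⟩
  · refine (antisymmOn_prodCov_right oddPos_injective
      (fun k _ b _ => evenPos_ne_oddPos k b) f hg).mono ?_
    rintro _ ⟨k, hk, rfl⟩
    exact ⟨k, hk, (glue_add b _ _ k).symm⟩

/-- Young symmetry is preserved by the coaction when the parameters of `Q` followed by the last ones
of `P` form one descending string. -/
theorem youngExpr_coact (𝕜 : Type*) [CommRing 𝕜] [Algebra 𝕜 B] [IsAddTorsionFree B] [NeZero n]
    {a b e : ℕ} {f : (Fin (a + b) → Fin n) → B} (hf : IsAlternating f) {g : (Fin e → Fin n) → B}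
    (hg : IsAlternating g) {P Q : ℕ → Fin n → Fin n → B} (hP : IsDescending 𝕜 P)
    (hQ : IsDescending 𝕜 Q) (hQP : IsDescending 𝕜 (glue e Q fun k => P (a + k)))
    (hPg : ∀ k i j J, Commute (P k i j) (g J)) (h : ∀ I J, youngExpr f g I J = 0)
    (I : Fin a → Fin n) (J : Sub n (b + e)) : youngExpr (coact P f) (coact Q g) I J = 0 := by
  set p' : ℕ → ℕ := fun k => evenPos (a + k) with hp'
  set P' : ℕ → Fin n → Fin n → B := fun k => P (a + k) with hP'
  have hp'i : p'.Injective := shift_injective evenPos_injective a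
  -- the positions of the antisymmetrized block, in the two orders of its parts
  set r : ℕ → ℕ := glue b p' oddPos with hr
  set s : ℕ → ℕ := glue e oddPos p' with hs
  have hri : r.Injective := glue_injective hp'i oddPos_injective fun k b => evenPos_ne_oddPos _ b
  have hsi : s.Injective :=
    glue_injective oddPos_injective hp'i fun k b => (evenPos_ne_oddPos _ k).symm
  set Φ : (ℕ → Fin n) → B := prodCov evenPos (a + b) oddPos e f g with hΦ
  have hΦ0 : altOp 𝕜 r (b + e) Φ = 0 := by
    funext y
    refine altOp_eq_zero_of_tup hri fun J => ?_
    rw [altOp_prodCov_young 𝕜 hf hg J (rd_wr hri _ _), h, smul_zero]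
  have hsr : (altOp 𝕜 s (e + b) : Module.End 𝕜 ((ℕ → Fin n) → B)) = altOp 𝕜 r (b + e) := by
    rw [add_comm e b]
    refine altOp_congr hsi hri ?_
    rw [hr, image_glue, add_comm b e, hs, image_glue, Set.union_comm]
  have hcomm : ∀ i j, Commute (permOp 𝕜 (Equiv.swap (s i) (s j)) :
      Module.End 𝕜 ((ℕ → Fin n) → B)) (descProd 𝕜 evenPos P a) := by
    intro i j
    refine commute_descProd 𝕜 fun k hk => ?_
    have hpos : ∀ j, evenPos k ≠ s j := by
      intro j
      simp only [hs, glue]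
      split_ifs
      · exact evenPos_ne_oddPos _ _
      · exact evenPos_injective.ne (by omega)
    exact permOp_swap_commute_siteOp 𝕜 _ (hpos i) (hpos j)
  have hbase : Commute (altOp 𝕜 s (e + b)) (descProd 𝕜 evenPos P a) :=
    commute_altOp 𝕜 fun i _ j _ _ => hcomm i j
  have h1 : AntisymmOn (s '' Set.Iio e) (descProd 𝕜 evenPos P a Φ) := by
    have h1 : AntisymmOn (s '' Set.Iio e) Φ :=
      (antisymmOn_prodCov_right oddPos_injective
        (fun k _ b _ => evenPos_ne_oddPos k b) f hg).mono (by
          rintro _ ⟨k, hk, rfl⟩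
          exact ⟨k, hk, (glue_of_lt _ _ hk).symm⟩)
    refine h1.apply 𝕜 ?_
    rintro _ ⟨i, -, rfl⟩ _ ⟨j, -, rfl⟩ -
    exact hcomm i j
  have h2 : AntisymmOn ((fun k => s (e + k)) '' Set.Iio b) (descProd 𝕜 evenPos P a Φ) := by
    have h2 : AntisymmOn ((fun k => s (e + k)) '' Set.Iio b) Φ :=
      (antisymmOn_prodCov_left evenPos_injective
        (fun k _ b _ => evenPos_ne_oddPos k b) hf g).mono (by
          rintro _ ⟨k, hk, rfl⟩
          exact ⟨a + k, Nat.add_lt_add_left hk a, (glue_add e oddPos p' k).symm⟩)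
    refine h2.apply 𝕜 ?_
    rintro _ ⟨i, -, rfl⟩ _ ⟨j, -, rfl⟩ -
    exact hcomm _ _
  have key := altOp_descProd_descProd hsi hQP h1 h2
  have e1 : descProd 𝕜 s (glue e Q P') e = descProd 𝕜 oddPos Q e :=
    descProd_congr (fun k hk => glue_of_lt _ _ hk) fun k hk => glue_of_lt _ _ hk
  have e2 : descProd 𝕜 (fun k => s (e + k)) (fun k => glue e Q P' (e + k)) b
      = descProd 𝕜 p' P' b :=
    descProd_congr (fun k _ => glue_add _ _ _ _) fun k _ => glue_add _ _ _ _
  have e3 : descProd 𝕜 p' P' b (descProd 𝕜 evenPos P a Φ) = descProd 𝕜 evenPos P (a + b) Φ := by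
    rw [descProd_add]
    rfl
  rw [e1, e2, e3, hΦ, descProd_descProd_prodCov evenPos_injective oddPos_injective
    (fun k _ b _ => evenPos_ne_oddPos k b) P Q f g hPg, ← hΦ,
    ← Module.End.mul_apply (altOp 𝕜 s (e + b)) (descProd 𝕜 evenPos P a), hbase.eq,
    Module.End.mul_apply, hsr, hΦ0, map_zero, map_zero] at key
  have hy := altOp_prodCov_young 𝕜 (hf.coact 𝕜 hP) (hg.coact 𝕜 hQ) J
    (y := wr r J.tup (wr evenPos I fun _ => 0)) (rd_wr hri _ _)
  have hrd : rd evenPos a (wr r J.tup (wr evenPos I fun _ => 0)) = I := by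
    rw [rd_wr_of_ne, rd_wr evenPos_injective]
    intro k _ j hj
    simp only [hr, glue]
    split_ifs
    · exact evenPos_injective.ne (by omega)
    · exact (evenPos_ne_oddPos _ _).symm
  rw [key, hrd] at hy
  exact (nsmul_eq_zero_iff.1 hy.symm).resolve_right
    (Nat.mul_ne_zero b.factorial_ne_zero e.factorial_ne_zero)

/-! ### Covariance of monomial straightening -/

/-- The right-hand side of the straightening relation for two families with coefficients in a
ring. -/
def straightenExpr {a d : ℕ} (f : (Fin d → Fin n) → B) (g : (Fin (a + d) → Fin n) → B)
    (I : Fin d → Fin n) (J : Sub n (a + d)) : B :=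
  ∑ x ∈ splittings J a d, splitSign x • (f x.2.tup * g (Fin.append x.1.tup I))

lemma evenPos_add_ne_glue {a : ℕ} (k j : ℕ) : evenPos (a + k) ≠ glue a evenPos oddPos j := by
  unfold glue
  split_ifs
  · exact evenPos_injective.ne (by omega)
  · exact evenPos_ne_oddPos _ _

lemma glue_evenPos_oddPos_injective (a : ℕ) : (glue a evenPos oddPos).Injective :=
  glue_injective evenPos_injective oddPos_injective evenPos_ne_oddPos

section StraightenCov

variable {a d : ℕ}

/-- The covector `f_{J₂} g_{J₁|I}`, where `J₁|J₂` is in the even and `I` in the odd positions. -/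
def straightenCov (f : (Fin d → Fin n) → B) (g : (Fin (a + d) → Fin n) → B) :
    (ℕ → Fin n) → B :=
  prodCov (fun k => evenPos (a + k)) d (glue a evenPos oddPos) (a + d) f g

lemma antisymmOn_straightenCov_glue {f : (Fin d → Fin n) → B} {g : (Fin (a + d) → Fin n) → B}
    (hg : IsAlternating g) :
    AntisymmOn (glue a evenPos oddPos '' Set.Iio (a + d)) (straightenCov f g) :=
  antisymmOn_prodCov_right (glue_evenPos_oddPos_injective a)
    (fun k _ b _ => evenPos_add_ne_glue k b) f hg

lemma antisymmOn_straightenCov_left {f : (Fin d → Fin n) → B} {g : (Fin (a + d) → Fin n) → B}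
    (hg : IsAlternating g) : AntisymmOn (evenPos '' Set.Iio a) (straightenCov f g) :=
  (antisymmOn_straightenCov_glue hg).mono (by rw [image_glue]; exact Set.subset_union_left)

lemma antisymmOn_straightenCov_odd {f : (Fin d → Fin n) → B} {g : (Fin (a + d) → Fin n) → B}
    (hg : IsAlternating g) : AntisymmOn (oddPos '' Set.Iio d) (straightenCov f g) :=
  (antisymmOn_straightenCov_glue hg).mono (by rw [image_glue]; exact Set.subset_union_right)

lemma antisymmOn_straightenCov_right {f : (Fin d → Fin n) → B} (hf : IsAlternating f)
    (g : (Fin (a + d) → Fin n) → B) :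
    AntisymmOn ((fun k => evenPos (a + k)) '' Set.Iio d) (straightenCov f g) :=
  antisymmOn_prodCov_left (shift_injective evenPos_injective a)
    (fun k _ b _ => evenPos_add_ne_glue k b) hf g

lemma altOp_straightenCov (𝕜 : Type*) [CommRing 𝕜] [Algebra 𝕜 B] [IsAddTorsionFree B]
    {f : (Fin d → Fin n) → B} (hf : IsAlternating f) {g : (Fin (a + d) → Fin n) → B}
    (hg : IsAlternating g) (J : Sub n (a + d)) {y : ℕ → Fin n}
    (hy : rd evenPos (a + d) y = J.tup) :
    altOp 𝕜 evenPos (a + d) (straightenCov f g) y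
      = (a.factorial * d.factorial) • straightenExpr f g (rd oddPos d y) J := by
  rw [altOp_apply_eq_splittings evenPos_injective (antisymmOn_straightenCov_left hg)
    (antisymmOn_straightenCov_right hf g) J hy, straightenExpr]
  congr 1
  refine Finset.sum_congr rfl fun x _ => ?_
  rw [straightenCov, prodCov, rd_wr_append_right evenPos_injective, rd_glue,
    rd_wr_append_left evenPos_injective, rd_wr_of_ne _ _ fun k _ b _ => evenPos_ne_oddPos k b]

/-- The straightening relation is preserved by the coaction: the fused products reassemble as in the
Young symmetry. -/
theorem straightenExpr_coact (𝕜 : Type*) [CommRing 𝕜] [Algebra 𝕜 B] [IsAddTorsionFree B] [NeZero n]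
    {f : (Fin d → Fin n) → B} (hf : IsAlternating f) {g : (Fin (a + d) → Fin n) → B}
    (hg : IsAlternating g) {P : ℕ → Fin n → Fin n → B} (hP : IsDescending 𝕜 P)
    (hPf : ∀ k i j J, Commute (P k i j) (f J)) (hPg : ∀ k i j J, Commute (P k i j) (g J))
    (h : ∀ (I : Sub n d) (J : Sub n (a + d)), g J.tup * f I.tup = straightenExpr f g I.tup J)
    (I : Sub n d) (J : Sub n (a + d)) :
    coact P g J.tup * coact (fun k => P (a + k)) f I.tup
      = straightenExpr (coact (fun k => P (a + k)) f) (coact P g) I.tup J := by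
  set N := a.factorial * d.factorial with hN
  have hN0 : N ≠ 0 := Nat.mul_ne_zero a.factorial_ne_zero d.factorial_ne_zero
  set P' : ℕ → Fin n → Fin n → B := fun k => P (a + k) with hP'
  set Φ : (ℕ → Fin n) → B := prodCov evenPos (a + d) oddPos d g f with hΦ
  have hΦp : AntisymmOn (evenPos '' Set.Iio (a + d)) Φ :=
    antisymmOn_prodCov_left evenPos_injective (fun k _ b _ => evenPos_ne_oddPos k b) hg f
  have hΦq : AntisymmOn (oddPos '' Set.Iio d) Φ :=
    antisymmOn_prodCov_right oddPos_injective (fun k _ b _ => evenPos_ne_oddPos k b) g hf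
  -- the relation, for arbitrary tuples
  have hrel : altOp 𝕜 evenPos (a + d) (straightenCov f g) = N • Φ := by
    have hp : AntisymmOn (evenPos '' Set.Iio (a + d))
        (altOp 𝕜 evenPos (a + d) (straightenCov f g) - N • Φ) := by
      intro i hi j hj hij y
      simp only [Pi.sub_apply, Pi.smul_apply, hΦp i hi j hj hij,
        antisymmOn_altOp 𝕜 evenPos_injective _ _ i hi j hj hij, smul_neg]
      abel
    have hq : AntisymmOn (oddPos '' Set.Iio d)
        (altOp 𝕜 evenPos (a + d) (straightenCov f g) - N • Φ) := by
      have h1 : AntisymmOn (oddPos '' Set.Iio d)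
          (altOp 𝕜 evenPos (a + d) (straightenCov f g)) := by
        refine (antisymmOn_straightenCov_odd hg).apply 𝕜 ?_
        rintro _ ⟨i, -, rfl⟩ _ ⟨j, -, rfl⟩ -
        refine (commute_altOp 𝕜 fun k _ l _ _ => ?_).symm
        rw [Commute, SemiconjBy, ← permOp_mul, ← permOp_mul]
        congr 1
        rw [Equiv.mul_swap_eq_swap_mul, Equiv.swap_apply_of_ne_of_ne
          (evenPos_ne_oddPos _ _).symm (evenPos_ne_oddPos _ _).symm,
          Equiv.swap_apply_of_ne_of_ne (evenPos_ne_oddPos _ _).symm (evenPos_ne_oddPos _ _).symm]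
      intro i hi j hj hij y
      simp only [Pi.sub_apply, Pi.smul_apply, hΦq i hi j hj hij, h1 i hi j hj hij, smul_neg]
      abel
    funext y
    refine sub_eq_zero.1 (hp.eq_zero_of_tup evenPos_injective fun J =>
      hq.eq_zero_of_tup oddPos_injective fun I => ?_)
    have e1 : rd evenPos (a + d) (wr oddPos I.tup (wr evenPos J.tup y)) = J.tup := by
      rw [rd_wr_of_ne _ _ fun k _ b _ => (evenPos_ne_oddPos b k).symm, rd_wr evenPos_injective]
    rw [Pi.sub_apply, altOp_straightenCov 𝕜 hf hg J e1, Pi.smul_apply, hΦ, prodCov, e1,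
      rd_wr oddPos_injective, h, sub_self]
  have hq : Commute (altOp 𝕜 evenPos (a + d)) (descProd 𝕜 oddPos P' d) :=
    commute_descProd 𝕜 fun k _ => commute_altOp 𝕜 fun i _ j _ _ =>
      permOp_swap_commute_siteOp 𝕜 _ (evenPos_ne_oddPos _ _).symm (evenPos_ne_oddPos _ _).symm
  have key := altOp_descProd_descProd evenPos_injective hP (antisymmOn_straightenCov_left hg)
    (antisymmOn_straightenCov_right hf g)
  have key := congrArg (descProd 𝕜 oddPos P' d) key
  rw [← Module.End.mul_apply (descProd 𝕜 oddPos P' d), ← hq.eq, Module.End.mul_apply, hrel,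
    map_nsmul, map_nsmul, descProd_descProd_prodCov evenPos_injective oddPos_injective
      (fun k _ b _ => evenPos_ne_oddPos k b) P P' g f hPf] at key
  have e1 : descProd 𝕜 (glue a evenPos oddPos) P (a + d)
      = descProd 𝕜 oddPos P' d * descProd 𝕜 evenPos P a := by
    rw [descProd_add]
    congr 1
    · exact descProd_congr (fun k _ => glue_add _ _ _ _) fun k _ => rfl
    · exact descProd_congr (fun k hk => glue_of_lt _ _ hk) fun k _ => rfl
  have e2 := descProd_descProd_prodCov (𝕜 := 𝕜) (shift_injective evenPos_injective a)
    (glue_evenPos_oddPos_injective a) (fun k (_ : k < d) b (_ : b < a + d) =>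
      evenPos_add_ne_glue k b) P' P f g fun k i j J => hPg (a + k) i j J
  rw [e1, Module.End.mul_apply] at e2
  rw [show prodCov (fun k => evenPos (a + k)) d (glue a evenPos oddPos) (a + d) f g
    = straightenCov f g from rfl] at e2
  rw [e2] at key
  obtain ⟨y, hy1, hy2⟩ := exists_rd evenPos_injective oddPos_injective evenPos_ne_oddPos
    J.tup I.tup
  have e3 := altOp_straightenCov 𝕜 (hf.coact 𝕜 (hP.shift a)) (hg.coact 𝕜 hP) J hy1
  rw [straightenCov, congrFun key y, Pi.smul_apply, prodCov, hy1, hy2, ← hN] at e3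
  exact nsmul_right_injective hN0 e3

end StraightenCov

end Covariance

/-! ### Covariance of the commuting relations -/

section CommutingCov

variable {𝕜 B : Type*} [CommRing 𝕜] [Ring B] [Algebra 𝕜 B] {n d e : ℕ}

/-- The sum over all sets of `m` positions in `I` and in `J` of the products of the two families
with the corresponding entries of `I` and `J` interchanged. -/
def exchangeSum (f : (Fin d → Fin n) → B) (g : (Fin e → Fin n) → B) (I : Fin d → Fin n)
    (J : Fin e → Fin n) (m : ℕ) : B :=
  ∑ K : Sub d m, ∑ L : Sub e m, f (exchange I J K L) * g (exchange J I L K)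

/-- There is one pair of empty sets of positions, and it exchanges nothing. -/
lemma exchangeSum_zero (f : (Fin d → Fin n) → B) (g : (Fin e → Fin n) → B) (I : Fin d → Fin n)
    (J : Fin e → Fin n) : exchangeSum f g I J 0 = f I * g J := by
  have h0 : ∀ {k : ℕ} (K : Sub k 0), K.1 = ∅ := fun K => Finset.card_eq_zero.1 K.2
  have hu : ∀ k : ℕ, (Finset.univ : Finset (Sub k 0)) = {⟨∅, rfl⟩} := fun k => by
    ext K
    simp only [Finset.mem_univ, Finset.mem_singleton, true_iff]
    exact Subtype.ext (h0 K)
  have h1 : ∀ {k l : ℕ} (s : Fin k → Fin n) (t : Fin l → Fin n) K L,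
      exchange (p := 0) s t K L = s := fun s t K L => funext fun b =>
    exchange_of_notMem _ _ _ _ (by simp [h0 K])
  simp only [exchangeSum, h1, hu, Finset.sum_singleton]

/-- The commuting relation with cleared denominators: `w b` stands for `u - v - e + b + 1`, and `δ`
for `1`. -/
def CommutingRel (δ : 𝕜) (w : ℕ → 𝕜) (f : (Fin d → Fin n) → B) (g : (Fin e → Fin n) → B)
    (I : Fin d → Fin n) (J : Fin e → Fin n) : Prop :=
  (∏ b ∈ Finset.Ico 0 d, w b) • (g J * f I - f I * g J)
    = ∑ m ∈ Finset.Icc 1 d, ((-1 : ℤ) ^ (m - 1) * (m.factorial : ℤ)) •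
      ((δ ^ m * ∏ b ∈ Finset.Ico m d, w b) •
        ((d.choose m : ℤ) • (g J * f I) - exchangeSum f g I J m))

/-- The form `c g_J(u) f_I(v) = ∑_m c_m ∑_{K,L} f(v) g(u)` of the commuting relation, in which the
subtracted product `f_I(v) g_J(u)` is the term with `m = 0`. -/
lemma commutingRel_iff (δ : 𝕜) (w : ℕ → 𝕜) (f : (Fin d → Fin n) → B) (g : (Fin e → Fin n) → B)
    (I : Fin d → Fin n) (J : Fin e → Fin n) : CommutingRel δ w f g I J ↔
      (∑ m ∈ Finset.range (d + 1), (d.choose m : 𝕜) * ((m.factorial : 𝕜) * matchWeight δ w d m))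
          • (g J * f I)
        = ∑ m ∈ Finset.range (d + 1),
          ((m.factorial : 𝕜) * matchWeight δ w d m) • exchangeSum f g I J m := by
  have hI : Finset.Icc 1 d = (Finset.range d).image Nat.succ := by
    ext x
    simp only [Finset.mem_Icc, Finset.mem_image, Finset.mem_range]
    exact ⟨fun h => ⟨x - 1, by omega, by omega⟩, by rintro ⟨y, hy, rfl⟩; omega⟩
  rw [CommutingRel, hI, Finset.sum_image fun _ _ _ _ h => Nat.succ_injective h,
    Finset.sum_range_succ', Finset.sum_range_succ', exchangeSum_zero, add_smul, Finset.sum_smul]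
  have hm : matchWeight δ w d 0 = ∏ b ∈ Finset.Ico 0 d, w b := by simp [matchWeight]
  have ht : ∀ m, ((-1 : ℤ) ^ (m.succ - 1) * (m.succ.factorial : ℤ)) •
      ((δ ^ m.succ * ∏ b ∈ Finset.Ico m.succ d, w b) •
        ((d.choose m.succ : ℤ) • (g J * f I) - exchangeSum f g I J m.succ))
      = (((m + 1).factorial : 𝕜) * matchWeight δ w d (m + 1)) • exchangeSum f g I J (m + 1)
        - ((d.choose (m + 1) : 𝕜) * (((m + 1).factorial : 𝕜) * matchWeight δ w d (m + 1)))
          • (g J * f I) := by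
    intro m
    rw [← Int.cast_smul_eq_zsmul 𝕜, ← Int.cast_smul_eq_zsmul 𝕜, matchWeight]
    simp only [Nat.succ_eq_add_one, Nat.add_sub_cancel]
    push_cast
    rw [neg_pow δ, pow_succ (-1 : 𝕜)]
    module
  rw [Finset.sum_congr rfl fun m _ => ht m, Finset.sum_sub_distrib, smul_sub, hm]
  simp only [Nat.choose_zero_right, Nat.factorial_zero, Nat.cast_one, one_mul]
  constructor
  · intro h
    rw [← sub_eq_zero] at h ⊢
    rw [← h]
    abel
  · intro h
    rw [← sub_eq_zero] at h ⊢
    rw [← h]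
    abel

/-- Interchanging the positions matched by `K`, `L` and `τ` exchanges entries of the two tuples, up
to a permutation of each tuple with the sign of `τ`. -/
lemma rd_comp_matchPerm_left {p q : ℕ → ℕ} (hp : p.Injective) (hq : q.Injective)
    (hpq : ∀ k b, p k ≠ q b) {m : ℕ} (K : Sub d m) (L : Sub e m) (τ : Equiv.Perm (Fin m))
    (y : ℕ → Fin n) : rd q d (y ∘ matchPerm p d q (matchingOf K (L.tup ∘ τ)))
      = exchange (rd q d y) (rd p e y) K L ∘ τ.viaFintypeEmbedding K.emb := by
  have hφ := isMatching_matchingOf K (L.tup_injective.comp τ.injective)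
  funext b
  rw [rd, Function.comp_apply, matchPerm_q hp hq hpq hφ, Function.comp_apply]
  by_cases hb : b ∈ K.1
  · obtain ⟨i, rfl⟩ := K.exists_tup_eq hb
    rw [matchingOf_tup, show K.tup i = K.emb i from rfl,
      Equiv.Perm.viaFintypeEmbedding_apply_image, show K.emb (τ i) = K.tup (τ i) from rfl,
      exchange_tup]
    rfl
  · have hb' : b ∉ Set.range K.emb := by
      rintro ⟨i, rfl⟩
      exact hb (K.tup_mem i)
    rw [matchingOf_of_notMem _ _ hb, Equiv.Perm.viaFintypeEmbedding_apply_notMem_range _ _ hb',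
      exchange_of_notMem _ _ _ _ hb]
    rfl

lemma rd_comp_matchPerm_right {p q : ℕ → ℕ} (hp : p.Injective) (hq : q.Injective)
    (hpq : ∀ k b, p k ≠ q b) {m : ℕ} (K : Sub d m) (L : Sub e m) (τ : Equiv.Perm (Fin m))
    (y : ℕ → Fin n) : rd p e (y ∘ matchPerm p d q (matchingOf K (L.tup ∘ τ)))
      = exchange (rd p e y) (rd q d y) L K ∘ τ⁻¹.viaFintypeEmbedding L.emb := by
  have hφ := isMatching_matchingOf K (L.tup_injective.comp τ.injective)
  funext a
  rw [rd, Function.comp_apply, Function.comp_apply]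
  by_cases ha : a ∈ L.1
  · obtain ⟨i, rfl⟩ := L.exists_tup_eq ha
    have h : matchingOf K (L.tup ∘ τ) (K.tup (τ⁻¹ i)) = some (L.tup i) := by
      simp [matchingOf_tup]
    rw [matchPerm_p hp hq hpq hφ h, show L.tup i = L.emb i from rfl,
      Equiv.Perm.viaFintypeEmbedding_apply_image, show L.emb (τ⁻¹ i) = L.tup (τ⁻¹ i) from rfl,
      exchange_tup]
    rfl
  · have ha' : a ∉ Set.range L.emb := by
      rintro ⟨i, rfl⟩
      exact ha (L.tup_mem i)
    have h : ∀ b, matchingOf K (L.tup ∘ τ) b ≠ some a := by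
      intro b hb
      by_cases hbK : b ∈ K.1
      · obtain ⟨i, rfl⟩ := K.exists_tup_eq hbK
        rw [matchingOf_tup, Option.some.injEq] at hb
        exact ha (hb ▸ L.tup_mem _)
      · rw [matchingOf_of_notMem _ _ hbK] at hb
        exact absurd hb (by simp)
    rw [matchPerm_p_of_ne hp hpq h, Equiv.Perm.viaFintypeEmbedding_apply_notMem_range _ _ ha',
      exchange_of_notMem _ _ _ _ ha]
    rfl

/-- The fused R-matrix produces the sums over exchanges of `m` entries in the commuting relation;
each exchange arises from `m!` partial matchings. -/
theorem fusedR_prodCov {p q : ℕ → ℕ} (hp : p.Injective) (hq : q.Injective)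
    (hpq : ∀ k b, p k ≠ q b) {δ : 𝕜} {w : ℕ → 𝕜} (hw : ∀ b, w (b + 1) = w b + δ)
    {f : (Fin d → Fin n) → B} (hf : IsAlternating f) {g : (Fin e → Fin n) → B}
    (hg : IsAlternating g) (y : ℕ → Fin n) :
    fusedR p e δ d q w (prodCov q d p e f g) y = ∑ m ∈ Finset.range (d + 1),
      ((m.factorial : 𝕜) * matchWeight δ w d m) • exchangeSum f g (rd q d y) (rd p e y) m := by
  rw [fusedR_apply_eq_sum hp d hq hpq hw
    (antisymmOn_prodCov_left hq (fun k _ b _ => (hpq b k).symm) hf g), Finset.sum_apply,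
    ← Finset.sum_fiberwise_of_maps_to (t := Finset.range (d + 1)) (g := matchCard)
      fun φ _ => Finset.mem_range_succ_iff.2 (matchCard_le φ)]
  refine Finset.sum_congr rfl fun m _ => ?_
  rw [Finset.filter_filter, sum_matchings_eq, exchangeSum, Finset.smul_sum]
  refine Finset.sum_congr rfl fun K _ => ?_
  rw [Finset.smul_sum]
  refine Finset.sum_congr rfl fun L _ => ?_
  have hτ : ∀ τ : Equiv.Perm (Fin m), (matchWeight δ w d (matchCard (matchingOf K (L.tup ∘ τ))) •
      permOp 𝕜 (matchPerm p d q (matchingOf K (L.tup ∘ τ))) (prodCov q d p e f g)) y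
      = matchWeight δ w d m • (f (exchange (rd q d y) (rd p e y) K L)
        * g (exchange (rd p e y) (rd q d y) L K)) := by
    intro τ
    rw [Pi.smul_apply, permOp_apply, matchCard_matchingOf, prodCov,
      rd_comp_matchPerm_left hp hq hpq, rd_comp_matchPerm_right hp hq hpq, hf, hg,
      Equiv.Perm.viaFintypeEmbedding_sign, Equiv.Perm.viaFintypeEmbedding_sign,
      Equiv.Perm.sign_inv, smul_mul_smul_comm, ← Units.val_mul, Int.units_mul_self, Units.val_one,
      one_smul]
  rw [Finset.sum_congr rfl fun τ _ => hτ τ, Finset.sum_const, Finset.card_univ, Fintype.card_perm,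
    Fintype.card_fin, mul_smul, Nat.cast_smul_eq_nsmul]

/-- The commuting relations are preserved by the coaction, the parameters of the two strings of
matrices being related by the R-matrix. -/
theorem CommutingRel.coact [NeZero n] [IsAddTorsionFree B] {δ : 𝕜} {w : ℕ → 𝕜}
    (hw : ∀ b, w (b + 1) = w b + δ) {f : (Fin d → Fin n) → B} (hf : IsAlternating f)
    {g : (Fin e → Fin n) → B} (hg : IsAlternating g) {P Q : ℕ → Fin n → Fin n → B}
    (hP : IsDescending 𝕜 P) (hQ : IsDescending 𝕜 Q)
    (hR : ∀ j < e, ∀ b < d, RTTRel (w b + ((e : 𝕜) - (j + 1)) * δ) δ (P j) (Q b))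
    (hzd : ∀ j < e, ∀ b < d, ∀ x : B, (w b + ((e : 𝕜) - j) * δ) • x = 0 → x = 0)
    (hPf : ∀ k i j I, Commute (P k i j) (f I)) (hQg : ∀ k i j J, Commute (Q k i j) (g J))
    (h : ∀ I J, CommutingRel δ w f g I J) (I : Fin d → Fin n) (J : Fin e → Fin n) :
    CommutingRel δ w (coact Q f) (coact P g) I J := by
  obtain ⟨y, rfl, rfl⟩ := exists_rd oddPos_injective evenPos_injective
    (fun k b => (evenPos_ne_oddPos b k).symm) I J
  have hcov := fun (F : (Fin d → Fin n) → B) (hF : IsAlternating F) (G : (Fin e → Fin n) → B)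
      (hG : IsAlternating G) y =>
    (fusedR_prodCov evenPos_injective oddPos_injective evenPos_ne_oddPos hw hF hG y).symm
  set c : 𝕜 := ∑ m ∈ Finset.range (d + 1),
    (d.choose m : 𝕜) * ((m.factorial : 𝕜) * matchWeight δ w d m) with hc
  have h1 : fusedR evenPos e δ d oddPos w (prodCov oddPos d evenPos e f g)
      = c • prodCov evenPos e oddPos d g f := by
    funext y
    rw [← hcov f hf g hg]
    exact ((commutingRel_iff δ w f g _ _).1 (h _ _)).symm
  rw [commutingRel_iff, hcov _ (hf.coact 𝕜 hQ) _ (hg.coact 𝕜 hP)]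
  have h2 := descProd_descProd_fusedR evenPos_injective hP d oddPos_injective evenPos_ne_oddPos hR
    hzd (antisymmOn_prodCov_right evenPos_injective
      (fun k _ b _ => (evenPos_ne_oddPos b k).symm) f hg)
  rw [h1, map_smul, map_smul, descProd_descProd_prodCov evenPos_injective oddPos_injective
    (fun k _ b _ => evenPos_ne_oddPos k b) P Q g f hPf, descProd_descProd_prodCov oddPos_injective
    evenPos_injective (fun k _ b _ => (evenPos_ne_oddPos b k).symm) Q P f g hQg] at h2
  exact congrFun h2 y

end CommutingCov

/-! ### Shifts of series -/

section Shift

variable {A : Type*} [Ring A]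

lemma coeff_shift (a : ℤ) (f : PowerSeries A) (r : ℕ) : PowerSeries.coeff r (shift a f)
    = ∑ x ∈ Finset.HasAntidiagonal.antidiagonal r,
      (Ring.choose (-(x.1 : ℤ)) x.2 * a ^ x.2 : ℤ) • PowerSeries.coeff x.1 f :=
  PowerSeries.coeff_mk _ _

lemma shift_add (a : ℤ) (f g : PowerSeries A) : shift a (f + g) = shift a f + shift a g := by
  ext r
  simp only [coeff_shift, map_add, smul_add, Finset.sum_add_distrib]

lemma shift_C_mul (a : ℤ) (c : A) (f : PowerSeries A) :
    shift a (PowerSeries.C c * f) = PowerSeries.C c * shift a f := by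
  ext r
  simp only [coeff_shift, PowerSeries.coeff_C_mul, Finset.mul_sum, mul_smul_comm]

lemma shift_one (a : ℤ) : shift a (1 : PowerSeries A) = 1 := by
  ext r
  rw [coeff_shift, Finset.sum_eq_single_of_mem (0, r) (by simp)]
  · rcases r with _ | r
    · simp
    · simp only [Nat.cast_zero, neg_zero, Ring.choose_zero_succ, zero_mul, zero_smul,
        PowerSeries.coeff_one, Nat.succ_ne_zero, if_false]
  · rintro ⟨i, j⟩ hij hne
    have hi : i ≠ 0 := by
      rintro rfl
      simp only [Finset.HasAntidiagonal.mem_antidiagonal, zero_add] at hij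
      exact hne (by rw [hij])
    simp [PowerSeries.coeff_one, hi]

lemma shift_C (a : ℤ) (c : A) : shift a (PowerSeries.C c) = PowerSeries.C c := by
  have := shift_C_mul a c 1
  rwa [shift_one, mul_one] at this

lemma shift_map {A' : Type*} [Ring A'] (φ : A →+* A') (a : ℤ) (f : PowerSeries A) :
    PowerSeries.map φ (shift a f) = shift a (PowerSeries.map φ f) := by
  ext r
  simp only [coeff_shift, PowerSeries.coeff_map, map_sum, map_zsmul]

lemma coeff_succ_linear_mul (a : ℤ) (f : PowerSeries A) (r : ℕ) :
    PowerSeries.coeff (r + 1) ((1 + a • PowerSeries.X) * f)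
      = PowerSeries.coeff (r + 1) f + a • PowerSeries.coeff r f := by
  rw [add_mul, one_mul, map_add, smul_mul_assoc, map_zsmul, PowerSeries.coeff_succ_X_mul]

lemma coeff_zero_linear_mul (a : ℤ) (f : PowerSeries A) :
    PowerSeries.coeff 0 ((1 + a • PowerSeries.X) * f) = PowerSeries.coeff 0 f := by
  rw [add_mul, one_mul, map_add, smul_mul_assoc, map_zsmul, PowerSeries.coeff_zero_X_mul,
    smul_zero, add_zero]

/-- The identity `(1 + a u⁻¹) (u + a)⁻¹ = u⁻¹`, which is Pascal's rule for the coefficients of the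
shift. Together with additivity and the value on constants it determines the shift. -/
lemma linear_mul_shift_X_mul (a : ℤ) (f : PowerSeries A) :
    (1 + a • PowerSeries.X) * shift a (PowerSeries.X * f) = PowerSeries.X * shift a f := by
  have h : ∀ r, PowerSeries.coeff (r + 1) (shift a (PowerSeries.X * f))
      = ∑ x ∈ Finset.HasAntidiagonal.antidiagonal r,
        (Ring.choose (-((x.1 + 1 : ℕ) : ℤ)) x.2 * a ^ x.2 : ℤ) • PowerSeries.coeff x.1 f := by
    intro r
    rw [coeff_shift, Finset.Nat.sum_antidiagonal_succ]
    simp only [PowerSeries.coeff_zero_X_mul, smul_zero, zero_add, PowerSeries.coeff_succ_X_mul]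
  ext r
  rcases r with _ | r
  · rw [coeff_zero_linear_mul, PowerSeries.coeff_zero_X_mul, coeff_shift]
    simp
  rw [coeff_succ_linear_mul, PowerSeries.coeff_succ_X_mul, h]
  rcases r with _ | r
  · rw [coeff_shift, coeff_shift]
    simp
  rw [h, coeff_shift, Finset.Nat.sum_antidiagonal_succ', Finset.Nat.sum_antidiagonal_succ',
    Finset.smul_sum]
  simp only [Ring.choose_zero_right, pow_zero]
  rw [add_assoc, ← Finset.sum_add_distrib]
  congr 1
  refine Finset.sum_congr rfl fun x _ => ?_
  rw [smul_smul, ← add_smul]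
  congr 1
  have := Ring.choose_succ_succ (-((x.1 + 1 : ℕ) : ℤ)) x.2
  rw [show -((x.1 + 1 : ℕ) : ℤ) + 1 = -(x.1 : ℤ) by push_cast; ring] at this
  rw [this, pow_succ]
  ring

/-- The recursion `(1 + a u⁻¹) D(f) = u⁻¹ D(f')` forces `D = 0`: it determines each coefficient of
`D(f)` from earlier ones. -/
lemma eq_zero_of_linear_mul (a : ℤ) {D : PowerSeries A → PowerSeries A}
    (h : ∀ f, ∃ f', (1 + a • PowerSeries.X) * D f = PowerSeries.X * D f') (f : PowerSeries A) :
    D f = 0 := by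
  have key : ∀ r f, PowerSeries.coeff r (D f) = 0 := by
    intro r
    induction r with
    | zero =>
      intro f
      obtain ⟨f', hf⟩ := h f
      rw [← coeff_zero_linear_mul a, hf, PowerSeries.coeff_zero_X_mul]
    | succ r ih =>
      intro f
      obtain ⟨f', hf⟩ := h f
      have := coeff_succ_linear_mul a (D f) r
      rw [hf, PowerSeries.coeff_succ_X_mul, ih, ih, smul_zero, add_zero] at this
      exact this.symm
  exact PowerSeries.ext fun r => key r f

lemma exists_eq_C_add_X_mul (f : PowerSeries A) :
    ∃ c f', f = PowerSeries.C c + PowerSeries.X * f' :=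
  ⟨PowerSeries.coeff 0 f, PowerSeries.mk fun r => PowerSeries.coeff (r + 1) f, by
    ext r
    rcases r with _ | r
    · simp
    · simp [PowerSeries.coeff_succ_X_mul]⟩

lemma shift_mul (a : ℤ) (f g : PowerSeries A) : shift a (f * g) = shift a f * shift a g := by
  refine sub_eq_zero.1 (eq_zero_of_linear_mul a
    (D := fun f => shift a (f * g) - shift a f * shift a g) (fun f => ?_) f)
  obtain ⟨c, f', rfl⟩ := exists_eq_C_add_X_mul f
  refine ⟨f', ?_⟩
  rw [add_mul (PowerSeries.C c), shift_add, shift_add, shift_C_mul, shift_C,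
    add_mul (PowerSeries.C c), add_sub_add_left_eq_sub, mul_sub, mul_sub,
    mul_assoc PowerSeries.X f' g, linear_mul_shift_X_mul, ← mul_assoc,
    linear_mul_shift_X_mul, mul_assoc]

/-- `f(u) ↦ f(u + a)` as a ring homomorphism. -/
def shiftHom (a : ℤ) : PowerSeries A →+* PowerSeries A where
  toFun := shift a
  map_one' := shift_one a
  map_mul' := shift_mul a
  map_zero' := by
    have := shift_C a (0 : A)
    rwa [map_zero] at this
  map_add' := shift_add a

lemma shiftHom_apply (a : ℤ) (f : PowerSeries A) : shiftHom a f = shift a f := rfl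

lemma linear_mul_shift_X (a : ℤ) :
    (1 + a • PowerSeries.X) * shift a (PowerSeries.X : PowerSeries A) = PowerSeries.X := by
  have := linear_mul_shift_X_mul a (1 : PowerSeries A)
  rwa [mul_one, shift_one, mul_one] at this

lemma shift_shift (a b : ℤ) (f : PowerSeries A) : shift a (shift b f) = shift (a + b) f := by
  refine sub_eq_zero.1 (eq_zero_of_linear_mul (a + b)
    (D := fun f => shift a (shift b f) - shift (a + b) f) (fun f => ?_) f)
  obtain ⟨c, f', rfl⟩ := exists_eq_C_add_X_mul f
  refine ⟨f', ?_⟩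
  have h1 : (1 + (a + b) • PowerSeries.X : PowerSeries A)
      = (1 + a • PowerSeries.X) * shift a (1 + b • PowerSeries.X) := by
    rw [shift_add, shift_one, ← shiftHom_apply, map_zsmul, shiftHom_apply, mul_add,
      mul_smul_comm, linear_mul_shift_X, add_smul, mul_one, add_assoc]
  have h2 : (1 + (a + b) • PowerSeries.X) * shift a (shift b (PowerSeries.X * f'))
      = PowerSeries.X * shift a (shift b f') := by
    rw [h1, mul_assoc, ← shift_mul, linear_mul_shift_X_mul, shift_mul, ← mul_assoc,
      linear_mul_shift_X]
  rw [shift_add, shift_add, shift_add, shift_C, shift_C, shift_C, add_sub_add_left_eq_sub,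
    mul_sub, mul_sub, h2, linear_mul_shift_X_mul]

end Shift

/-! ### The relations of the Yangian for shifted series -/

section ShiftedRTT

variable {A : Type*} [Ring A]

/-- The substitution `u ↦ u + a`, `v ↦ v + b`. -/
def shift₂ (a b : ℤ) : Series₂ A →+* Series₂ A := (shiftHom b).comp (PowerSeries.map (shiftHom a))

lemma shift₂_inU (a b : ℤ) (f : PowerSeries A) : shift₂ a b (inU f) = inU (shift a f) := by
  rw [shift₂, RingHom.comp_apply, inU, PowerSeries.map_C, shiftHom_apply, shift_C]
  rfl

lemma shift₂_inV (a b : ℤ) (f : PowerSeries A) : shift₂ a b (inV f) = inV (shift b f) := by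
  have : PowerSeries.map (shiftHom a) (inV f) = inV f := by
    ext1 r
    rw [PowerSeries.coeff_map, inV, PowerSeries.coeff_map, shiftHom_apply, shift_C]
  rw [shift₂, RingHom.comp_apply, this, shiftHom_apply, inV, ← shift_map]
  rfl

lemma linear_mul_shift₂_xx (a b : ℤ) : (1 + a • xx A) * shift₂ a b (xx A) = xx A := by
  have h := congrArg (inU (A := A)) (linear_mul_shift_X (A := A) a)
  have h2 := shift₂_inU a b (PowerSeries.X : PowerSeries A)
  simp only [inU, map_mul, map_add, map_one, map_zsmul] at h h2
  rw [h2, h]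

lemma linear_mul_shift₂_yy (a b : ℤ) : (1 + b • yy A) * shift₂ a b (yy A) = yy A := by
  rw [shift₂, RingHom.comp_apply, PowerSeries.map_X, shiftHom_apply, linear_mul_shift_X]

/-- `u⁻¹ v⁻¹ (u - v + c)`, with coefficients in a ring. -/
def linear₂ (A : Type*) [Ring A] (c : ℤ) : Series₂ A := yy A - xx A + c • (xx A * yy A)

lemma scalar₂_linearFactor [Algebra ℂ A] (c : ℤ) : scalar₂ A (linearFactor c) = linear₂ A c := by
  simp [scalar₂, linearFactor, linear₂, xx, yy]

lemma uv_eq [Algebra ℂ A] : uv A = xx A * yy A := by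
  simp [scalar₂, uv, xx, yy]

/-- The relations between `T(u + a)` and `T(v + b)`. -/
lemma IsRTT.shift₂ {n : ℕ} {P : Fin n → Fin n → PowerSeries A} (h : IsRTT P) (a b : ℤ)
    (i j k l : Fin n) : linear₂ A (a - b)
      * (inU (shift a (P i j)) * inV (shift b (P k l))
        - inV (shift b (P k l)) * inU (shift a (P i j)))
    = (xx A * yy A) * (inU (shift a (P k j)) * inV (shift b (P i l))
      - inV (shift b (P k j)) * inU (shift a (P i l))) := by
  have h1 := congrArg (YangianFlag.shift₂ a b) (h i j k l)
  simp only [map_mul, map_sub, shift₂_inU, shift₂_inV] at h1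
  have ex := linear_mul_shift₂_xx (A := A) a b
  have ey := linear_mul_shift₂_yy (A := A) a b
  set x' := YangianFlag.shift₂ a b (xx A)
  set y' := YangianFlag.shift₂ a b (yy A)
  have cx : ∀ F : Series₂ A, Commute (1 + a • xx A) F := fun F =>
    (Commute.one_left F).add_left ((commute_xx F).smul_left a)
  have cy : ∀ F : Series₂ A, Commute (1 + b • yy A) F := fun F =>
    (Commute.one_left F).add_left ((commute_yy F).smul_left b)
  have e1 : (1 + a • xx A) * (1 + b • yy A) * (y' - x') = linear₂ A (a - b) := by
    have t1 : (1 + a • xx A) * (1 + b • yy A) * y' = (1 + a • xx A) * yy A := by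
      rw [mul_assoc, ey]
    have t2 : (1 + a • xx A) * (1 + b • yy A) * x' = (1 + b • yy A) * xx A := by
      rw [(cx _).eq, mul_assoc, ex]
    rw [mul_sub, t1, t2, linear₂, add_mul, add_mul, smul_mul_assoc, smul_mul_assoc,
      (commute_yy (xx A)).eq, one_mul, one_mul]
    module
  have e2 : (1 + a • xx A) * (1 + b • yy A) * (x' * y') = xx A * yy A := by
    rw [mul_assoc, ← mul_assoc (1 + b • yy A), (cy x').eq, mul_assoc x', ey, ← mul_assoc, ex]
  have h2 := congrArg (fun F => (1 + a • xx A) * (1 + b • yy A) * F) h1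
  rwa [← mul_assoc, e1, ← mul_assoc _ (x' * y'), e2] at h2

/-- The restriction of a series in `u⁻¹, v⁻¹` to `u = v`. -/
def diag : Series₂ A →+ PowerSeries A where
  toFun F := PowerSeries.mk fun r =>
    ∑ x ∈ Finset.HasAntidiagonal.antidiagonal r, coeff₂ x.1 x.2 F
  map_zero' := by ext r; simp [coeff₂]
  map_add' F G := by ext r; simp [coeff₂, Finset.sum_add_distrib]

lemma coeff_diag (F : Series₂ A) (r : ℕ) : PowerSeries.coeff r (diag F)
    = ∑ x ∈ Finset.HasAntidiagonal.antidiagonal r, coeff₂ x.1 x.2 F := by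
  simp [diag]

lemma diag_inU_mul_inV (f g : PowerSeries A) : diag (inU f * inV g) = f * g := by
  ext r
  simp only [coeff_diag, coeff₂_inU_mul_inV, PowerSeries.coeff_mul]

lemma diag_inV_mul_inU (f g : PowerSeries A) : diag (inV g * inU f) = g * f := by
  ext r
  simp only [coeff_diag, coeff₂_inV_mul_inU, PowerSeries.coeff_mul]
  rw [← Finset.Nat.sum_antidiagonal_swap]
  rfl

lemma diag_xx_mul (F : Series₂ A) : diag (xx A * F) = PowerSeries.X * diag F := by
  ext r
  rcases r with _ | r
  · rw [coeff_diag, PowerSeries.coeff_zero_X_mul, Finset.Nat.antidiagonal_zero,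
      Finset.sum_singleton, coeff₂_xx_zero]
  · rw [coeff_diag, PowerSeries.coeff_succ_X_mul, Finset.Nat.sum_antidiagonal_succ, coeff_diag]
    simp only [coeff₂_xx_zero, coeff₂_xx_succ, zero_add]

lemma diag_yy_mul (F : Series₂ A) : diag (yy A * F) = PowerSeries.X * diag F := by
  ext r
  rcases r with _ | r
  · rw [coeff_diag, PowerSeries.coeff_zero_X_mul, Finset.Nat.antidiagonal_zero,
      Finset.sum_singleton, coeff₂_yy_zero]
  · rw [coeff_diag, PowerSeries.coeff_succ_X_mul, Finset.Nat.sum_antidiagonal_succ', coeff_diag]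
    simp only [coeff₂_yy_zero, coeff₂_yy_succ, zero_add]

/-- The relations between `T(u + a)` and `T(u + b)`, from those between `T(u + a)` and `T(v + b)` at
`u = v`. -/
lemma IsRTT.shift {n : ℕ} {P : Fin n → Fin n → PowerSeries A} (h : IsRTT P) (a b : ℤ)
    (i j k l : Fin n) :
    (a - b) • (shift a (P i j) * shift b (P k l) - shift b (P k l) * shift a (P i j))
    = shift a (P k j) * shift b (P i l) - shift b (P k j) * shift a (P i l) := by
  have h1 := congrArg diag (h.shift₂ a b i j k l)
  rw [linear₂, add_mul, sub_mul, map_add, map_sub, diag_xx_mul, diag_yy_mul, sub_self, zero_add,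
    smul_mul_assoc, map_zsmul, mul_assoc, mul_assoc, diag_xx_mul, diag_xx_mul, diag_yy_mul,
    diag_yy_mul, map_sub, map_sub, diag_inU_mul_inV, diag_inU_mul_inV, diag_inV_mul_inU,
    diag_inV_mul_inU, ← mul_smul_comm, ← mul_smul_comm] at h1
  ext r
  have := congrArg (PowerSeries.coeff (r + 1 + 1)) h1
  simpa only [PowerSeries.coeff_succ_X_mul] using this

/-- The matrices `T(u + c), T(u + c - 1), …` form a descending string. -/
lemma isDescending_shift {n : ℕ} (𝕜 : Type*) [CommRing 𝕜] [Algebra 𝕜 (PowerSeries A)]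
    {P : Fin n → Fin n → PowerSeries A} (h : IsRTT P) (c : ℤ) :
    IsDescending 𝕜 fun (k : ℕ) i j => YangianFlag.shift (c - k) (P i j) := by
  intro s t hst i j k l
  rw [Nat.cast_smul_eq_nsmul, one_smul, ← h.shift (c - s) (c - t), ← natCast_zsmul,
    Nat.cast_sub hst.le]
  congr 1
  ring

lemma IsDescending.map {𝕜 𝕜' B B' : Type*} [CommRing 𝕜] [CommRing 𝕜'] [Ring B] [Ring B']
    [Algebra 𝕜 B] [Algebra 𝕜' B'] {n : ℕ} {P : ℕ → Fin n → Fin n → B} (h : IsDescending 𝕜 P)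
    (φ : B →+* B') : IsDescending 𝕜' fun k i j => φ (P k i j) := by
  intro s t hst i j k l
  have := congrArg φ (h s t hst i j k l)
  rw [Nat.cast_smul_eq_nsmul, one_smul] at this ⊢
  simpa only [map_nsmul, map_sub, map_mul] using this

/-- Multiplication by `u⁻¹ v⁻¹ (u - v + c)` is injective: its part free of `v⁻¹` is `-u⁻¹`. -/
lemma eq_zero_of_linear₂_mul (c : ℤ) {F : Series₂ A} (h : linear₂ A c * F = 0) : F = 0 := by
  have hs : ∀ s r, coeff₂ r s F = 0 := by
    intro s
    induction s with
    | zero =>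
      intro r
      have := congrArg (coeff₂ (r + 1) 0) h
      rw [linear₂, add_mul, sub_mul, smul_mul_assoc, (commute_xx (yy A)).eq, mul_assoc] at this
      simpa only [coeff₂, map_add, map_sub, map_zsmul, PowerSeries.coeff_zero_X_mul, map_zero,
        zero_sub, smul_zero, add_zero, map_neg, PowerSeries.coeff_C_mul,
        PowerSeries.coeff_succ_X_mul, neg_eq_zero] using this
    | succ s ih =>
      intro r
      have := congrArg (coeff₂ (r + 1) (s + 1)) h
      rw [linear₂, add_mul, sub_mul, smul_mul_assoc, (commute_xx (yy A)).eq, mul_assoc] at this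
      have ih1 := ih (r + 1)
      have ih2 := ih r
      simp only [coeff₂] at ih1 ih2
      simpa only [coeff₂, map_add, map_sub, map_zsmul, PowerSeries.coeff_succ_X_mul, map_zero,
        zero_sub, smul_zero, add_zero, map_neg, PowerSeries.coeff_C_mul, ih1, ih2,
        neg_eq_zero] using this
  exact coeff₂_ext fun r s => by rw [hs]; simp [coeff₂]

end ShiftedRTT

/-! ### Families satisfying the relations of the flag algebra -/

section FlagFamily

variable {A A' : Type*} [Ring A] [Algebra ℂ A] [Ring A'] [Algebra ℂ A'] {n : ℕ}

instance : IsAddTorsionFree (PowerSeries A) :=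
  haveI : Module ℚ A := Module.compHom A (algebraMap ℚ ℂ)
  haveI := IsAddTorsionFree.of_module_rat A
  inferInstanceAs (IsAddTorsionFree ((Unit →₀ ℕ) → A))

instance : IsAddTorsionFree (Series₂ A) :=
  inferInstanceAs (IsAddTorsionFree ((Unit →₀ ℕ) → PowerSeries A))

/-- The application of an algebra map to the coefficients of series in two variables. -/
def map₂ (φ : A →ₐ[ℂ] A') : Series₂ A →+* Series₂ A' :=
  PowerSeries.map (PowerSeries.map φ.toRingHom)

lemma coeff₂_map₂ (φ : A →ₐ[ℂ] A') (r s : ℕ) (F : Series₂ A) :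
    coeff₂ r s (map₂ φ F) = φ (coeff₂ r s F) := by
  simp [coeff₂, map₂]

lemma map₂_inU (φ : A →ₐ[ℂ] A') (f : PowerSeries A) :
    map₂ φ (inU f) = inU (PowerSeries.map φ.toRingHom f) := by
  simp [map₂, inU]

lemma map₂_inV (φ : A →ₐ[ℂ] A') (f : PowerSeries A) :
    map₂ φ (inV f) = inV (PowerSeries.map φ.toRingHom f) := by
  ext s r
  simp [map₂, inV]

lemma map₂_scalar₂ (φ : A →ₐ[ℂ] A') (F : Series₂ ℂ) : map₂ φ (scalar₂ A F) = scalar₂ A' F := by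
  ext s r
  simp [map₂, scalar₂]

/-- The scalar series act on series with coefficients in an algebra. -/
abbrev scalarAlgebra (A : Type*) [Ring A] [Algebra ℂ A] : Algebra (Series₂ ℂ) (Series₂ A) :=
  (scalar₂ A).toAlgebra' fun c F => by
    refine coeff₂_ext fun r s => ?_
    simp only [coeff₂, PowerSeries.coeff_mul, map_sum, scalar₂, PowerSeries.coeff_map]
    rw [← Finset.Nat.sum_antidiagonal_swap]
    refine Finset.sum_congr rfl fun x _ => ?_
    rw [← Finset.Nat.sum_antidiagonal_swap]
    exact Finset.sum_congr rfl fun y _ => Algebra.commutes _ _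

/-- The relations of the flag algebra for a family of series. -/
structure IsFlagFamily (γ : Composition n)
    (F : ∀ d, d ∈ flagSizes γ → (Fin d → Fin n) → PowerSeries A) : Prop where
  alternating : ∀ d hd, IsAlternating (F d hd)
  commuting : ∀ d e hd he, d ≤ e → ∀ I J,
    commutingLHS (F d hd) (F e he) I J = commutingRHS (F d hd) (F e he) I J
  young : ∀ a p e hd he, 1 ≤ p → a + p ≤ e → ∀ I J, youngSum (F (a + p) hd) (F e he) I J = 0
  straightening : ∀ a d hd he I J,
    straightenLHS (F d hd) (F (a + d) he) I J = straightenRHS (F d hd) (F (a + d) he) I J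

section Naturality

variable (φ : A →ₐ[ℂ] A') {a p d e : ℕ}

lemma map₂_commutingLHS (f : (Fin d → Fin n) → PowerSeries A) (g : (Fin e → Fin n) → PowerSeries A)
    (I : Fin d → Fin n) (J : Fin e → Fin n) : map₂ φ (commutingLHS f g I J)
      = commutingLHS (fun I => PowerSeries.map φ.toRingHom (f I))
        (fun J => PowerSeries.map φ.toRingHom (g J)) I J := by
  simp only [commutingLHS, denom, map_mul, map_sub, map₂_inU, map₂_inV, map₂_scalar₂]

lemma map₂_commutingRHS (f : (Fin d → Fin n) → PowerSeries A) (g : (Fin e → Fin n) → PowerSeries A)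
    (I : Fin d → Fin n) (J : Fin e → Fin n) : map₂ φ (commutingRHS f g I J)
      = commutingRHS (fun I => PowerSeries.map φ.toRingHom (f I))
        (fun J => PowerSeries.map φ.toRingHom (g J)) I J := by
  simp only [commutingRHS, denom, uv, map_mul, map_sub, map_sum, map_zsmul, map_pow, map₂_inU,
    map₂_inV, map₂_scalar₂]

lemma map_youngSum (f : (Fin (a + p) → Fin n) → PowerSeries A)
    (g : (Fin e → Fin n) → PowerSeries A) (I : Fin a → Fin n) (J : Sub n (p + e)) :
    PowerSeries.map φ.toRingHom (youngSum f g I J)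
      = youngSum (fun I => PowerSeries.map φ.toRingHom (f I))
        (fun J => PowerSeries.map φ.toRingHom (g J)) I J := by
  simp only [youngSum, map_sum, map_zsmul, map_mul, shift_map]

lemma map_straightenLHS (f : (Fin d → Fin n) → PowerSeries A)
    (g : (Fin e → Fin n) → PowerSeries A) (I : Sub n d) (J : Sub n e) :
    PowerSeries.map φ.toRingHom (straightenLHS f g I J)
      = straightenLHS (fun I => PowerSeries.map φ.toRingHom (f I))
        (fun J => PowerSeries.map φ.toRingHom (g J)) I J := by
  simp only [straightenLHS, map_mul, shift_map]

lemma map_straightenRHS (f : (Fin d → Fin n) → PowerSeries A)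
    (g : (Fin (a + d) → Fin n) → PowerSeries A) (I : Sub n d) (J : Sub n (a + d)) :
    PowerSeries.map φ.toRingHom (straightenRHS f g I J)
      = straightenRHS (fun I => PowerSeries.map φ.toRingHom (f I))
        (fun J => PowerSeries.map φ.toRingHom (g J)) I J := by
  simp only [straightenRHS, map_sum, map_zsmul, map_mul, shift_map]

lemma IsFlagFamily.map {γ : Composition n}
    {F : ∀ d, d ∈ flagSizes γ → (Fin d → Fin n) → PowerSeries A} (hF : IsFlagFamily γ F) :
    IsFlagFamily γ fun d hd I => PowerSeries.map φ.toRingHom (F d hd I) where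
  alternating d hd σ t := by
    rw [← map_zsmul, ← hF.alternating]
  commuting d e hd he hde I J := by
    rw [← map₂_commutingLHS, ← map₂_commutingRHS, hF.commuting d e hd he hde]
  young a p e hd he hp hde I J := by
    rw [← map_youngSum, hF.young a p e hd he hp hde, map_zero]
  straightening a d hd he I J := by
    rw [← map_straightenLHS, ← map_straightenRHS, hF.straightening]

end Naturality

lemma FlagAlgebra.isFlagFamily (γ : Composition n) (r₀ : ℕ) :
    IsFlagFamily γ fun _ hd I => FlagAlgebra.f γ r₀ hd I := by
  have hrel : ∀ {x y}, FRel γ r₀ x y → FlagAlgebra.mk γ r₀ x = FlagAlgebra.mk γ r₀ y :=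
    fun h => RingQuot.mkAlgHom_rel ℂ h
  refine ⟨fun d hd σ t => ?_, fun d e hd he hde I J => ?_, fun a p e hd he hp hde I J => ?_,
    fun a d hd he I J => ?_⟩
  · rw [FlagAlgebra.f, FlagAlgebra.f, ← map_zsmul]
    ext r
    exact hrel (FRel.alternating hd t σ r)
  · refine coeff₂_ext fun r s => ?_
    have := hrel (FRel.commuting hd he hde I J r s)
    rwa [← coeff₂_map₂, ← coeff₂_map₂, map₂_commutingLHS, map₂_commutingRHS] at this
  · have h := map_youngSum (FlagAlgebra.mk γ r₀) (freeF γ r₀ hd) (freeF γ r₀ he) I J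
    refine h.symm.trans ?_
    ext r
    exact (hrel (FRel.young hp hd he hde I J r)).symm.trans (map_zero _)
  · have h1 := map_straightenLHS (FlagAlgebra.mk γ r₀) (freeF γ r₀ hd) (freeF γ r₀ he) I J
    have h2 := map_straightenRHS (FlagAlgebra.mk γ r₀) (freeF γ r₀ hd) (freeF γ r₀ he) I J
    refine h1.symm.trans (Eq.trans ?_ h2)
    ext r
    exact hrel (FRel.straightening hd he I J r)

lemma FlagAlgebra.coeff_f_of_lt (γ : Composition n) (r₀ : ℕ) {d : ℕ} (hd : d ∈ flagSizes γ)
    (I : Fin d → Fin n) {r : ℕ} (hr : r < r₀) :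
    PowerSeries.coeff r (FlagAlgebra.f γ r₀ hd I) = 0 := by
  rw [FlagAlgebra.f, PowerSeries.coeff_map, freeF, PowerSeries.coeff_mk, dif_neg (by omega),
    map_zero]

lemma FlagAlgebra.hom_ext {γ : Composition n} {r₀ : ℕ} {φ ψ : FlagAlgebra γ r₀ →ₐ[ℂ] A}
    (h : ∀ d (hd : d ∈ flagSizes γ) I, PowerSeries.map φ.toRingHom (FlagAlgebra.f γ r₀ hd I)
      = PowerSeries.map ψ.toRingHom (FlagAlgebra.f γ r₀ hd I)) : φ = ψ := by
  refine RingQuot.ringQuot_ext' ℂ φ ψ (FreeAlgebra.hom_ext (funext fun x => ?_))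
  obtain ⟨⟨⟨d, hd⟩, I⟩, ⟨r, hr⟩⟩ := x
  have h1 := congrArg (PowerSeries.coeff r) (h d hd I)
  rw [PowerSeries.coeff_map, PowerSeries.coeff_map, FlagAlgebra.f, PowerSeries.coeff_map, freeF,
    PowerSeries.coeff_mk, dif_pos hr] at h1
  exact h1

/-- A family satisfying the relations of the flag algebra gives an algebra map. -/
lemma FlagAlgebra.exists_lift {γ : Composition n} {r₀ : ℕ}
    {F : ∀ d, d ∈ flagSizes γ → (Fin d → Fin n) → PowerSeries A} (hF : IsFlagFamily γ F)
    (h0 : ∀ d hd I, ∀ r < r₀, PowerSeries.coeff r (F d hd I) = 0) :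
    ∃ φ : FlagAlgebra γ r₀ →ₐ[ℂ] A, ∀ d hd I,
      PowerSeries.map φ.toRingHom (FlagAlgebra.f γ r₀ hd I) = F d hd I := by
  let ψ : FreeAlgebra ℂ (FGen γ r₀) →ₐ[ℂ] A :=
    FreeAlgebra.lift ℂ fun x => PowerSeries.coeff x.2.1 (F x.1.1.1 x.1.1.2 x.1.2)
  have hψ : ∀ {d} (hd : d ∈ flagSizes γ),
      (fun I => PowerSeries.map ψ.toRingHom (freeF γ r₀ hd I)) = F d hd := by
    intro d hd
    funext I
    ext r
    rw [PowerSeries.coeff_map, freeF, PowerSeries.coeff_mk]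
    split_ifs with hr
    · exact FreeAlgebra.lift_ι_apply _ _
    · rw [map_zero, h0 d hd I r (by omega)]
  have hrel : ∀ ⦃x y⦄, FRel γ r₀ x y → ψ x = ψ y := by
    intro x y h
    have hc : ∀ (f : PowerSeries (FreeAlgebra ℂ (FGen γ r₀))) r, ψ (PowerSeries.coeff r f)
        = PowerSeries.coeff r (PowerSeries.map ψ.toRingHom f) := fun f r => rfl
    cases h with
    | alternating hd J σ r =>
      rw [hc, hc, map_zsmul]
      have e := hF.alternating _ hd σ J
      rw [← hψ hd] at e
      exact congrArg _ e
    | commuting hd he hde I J r s =>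
      rw [← coeff₂_map₂, ← coeff₂_map₂, map₂_commutingLHS, map₂_commutingRHS, hψ, hψ,
        hF.commuting _ _ hd he hde]
    | young hp hd he hde I J r =>
      rw [hc, map_youngSum, hψ, hψ, hF.young _ _ _ hd he hp hde, map_zero, map_zero]
    | straightening hd he I J r =>
      rw [hc, hc, map_straightenLHS, map_straightenRHS, hψ, hψ, hF.straightening]
  refine ⟨RingQuot.liftAlgHom ℂ ⟨ψ, hrel⟩, fun d hd I => ?_⟩
  rw [← hψ hd, FlagAlgebra.f]
  ext r
  exact RingQuot.liftAlgHom_mkAlgHom_apply ℂ _ _ _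

end FlagFamily

/-! ### The coaction -/

section Coaction

variable {A : Type*} [Ring A] {n : ℕ}

lemma map_coact {B B' : Type*} [Ring B] [Ring B'] (φ : B →+* B') {d : ℕ}
    (P : ℕ → Fin n → Fin n → B) (F : (Fin d → Fin n) → B) (I : Fin d → Fin n) :
    φ (coact P F I) = coact (fun k i j => φ (P k i j)) (fun J => φ (F J)) I := by
  simp only [coact, tupleProd, map_sum, map_mul, map_list_prod, List.map_ofFn]
  rfl

lemma commute_of_coeff {f g : PowerSeries A}
    (h : ∀ r s, Commute (PowerSeries.coeff r f) (PowerSeries.coeff s g)) : Commute f g := by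
  ext r
  rw [PowerSeries.coeff_mul, PowerSeries.coeff_mul, ← Finset.Nat.sum_antidiagonal_swap]
  exact Finset.sum_congr rfl fun x _ => (h _ _).eq

lemma commute_coeff_shift {f g : PowerSeries A}
    (h : ∀ r s, Commute (PowerSeries.coeff r f) (PowerSeries.coeff s g)) (a : ℤ) (r s : ℕ) :
    Commute (PowerSeries.coeff r (shift a f)) (PowerSeries.coeff s g) := by
  rw [coeff_shift]
  exact Commute.sum_left _ _ _ fun x _ => (h _ _).smul_left _

lemma commute_shift {f g : PowerSeries A}
    (h : ∀ r s, Commute (PowerSeries.coeff r f) (PowerSeries.coeff s g)) (a b : ℤ) :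
    Commute (shift a f) (shift b g) :=
  commute_of_coeff fun r s => (commute_coeff_shift
    (fun s r => (commute_coeff_shift h a r s).symm) b s r).symm

lemma IsAlternating.map {B B' : Type*} [Ring B] [Ring B'] (φ : B →+* B') {d : ℕ}
    {F : (Fin d → Fin n) → B} (hF : IsAlternating F) : IsAlternating fun I => φ (F I) :=
  fun σ t => by rw [← map_zsmul, ← hF]

/-- The coaction on families of series: `F_I(u) ↦ ∑_J F_J(u) t_{j_1 i_1}(u) t_{j_2 i_2}(u - 1) ⋯`,
the sum being over all tuples `J`. -/
def coactSeries (T : Fin n → Fin n → PowerSeries A) {d : ℕ} (F : (Fin d → Fin n) → PowerSeries A)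
    (I : Fin d → Fin n) : PowerSeries A := coact (fun k i j => shift (-(k : ℤ)) (T i j)) F I

lemma shift_coactSeries (c : ℤ) (T : Fin n → Fin n → PowerSeries A) {d : ℕ}
    (F : (Fin d → Fin n) → PowerSeries A) (I : Fin d → Fin n) :
    shift c (coactSeries T F I)
      = coact (fun k i j => shift (c - k) (T i j)) (fun J => shift c (F J)) I := by
  rw [coactSeries, ← shiftHom_apply, map_coact]
  simp only [shiftHom_apply, shift_shift, sub_eq_add_neg]

lemma youngSum_eq {a p e : ℕ} (f : (Fin (a + p) → Fin n) → PowerSeries A)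
    (g : (Fin e → Fin n) → PowerSeries A) (I : Fin a → Fin n) (J : Sub n (p + e)) :
    youngSum f g I J = youngExpr (fun I => shift ((a + p : ℕ) : ℤ) (f I))
      (fun J => shift ((e + p : ℕ) : ℤ) (g J)) I J := rfl

lemma straightenRHS_eq {a d : ℕ} (f : (Fin d → Fin n) → PowerSeries A)
    (g : (Fin (a + d) → Fin n) → PowerSeries A) (I : Sub n d) (J : Sub n (a + d)) :
    straightenRHS f g I J = straightenExpr (fun I => shift (d : ℤ) (f I))
      (fun J => shift ((a + d : ℕ) : ℤ) (g J)) I.tup J := rfl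

lemma isDescending_shift_neg (𝕜 : Type*) [CommRing 𝕜] [Algebra 𝕜 (PowerSeries A)]
    {T : Fin n → Fin n → PowerSeries A} (hT : IsRTT T) :
    IsDescending 𝕜 fun (k : ℕ) i j => shift (-(k : ℤ)) (T i j) := by
  simpa only [zero_sub] using isDescending_shift 𝕜 hT 0

lemma IsAlternating.shift {d : ℕ} {F : (Fin d → Fin n) → PowerSeries A} (hF : IsAlternating F)
    (c : ℤ) : IsAlternating fun I => shift c (F I) := hF.map (shiftHom c)

variable [Algebra ℂ A]

lemma denom_eq (e p d : ℕ) : denom A e p d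
    = scalar₂ A (∏ b ∈ Finset.Ico p d, linearFactor ((b : ℤ) + 1 - e)) := by
  have h := Finset.prod_Ico_add' (fun q : ℕ => linearFactor ((q : ℤ) - e)) p d 1
  rw [denom, show Finset.Icc (p + 1) d = Finset.Ico (p + 1) (d + 1) from by ext; simp, ← h]
  push_cast
  rfl

attribute [local instance] scalarAlgebra

lemma scalar_smul (c : Series₂ ℂ) (F : Series₂ A) : c • F = scalar₂ A c * F := rfl

/-- The commuting relations of the flag algebra as relations over the scalar series in `u⁻¹, v⁻¹`,
with `δ = u⁻¹ v⁻¹` because every linear factor is multiplied by `u⁻¹ v⁻¹`. -/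
lemma commuting_iff {d e : ℕ} (f : (Fin d → Fin n) → PowerSeries A)
    (g : (Fin e → Fin n) → PowerSeries A) (I : Fin d → Fin n) (J : Fin e → Fin n) :
    commutingLHS f g I J = commutingRHS f g I J ↔
      CommutingRel (PowerSeries.C PowerSeries.X * PowerSeries.X : Series₂ ℂ)
        (fun b : ℕ => linearFactor ((b : ℤ) + 1 - e)) (fun I => inV (f I)) (fun J => inU (g J))
        I J := by
  rw [CommutingRel, commutingLHS, commutingRHS]
  simp only [scalar_smul, denom_eq, map_mul (scalar₂ A) (_ ^ _), map_pow]
  rfl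

lemma linearFactor_add_mul (c : ℤ) (m : ℤ) :
    linearFactor c + (m : Series₂ ℂ) * (PowerSeries.C PowerSeries.X * PowerSeries.X)
      = linearFactor (c + m) := by
  rw [linearFactor, linearFactor, add_smul, ← zsmul_eq_mul, add_assoc]

section Preservation

variable [NeZero n] {T : Fin n → Fin n → PowerSeries A}

lemma commuting_coactSeries (hT : IsRTT T) {d e : ℕ} {f : (Fin d → Fin n) → PowerSeries A}
    {g : (Fin e → Fin n) → PowerSeries A} (hf : IsAlternating f) (hg : IsAlternating g)
    (hTf : ∀ i j I r s, Commute (PowerSeries.coeff r (T i j)) (PowerSeries.coeff s (f I)))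
    (hTg : ∀ i j J r s, Commute (PowerSeries.coeff r (T i j)) (PowerSeries.coeff s (g J)))
    (h : ∀ I J, commutingLHS f g I J = commutingRHS f g I J) (I : Fin d → Fin n)
    (J : Fin e → Fin n) : commutingLHS (coactSeries T f) (coactSeries T g) I J
      = commutingRHS (coactSeries T f) (coactSeries T g) I J := by
  have hU : (fun J => inU (coactSeries T g J))
      = coact (fun k i j => inU (shift (-(k : ℤ)) (T i j))) fun J => inU (g J) :=
    funext fun J => map_coact (PowerSeries.C : PowerSeries A →+* Series₂ A) _ g J
  have hV : (fun I => inV (coactSeries T f I))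
      = coact (fun k i j => inV (shift (-(k : ℤ)) (T i j))) fun I => inV (f I) :=
    funext fun I => map_coact (PowerSeries.map (PowerSeries.C : A →+* PowerSeries A)) _ f I
  have hPU : IsDescending (Series₂ ℂ) fun (k : ℕ) i j => inU (shift (-(k : ℤ)) (T i j)) :=
    (isDescending_shift_neg ℂ hT).map (PowerSeries.C : PowerSeries A →+* Series₂ A)
  have hPV : IsDescending (Series₂ ℂ) fun (k : ℕ) i j => inV (shift (-(k : ℤ)) (T i j)) :=
    (isDescending_shift_neg ℂ hT).map (PowerSeries.map (PowerSeries.C : A →+* PowerSeries A))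
  have hf' : IsAlternating fun I => inV (f I) :=
    hf.map (PowerSeries.map (PowerSeries.C : A →+* PowerSeries A))
  have hg' : IsAlternating fun J => inU (g J) :=
    hg.map (PowerSeries.C : PowerSeries A →+* Series₂ A)
  rw [commuting_iff, hU, hV]
  refine CommutingRel.coact (fun b => ?_)
    hf' hg' hPU hPV (fun j _ b _ i i' k k' => ?_)
    (fun j _ b _ x hx => ?_)
    (fun k i j I => commute_inU_inV fun r s => commute_coeff_shift (hTf i j I) _ r s)
    (fun k i j J => (commute_inU_inV fun s r =>
      (commute_coeff_shift (hTg i j J) _ r s).symm).symm)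
    (fun I J => (commuting_iff _ _ I J).1 (h I J)) I J
  · have := linearFactor_add_mul ((b : ℤ) + 1 - e) 1
    rw [Int.cast_one, one_mul] at this
    rw [this]
    congr 1
    push_cast
    ring
  · have h1 := linearFactor_add_mul ((b : ℤ) + 1 - e) (e - (j + 1))
    push_cast at h1
    rw [h1, scalar_smul, scalar_smul, scalar₂_linearFactor]
    have h2 := hT.shift₂ (-(j : ℤ)) (-(b : ℤ)) i i' k k'
    rw [← uv_eq] at h2
    refine Eq.trans ?_ h2
    congr 2
    ring
  · have h1 := linearFactor_add_mul ((b : ℤ) + 1 - e) (e - j)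
    push_cast at h1
    rw [h1, scalar_smul, scalar₂_linearFactor] at hx
    exact eq_zero_of_linear₂_mul _ hx

lemma youngSum_coactSeries (hT : IsRTT T) {a p e : ℕ} {f : (Fin (a + p) → Fin n) → PowerSeries A}
    {g : (Fin e → Fin n) → PowerSeries A} (hf : IsAlternating f) (hg : IsAlternating g)
    (hTg : ∀ i j J r s, Commute (PowerSeries.coeff r (T i j)) (PowerSeries.coeff s (g J)))
    (h : ∀ I J, youngSum f g I J = 0) (I : Fin a → Fin n) (J : Sub n (p + e)) :
    youngSum (coactSeries T f) (coactSeries T g) I J = 0 := by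
  rw [youngSum_eq]
  simp only [shift_coactSeries]
  refine youngExpr_coact ℂ (hf.shift _) (hg.shift _) (isDescending_shift ℂ hT _)
    (isDescending_shift ℂ hT _) ?_ (fun k i j J => commute_shift (hTg i j J) _ _) h I J
  -- the parameters `u + e + p, …, u + p + 1` are followed by `u + p, …, u + 1`
  convert isDescending_shift ℂ hT ((e + p : ℕ) : ℤ) using 1
  funext k i j
  rcases lt_or_ge k e with h | h
  · rw [glue_of_lt _ _ h]
  · obtain ⟨k, rfl⟩ := Nat.exists_eq_add_of_le h
    rw [glue_add]
    congr 1
    push_cast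
    ring

lemma straightening_coactSeries (hT : IsRTT T) {a d : ℕ} {f : (Fin d → Fin n) → PowerSeries A}
    {g : (Fin (a + d) → Fin n) → PowerSeries A} (hf : IsAlternating f) (hg : IsAlternating g)
    (hTf : ∀ i j I r s, Commute (PowerSeries.coeff r (T i j)) (PowerSeries.coeff s (f I)))
    (hTg : ∀ i j J r s, Commute (PowerSeries.coeff r (T i j)) (PowerSeries.coeff s (g J)))
    (h : ∀ I J, straightenLHS f g I J = straightenRHS f g I J) (I : Sub n d) (J : Sub n (a + d)) :
    straightenLHS (coactSeries T f) (coactSeries T g) I J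
      = straightenRHS (coactSeries T f) (coactSeries T g) I J := by
  rw [straightenRHS_eq, straightenLHS]
  simp only [shift_coactSeries]
  have h := straightenExpr_coact ℂ (hf.shift d)
    (hg.shift (a + d : ℕ)) (isDescending_shift ℂ hT ((a + d : ℕ) : ℤ))
    (fun k i j J => commute_shift (hTf i j J) _ _) (fun k i j J => commute_shift (hTg i j J) _ _)
    h I J
  have e1 : ∀ k : ℕ, ((a + d : ℕ) : ℤ) - (a + k : ℕ) = d - k := fun k => by push_cast; ring
  simp only [e1] at h
  exact h

/-- The coaction preserves the relations of the flag algebra. -/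
theorem IsFlagFamily.coact {γ : Composition n}
    {F : ∀ d, d ∈ flagSizes γ → (Fin d → Fin n) → PowerSeries A} (hF : IsFlagFamily γ F)
    (hT : IsRTT T) (hTF : ∀ d hd i j I r s, Commute (PowerSeries.coeff r (T i j))
      (PowerSeries.coeff s (F d hd I))) :
    IsFlagFamily γ fun d hd => coactSeries T (F d hd) where
  alternating d hd := (hF.alternating d hd).coact ℂ (isDescending_shift_neg ℂ hT)
  commuting d e hd he hde := commuting_coactSeries hT (hF.alternating d hd) (hF.alternating e he)
    (hTF d hd) (hTF e he) (hF.commuting d e hd he hde)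
  young a p e hd he hp hde := youngSum_coactSeries hT (hF.alternating _ hd) (hF.alternating e he)
    (hTF e he) (hF.young a p e hd he hp hde)
  straightening a d hd he := straightening_coactSeries hT (hF.alternating d hd)
    (hF.alternating _ he) (hTF d hd) (hTF _ he) (hF.straightening a d hd he)

end Preservation

end Coaction

/-! ### The comodule algebra structure -/

section Comodule

variable {n : ℕ}

lemma map_coactSeries {A A' : Type*} [Ring A] [Ring A'] (φ : A →+* A')
    (T : Fin n → Fin n → PowerSeries A) {d : ℕ} (F : (Fin d → Fin n) → PowerSeries A)
    (I : Fin d → Fin n) : PowerSeries.map φ (coactSeries T F I) =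
      coactSeries (fun i j => PowerSeries.map φ (T i j)) (fun J => PowerSeries.map φ (F J)) I := by
  simp only [coactSeries, map_coact, shift_map]

/-- The products `tupleProd` are multiplicative for matrices whose entries commute with those of the
other string. -/
lemma sum_tupleProd_mul_tupleProd {B : Type*} [Ring B] {P Q : ℕ → Fin n → Fin n → B}
    (h : ∀ k l i j i' j', Commute (P k i j) (Q l i' j')) {d : ℕ} (K I : Fin d → Fin n) :
    ∑ J, tupleProd P K J * tupleProd Q J I
      = tupleProd (fun k i j => ∑ l, P k i l * Q k l j) K I := by
  induction d generalizing P Q with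
  | zero => simp [tupleProd]
  | succ d ih =>
    obtain ⟨x, rfl⟩ : ∃ x : Fin n × (Fin d → Fin n), K = Fin.cons x.1 x.2 :=
      ⟨(K 0, Fin.tail K), (Fin.cons_self_tail K).symm⟩
    rw [tupleProd_cons, ← ih fun k l => h (k + 1) (l + 1), Finset.sum_mul_sum,
      ← (Fin.consEquiv fun _ => Fin n).sum_comp, Fintype.sum_prod_type]
    refine Finset.sum_congr rfl fun j _ => Finset.sum_congr rfl fun J _ => ?_
    have h1 : Commute (tupleProd (fun k => P (k + 1)) x.2 J) (Q 0 j (I 0)) :=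
      tupleProd_commute (fun k i' j' => h _ _ _ _ _ _) _ _
    change tupleProd P (Fin.cons x.1 x.2 : Fin (d + 1) → Fin n) (Fin.cons j J : Fin (d + 1) → Fin n)
      * tupleProd Q (Fin.cons j J : Fin (d + 1) → Fin n) I = _
    rw [tupleProd_cons, tupleProd_cons]
    simp only [Fin.cons_zero, Fin.cons_succ]
    rw [mul_assoc, ← mul_assoc _ (Q 0 j (I 0)), h1.eq, mul_assoc, ← mul_assoc]

lemma coactSeries_coactSeries {A : Type*} [Ring A] {T U : Fin n → Fin n → PowerSeries A}
    (h : ∀ i j i' j' r s, Commute (PowerSeries.coeff r (T i j)) (PowerSeries.coeff s (U i' j')))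
    {d : ℕ} (F : (Fin d → Fin n) → PowerSeries A) (I : Fin d → Fin n) :
    coactSeries U (coactSeries T F) I
      = coactSeries (fun i j => ∑ l, T i l * U l j) F I := by
  have h1 : ∀ (k : ℕ) i j, shift (-(k : ℤ)) (∑ l, T i l * U l j)
      = ∑ l, shift (-(k : ℤ)) (T i l) * shift (-(k : ℤ)) (U l j) := by
    intro k i j
    rw [← shiftHom_apply, map_sum]
    exact Finset.sum_congr rfl fun l _ => shift_mul _ _ _
  unfold coactSeries
  simp only [h1]
  unfold coact
  simp only [Finset.sum_mul]
  rw [Finset.sum_comm]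
  refine Finset.sum_congr rfl fun K _ => ?_
  simp only [mul_assoc]
  rw [← Finset.mul_sum, sum_tupleProd_mul_tupleProd]
  intro k l i j i' j'
  exact commute_shift (h i j i' j') _ _

lemma tupleProd_one {B : Type*} [Ring B] {d : ℕ} (J I : Fin d → Fin n) :
    tupleProd (fun _ i j => if i = j then (1 : B) else 0) J I = if J = I then 1 else 0 := by
  induction d with
  | zero => simp [tupleProd, Subsingleton.elim J I]
  | succ d ih =>
    obtain ⟨x, rfl⟩ : ∃ x : Fin n × (Fin d → Fin n), J = Fin.cons x.1 x.2 :=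
      ⟨(J 0, Fin.tail J), (Fin.cons_self_tail J).symm⟩
    obtain ⟨y, rfl⟩ : ∃ y : Fin n × (Fin d → Fin n), I = Fin.cons y.1 y.2 :=
      ⟨(I 0, Fin.tail I), (Fin.cons_self_tail I).symm⟩
    rw [tupleProd_cons, ih]
    by_cases h1 : x.1 = y.1 <;> by_cases h2 : x.2 = y.2 <;> simp [Fin.cons_inj, h1, h2]

lemma coactSeries_one {A : Type*} [Ring A] {d : ℕ} (F : (Fin d → Fin n) → PowerSeries A)
    (I : Fin d → Fin n) : coactSeries (fun i j => if i = j then 1 else 0) F I = F I := by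
  have h1 : ∀ (k : ℕ) (i j : Fin n), shift (-(k : ℤ)) (if i = j then (1 : PowerSeries A) else 0)
      = if i = j then 1 else 0 := by
    intro k i j
    rw [← shiftHom_apply]
    split_ifs
    · exact map_one _
    · exact map_zero _
  simp only [coactSeries, h1, coact, tupleProd_one, mul_ite, mul_one, mul_zero,
    Finset.sum_ite_eq', Finset.mem_univ, if_true]

/-- If the constant terms of a family vanish, so do those of its image under the coaction. -/
lemma coeff_zero_coactSeries {A : Type*} [Ring A] {T : Fin n → Fin n → PowerSeries A} {d : ℕ}
    {F : (Fin d → Fin n) → PowerSeries A} (h : ∀ J, PowerSeries.coeff 0 (F J) = 0)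
    (I : Fin d → Fin n) : PowerSeries.coeff 0 (coactSeries T F I) = 0 := by
  simp only [coactSeries, coact, map_sum, PowerSeries.coeff_mul, Finset.Nat.antidiagonal_zero,
    Finset.sum_singleton, h, zero_mul, Finset.sum_const_zero]

variable {A : Type*} [Ring A] [Algebra ℂ A]

/-- The matrix `1 ⊗ T(u)`. -/
def rightT (A : Type*) [Ring A] [Algebra ℂ A] (i j : Fin n) : PowerSeries (A ⊗[ℂ] Yangian n) :=
  PowerSeries.map (Algebra.TensorProduct.includeRight : Yangian n →ₐ[ℂ] A ⊗[ℂ] Yangian n).toRingHom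
    (Yangian.tSeries i j)

/-- The series `f(u) ⊗ 1`. -/
def leftSeries (f : PowerSeries A) : PowerSeries (A ⊗[ℂ] Yangian n) :=
  PowerSeries.map (Algebra.TensorProduct.includeLeft : A →ₐ[ℂ] A ⊗[ℂ] Yangian n).toRingHom f

lemma rightT_isRTT : IsRTT (rightT (n := n) A) := by
  have h := isRTT_of_coeff (fun i j a => by
    rw [Yangian.t_zero]
    split_ifs
    · rw [map_one]
      exact Commute.one_left a
    · rw [map_zero]
      exact Commute.zero_left a) ((Yangian.isRTTCoeff n).map
    (Algebra.TensorProduct.includeRight : Yangian n →ₐ[ℂ] A ⊗[ℂ] Yangian n).toRingHom)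
  convert h using 3
  ext r
  simp [rightT, Yangian.tSeries]

/-- The coaction formula, with minors, as a sum over all tuples. -/
lemma sum_tensorSeries_minor {d : ℕ} {f : (Fin d → Fin n) → PowerSeries A} (hf : IsAlternating f)
    (I : Fin d → Fin n) : ∑ J : Sub n d, tensorSeries (f J.tup) (Yangian.minor J.tup I)
      = coactSeries (rightT A) (fun J => leftSeries (f J)) I := by
  have hf' : IsAlternating fun J => (leftSeries (f J) : PowerSeries (A ⊗[ℂ] Yangian n)) :=
    hf.map (PowerSeries.map
      (Algebra.TensorProduct.includeLeft : A →ₐ[ℂ] A ⊗[ℂ] Yangian n).toRingHom)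
  rw [coactSeries, coact, sum_tuples_eq]
  · refine Finset.sum_congr rfl fun J _ => ?_
    rw [tensorSeries_eq_mul, Yangian.minor, map_sum, Finset.mul_sum]
    refine Finset.sum_congr rfl fun σ _ => ?_
    rw [show leftSeries (f (J.tup ∘ σ)) = _ from hf' σ J.tup, map_zsmul, mul_smul_comm,
      smul_mul_assoc, map_list_prod, List.map_ofFn, tupleProd]
    refine congrArg _ (congrArg _ (congrArg _ (congrArg _ (funext fun k => ?_))))
    exact shift_map _ _ _
  · intro t ht
    rw [hf'.eq_zero ht, zero_mul]

lemma commute_rightT_leftSeries (i j : Fin n) (f : PowerSeries A) (r s : ℕ) :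
    Commute (PowerSeries.coeff r (rightT A i j))
      (PowerSeries.coeff s (leftSeries f : PowerSeries (A ⊗[ℂ] Yangian n))) := by
  simp [rightT, leftSeries, Commute, SemiconjBy]

lemma Yangian.map_counit_tSeries (i j : Fin n) :
    PowerSeries.map (Yangian.counit n).toRingHom (Yangian.tSeries i j)
      = if i = j then 1 else 0 := by
  ext r
  rw [PowerSeries.coeff_map]
  simp only [Yangian.tSeries, PowerSeries.coeff_mk]
  refine (Yangian.counit_t i j r).trans ?_
  split_ifs <;> simp_all [PowerSeries.coeff_one]

/-- An algebra map given by the coaction formula on generators is coassociative and counital. -/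
lemma isRightComoduleAlgebra_of_map_f {γ : Composition n} {r₀ : ℕ}
    {ρ : FlagAlgebra γ r₀ →ₐ[ℂ] FlagAlgebra γ r₀ ⊗[ℂ] Yangian n}
    (hρ : ∀ (d : ℕ) (hd : d ∈ flagSizes γ) I, PowerSeries.map ρ.toRingHom (FlagAlgebra.f γ r₀ hd I)
      = coactSeries (rightT _) (fun J => leftSeries (FlagAlgebra.f γ r₀ hd J)) I) :
    IsRightComoduleAlgebra ρ where
  coassoc := by
    refine FlagAlgebra.hom_ext fun d hd I => ?_
    -- the three embeddings into the triple tensor product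
    let i₁ : FlagAlgebra γ r₀ →ₐ[ℂ] FlagAlgebra γ r₀ ⊗[ℂ] (Yangian n ⊗[ℂ] Yangian n) :=
      Algebra.TensorProduct.includeLeft
    let i₂ : Yangian n →ₐ[ℂ] FlagAlgebra γ r₀ ⊗[ℂ] (Yangian n ⊗[ℂ] Yangian n) :=
      (Algebra.TensorProduct.includeRight).comp Algebra.TensorProduct.includeLeft
    let i₃ : Yangian n →ₐ[ℂ] FlagAlgebra γ r₀ ⊗[ℂ] (Yangian n ⊗[ℂ] Yangian n) :=
      (Algebra.TensorProduct.includeRight).comp Algebra.TensorProduct.includeRight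
    set Ψ := (Algebra.TensorProduct.assoc ℂ ℂ ℂ (FlagAlgebra γ r₀) (Yangian n)
      (Yangian n)).toAlgHom.comp (Algebra.TensorProduct.map ρ (AlgHom.id ℂ (Yangian n))) with hΨ
    set Ω := Algebra.TensorProduct.map (AlgHom.id ℂ (FlagAlgebra γ r₀))
      (Bialgebra.comulAlgHom ℂ (Yangian n)) with hΩ
    set α : FlagAlgebra γ r₀ ⊗[ℂ] Yangian n →ₐ[ℂ] FlagAlgebra γ r₀ ⊗[ℂ] (Yangian n ⊗[ℂ] Yangian n)
      := Algebra.TensorProduct.map (AlgHom.id ℂ _) Algebra.TensorProduct.includeLeft with hα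
    have hcomp : ∀ {R S T : Type} [Ring R] [Ring S] [Ring T] [Algebra ℂ R] [Algebra ℂ S]
        [Algebra ℂ T] (φ : S →ₐ[ℂ] T) (ψ : R →ₐ[ℂ] S) (f : PowerSeries R),
        PowerSeries.map (φ.comp ψ).toRingHom f
          = PowerSeries.map φ.toRingHom (PowerSeries.map ψ.toRingHom f) :=
      fun φ ψ f => by ext r; simp
    have h1 : Ψ.comp Algebra.TensorProduct.includeLeft = α.comp ρ := by
      have : ∀ x : FlagAlgebra γ r₀ ⊗[ℂ] Yangian n,
          Algebra.TensorProduct.assoc ℂ ℂ ℂ (FlagAlgebra γ r₀) (Yangian n) (Yangian n)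
            (x ⊗ₜ[ℂ] 1) = α x := by
        intro x
        induction x with
        | zero => simp
        | add x y hx hy => rw [TensorProduct.add_tmul, map_add, map_add, hx, hy]
        | tmul a h => simp [hα]
      refine AlgHom.ext fun x => ?_
      simpa [hΨ] using this (ρ x)
    have h2 : Ψ.comp Algebra.TensorProduct.includeRight = i₃ := by
      refine AlgHom.ext fun x => ?_
      simp [hΨ, i₃, Algebra.TensorProduct.one_def]
    have h3 : α.comp Algebra.TensorProduct.includeLeft = i₁ := by
      refine AlgHom.ext fun x => ?_
      simp [hα, i₁, Algebra.TensorProduct.one_def]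
    have h4 : α.comp Algebra.TensorProduct.includeRight = i₂ := by
      refine AlgHom.ext fun x => ?_
      simp [hα, i₂]
    have h5 : Ω.comp Algebra.TensorProduct.includeLeft = i₁ := by
      refine AlgHom.ext fun x => ?_
      simp [hΩ, i₁, Algebra.TensorProduct.one_def]
    have h6 : ∀ i j, PowerSeries.map Ω.toRingHom (rightT (FlagAlgebra γ r₀) i j)
        = ∑ l, PowerSeries.map i₂.toRingHom (Yangian.tSeries i l)
          * PowerSeries.map i₃.toRingHom (Yangian.tSeries l j) := by
      intro i j
      rw [rightT, ← hcomp]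
      have : Ω.comp Algebra.TensorProduct.includeRight
          = (Algebra.TensorProduct.includeRight).comp (Yangian.comul n) :=
        AlgHom.ext fun x => by simp [hΩ]; rfl
      rw [this, hcomp]
      have hΔ : PowerSeries.map (Yangian.comul n).toRingHom (Yangian.tSeries i j)
          = Yangian.comulSeries i j := by
        ext r
        rw [Yangian.coeff_comulSeries, ← Yangian.comul_t]
        simp [Yangian.tSeries]
      rw [hΔ, Yangian.comulSeries, map_sum]
      refine Finset.sum_congr rfl fun l _ => ?_
      rw [tensorSeries_eq_mul, map_mul, ← hcomp, ← hcomp]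
    rw [← AlgHom.comp_assoc, ← hΨ, hcomp Ψ ρ, hcomp Ω ρ, hρ, map_coactSeries, map_coactSeries]
    have e1 : ∀ i j, PowerSeries.map Ψ.toRingHom (rightT (FlagAlgebra γ r₀) i j)
        = PowerSeries.map i₃.toRingHom (Yangian.tSeries i j) := fun i j => by
      rw [rightT, ← hcomp, h2]
    have e2 : (fun J => PowerSeries.map Ψ.toRingHom (leftSeries (FlagAlgebra.f γ r₀ hd J)))
        = coactSeries (fun i j => PowerSeries.map i₂.toRingHom (Yangian.tSeries i j))
          fun J => PowerSeries.map i₁.toRingHom (FlagAlgebra.f γ r₀ hd J) := by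
      funext J
      rw [leftSeries, ← hcomp, h1, hcomp, hρ, map_coactSeries]
      simp only [rightT, leftSeries, ← hcomp, h3, h4]
    have e3 : ∀ J, PowerSeries.map Ω.toRingHom (leftSeries (FlagAlgebra.f γ r₀ hd J))
        = PowerSeries.map i₁.toRingHom (FlagAlgebra.f γ r₀ hd J) := fun J => by
      rw [leftSeries, ← hcomp, h5]
    simp only [e1, e2, e3, h6]
    refine coactSeries_coactSeries (fun i j i' j' r s => ?_) _ _
    simp [i₂, i₃, Commute, SemiconjBy]
  counit := by
    refine FlagAlgebra.hom_ext fun d hd I => ?_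
    set Ω := (Algebra.TensorProduct.rid ℂ ℂ (FlagAlgebra γ r₀)).toAlgHom.comp
      (Algebra.TensorProduct.map (AlgHom.id ℂ (FlagAlgebra γ r₀))
        (Bialgebra.counitAlgHom ℂ (Yangian n))) with hΩ
    have hcomp : ∀ {R S T : Type} [Ring R] [Ring S] [Ring T] [Algebra ℂ R] [Algebra ℂ S]
        [Algebra ℂ T] (φ : S →ₐ[ℂ] T) (ψ : R →ₐ[ℂ] S) (f : PowerSeries R),
        PowerSeries.map (φ.comp ψ).toRingHom f
          = PowerSeries.map φ.toRingHom (PowerSeries.map ψ.toRingHom f) :=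
      fun φ ψ f => by ext r; simp
    have h1 : Ω.comp Algebra.TensorProduct.includeLeft = AlgHom.id ℂ _ :=
      AlgHom.ext fun x => by simp [hΩ]
    have h2 : Ω.comp Algebra.TensorProduct.includeRight
        = (Algebra.ofId ℂ (FlagAlgebra γ r₀)).comp (Yangian.counit n) :=
      AlgHom.ext fun x => by
        simp [hΩ, Algebra.ofId_apply, Algebra.algebraMap_eq_smul_one]
        rfl
    rw [← AlgHom.comp_assoc, ← hΩ, hcomp Ω ρ, hρ, map_coactSeries]
    have e1 : ∀ i j, PowerSeries.map Ω.toRingHom (rightT (FlagAlgebra γ r₀) i j)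
        = if i = j then 1 else 0 := fun i j => by
      rw [rightT, ← hcomp, h2, hcomp, Yangian.map_counit_tSeries]
      split_ifs <;> simp
    have e2 : ∀ J, PowerSeries.map Ω.toRingHom (leftSeries (FlagAlgebra.f γ r₀ hd J))
        = PowerSeries.map (AlgHom.id ℂ (FlagAlgebra γ r₀)).toRingHom
          (FlagAlgebra.f γ r₀ hd J) := fun J => by
      rw [leftSeries, ← hcomp, h1]
    simp only [e1, e2]
    exact coactSeries_one _ I

end Comodule

end YangianFlag

end

theorem mainTheorem1 (n : ℕ) (hn : 0 < n) (γ : Composition n) (r₀ : ℕ) (hr₀ : r₀ ≤ 1) :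
    ∃! ρ : FlagAlgebra γ r₀ →ₐ[ℂ] FlagAlgebra γ r₀ ⊗[ℂ] Yangian n,
      (∀ (d : ℕ) (hd : d ∈ flagSizes γ) (I : Fin d → Fin n),
        PowerSeries.map ρ.toRingHom (FlagAlgebra.f γ r₀ hd I) =
          ∑ J : Sub n d,
            tensorSeries (FlagAlgebra.f γ r₀ hd J.tup) (Yangian.minor J.tup I)) ∧
      IsRightComoduleAlgebra ρ := by
  have : NeZero n := ⟨hn.ne'⟩
  have hf := FlagAlgebra.isFlagFamily γ r₀
  have hformula : ∀ (d : ℕ) (hd : d ∈ flagSizes γ) (I : Fin d → Fin n),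
      ∑ J : Sub n d, tensorSeries (FlagAlgebra.f γ r₀ hd J.tup) (Yangian.minor J.tup I)
        = coactSeries (rightT _) (fun J => leftSeries (FlagAlgebra.f γ r₀ hd J)) I :=
    fun d hd I => sum_tensorSeries_minor (hf.alternating d hd) I
  simp only [hformula]
  obtain ⟨ρ, hρ⟩ := FlagAlgebra.exists_lift (r₀ := r₀) (IsFlagFamily.coact
    (hf.map (Algebra.TensorProduct.includeLeft :
      FlagAlgebra γ r₀ →ₐ[ℂ] FlagAlgebra γ r₀ ⊗[ℂ] Yangian n))
    (rightT_isRTT (A := FlagAlgebra γ r₀))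
    fun d hd i j I r s => commute_rightT_leftSeries i j _ r s) (fun d hd I r hr => by
      obtain rfl : r = 0 := by omega
      refine coeff_zero_coactSeries (fun J => ?_) I
      rw [PowerSeries.coeff_map, FlagAlgebra.coeff_f_of_lt γ r₀ hd J hr, map_zero])
  refine ⟨ρ, ⟨hρ, isRightComoduleAlgebra_of_map_f hρ⟩, fun ρ' hρ' => ?_⟩
  exact FlagAlgebra.hom_ext fun d hd I => (hρ'.1 d hd I).trans (hρ d hd I).symm
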